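/- A combinatorial map is a quadruple $\mathcal M=(F;\lambda,\rho,\tau)$ where $F$ is a finite nonempty set (of flags) and $\lambda,\rho,\tau$ are fixed-point-free involutory permutations of $F$ such that $\lambda\tau=\tau\lambda$ and $\langle\lambda,\rho,\tau\rangle$ acts transitively on $F$. Its vertices and edges are the orbits of $\langle\rho,\tau\rangle$ and of $\langle\lambda,\tau\rangle$ on $F$, a vertex and an edge being incident when they intersect; $\mathcal M$ is an embedding of a graph $G$ if the graph so obtained is isomorphic to $G$. An isomorphism of combinatorial maps is a bijection of the flag sets that intertwines the respective involutions $\lambda,\rho,\tau$. The map $\mathcal M$ is regular if its group of automorphisms (isomorphisms from $\mathcal M$ to itself) acts regularly on $F$, and nonorientable if the subgroup $\langle\rho\tau,\tau\lambda\rangle$ acts transitively on $F$. Theorem. Let $K_{n,n}$ be the complete bipartite graph with both parts of size $n$. (1) If $n\equiv 0$, $1$ or $3 \pmod 4$, then $K_{n,n}$ has no nonorientable regular embedding. (2) Let $n=2p_1^{a_1}p_2^{a_2}\cdots p_k^{a_k}$ with $k\ge 0$, distinct primes $p_1,\dots,p_k$ and exponents $a_i\ge 1$. Then the number of nonorientable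 regular embeddings of $K_{n,n}$ up to isomorphism of maps is $2^k$ if $p_i\equiv\pm1\pmod 8$ for all $i=1,\dots,k$, and $0$ otherwise. -/

import Mathlib

/-- A combinatorial map: a finite nonempty set of flags with three fixed-point-free involutions,
the longitudinal one `lam`, the rotary one `rho` and the transversal one `tau`, such that `lam` and
`tau` commute and the three together generate a transitive group. -/
structure CombMap where
  Flag : Type
  finite_flag : Finite Flag
  nonempty_flag : Nonempty Flag
  lam : Equiv.Perm Flag
  rho : Equiv.Perm Flag
  tau : Equiv.Perm Flag
  lam_mul_self : lam * lam = 1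
  rho_mul_self : rho * rho = 1
  tau_mul_self : tau * tau = 1
  lam_ne : ∀ x, lam x ≠ x
  rho_ne : ∀ x, rho x ≠ x
  tau_ne : ∀ x, tau x ≠ x
  lam_tau_comm : lam * tau = tau * lam
  transitive : MulAction.IsPretransitive (Subgroup.closure {lam, rho, tau}) Flag

namespace CombMap

/-- The vertices: orbits of `⟨ρ, τ⟩`. -/
def Vertex (M : CombMap) : Type :=
  MulAction.orbitRel.Quotient (Subgroup.closure {M.rho, M.tau}) M.Flag

/-- The edges: orbits of `⟨λ, τ⟩`. -/
def Edge (M : CombMap) : Type :=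
  MulAction.orbitRel.Quotient (Subgroup.closure {M.lam, M.tau}) M.Flag

/-- The vertex of a flag. -/
def vertexOf (M : CombMap) (x : M.Flag) : M.Vertex :=
  Quotient.mk (MulAction.orbitRel (Subgroup.closure {M.rho, M.tau}) M.Flag) x

/-- The edge of a flag. -/
def edgeOf (M : CombMap) (x : M.Flag) : M.Edge :=
  Quotient.mk (MulAction.orbitRel (Subgroup.closure {M.lam, M.tau}) M.Flag) x

/-- A vertex and an edge are incident when the two orbits have a flag in common. -/
def Incident (M : CombMap) (v : M.Vertex) (e : M.Edge) : Prop :=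
  ∃ x : M.Flag, M.vertexOf x = v ∧ M.edgeOf x = e

/-- `M` is an embedding of the simple graph `G`: its underlying graph (vertices, edges and their
incidence) is isomorphic to `G`. As every edge of `G` has two distinct ends, this excludes loops,
multiple edges and degenerate edges (flags fixed by `λτ`) in `M`. -/
def IsEmbeddingOf (M : CombMap) {V : Type} (G : SimpleGraph V) : Prop :=
  ∃ (f : M.Vertex ≃ V) (g : M.Edge ≃ G.edgeSet),
    ∀ v e, M.Incident v e ↔ f v ∈ (g e : Sym2 V)

/-- Map isomorphisms: bijections of the flags that intertwine the three involutions. -/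
structure Iso (M N : CombMap) where
  toEquiv : M.Flag ≃ N.Flag
  map_lam : ∀ x, toEquiv (M.lam x) = N.lam (toEquiv x)
  map_rho : ∀ x, toEquiv (M.rho x) = N.rho (toEquiv x)
  map_tau : ∀ x, toEquiv (M.tau x) = N.tau (toEquiv x)

/-- `M` is regular: its automorphisms act regularly on the flags. -/
def IsRegular (M : CombMap) : Prop :=
  ∀ x y : M.Flag, ∃! φ : Iso M M, φ.toEquiv x = y

/-- `M` is nonorientable: the even-word subgroup `⟨ρτ, τλ⟩` is transitive on the flags. -/
def IsNonorientable (M : CombMap) : Prop :=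
  MulAction.IsPretransitive (Subgroup.closure {M.rho * M.tau, M.tau * M.lam}) M.Flag

/-- `M` is a nonorientable regular embedding of the graph `G`. -/
def IsNonorientableRegularEmbedding (M : CombMap) {V : Type} (G : SimpleGraph V) : Prop :=
  M.IsEmbeddingOf G ∧ M.IsRegular ∧ M.IsNonorientable

/-- The relation of being isomorphic, as an equivalence relation on combinatorial maps. -/
def isoSetoid : Setoid CombMap where
  r M N := Nonempty (Iso M N)
  iseqv :=
    { refl := fun _ => ⟨⟨Equiv.refl _, fun _ => rfl, fun _ => rfl, fun _ => rfl⟩⟩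
      symm := fun ⟨φ⟩ => ⟨⟨φ.toEquiv.symm,
        fun x => by rw [Equiv.symm_apply_eq, φ.map_lam, Equiv.apply_symm_apply],
        fun x => by rw [Equiv.symm_apply_eq, φ.map_rho, Equiv.apply_symm_apply],
        fun x => by rw [Equiv.symm_apply_eq, φ.map_tau, Equiv.apply_symm_apply]⟩⟩
      trans := fun ⟨φ⟩ ⟨ψ⟩ => ⟨⟨φ.toEquiv.trans ψ.toEquiv,
        fun x => by simp [φ.map_lam, ψ.map_lam],
        fun x => by simp [φ.map_rho, ψ.map_rho],
        fun x => by simp [φ.map_tau, ψ.map_tau]⟩⟩ }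

end CombMap

/-- The number (possibly infinite a priori) of nonorientable regular embeddings of `G` up to
isomorphism of maps. -/
noncomputable def numNonorientableRegularEmbeddings {V : Type} (G : SimpleGraph V) : ℕ∞ :=
  Set.encard ((fun M : CombMap => (Quotient.mk CombMap.isoSetoid M)) ''
    {M : CombMap | M.IsNonorientableRegularEmbedding G})

/-! A regular embedding of `K_{n,n}` is encoded in its group `G` of colour-preserving monodromies,
of order `2 * n ^ 2`. With `r = ρτ`, `s = λrλ` and `t = τ`, every element of `G` is uniquely `s ^ j
* r ^ i` or `s ^ j * r ^ i * t`; `t` inverts both rotations, and conjugation by `λ` is an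
automorphism `l` that exchanges them. Nonorientability becomes the condition `t ∈ ⟨r, s⟩`, so a
homomorphism to `{1, -1}` is determined by its values on `r` and `s`. Most of the argument plays
this against sign characters of coset actions: an involution acting freely on the cosets of a
subgroup of index `2k` has sign `(-1) ^ k`.

Odd `n` is excluded by the regular representation (`not_odd`). Suppose `4 ∣ n`. On the cosets of
`⟨r, t⟩` both `s` and `t` are odd. If `r` is even there, a Sylow 2-subgroup compatible with the
factorization gives a contradiction (`not_four_dvd_of_sign_r`). If `r` is odd there, every sign
character takes equal values on `r`, `s`, `t`; then `r ^ (n / 2)` and `s ^ (n / 2)` are central, and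
dividing by the four-group they generate halves the degree until it is twice an odd number, where
`s` is odd and `t` is even (`false_of_sign_eq`).

Let `n = 2m` with `m` odd. Some sign character separates `r` from `s` (`exists_sign_ne`), which
makes `⟨r², s²⟩` a normal subgroup of order `m ^ 2`; `t` acts on it without nontrivial fixed points,
so it is abelian (`exists_normal_subgroup`). The half-turns `r ^ m`, `s ^ m` act on it, and their
relations leave a single parameter `x` with `x² = 2` in `ℤ/m` (`exists_relations`).

Conversely, if `x² = 2`, the matrix with rows `(x, 1)` and `(-1, 0)` has fourth power `-1`, so the
dihedral group of order 16 acts on `(ℤ/m)²`. The semidirect product carries a map with the required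
properties; every embedding is isomorphic to one of these, and a relation between the rotations
recovers `x`. The count is therefore that of square roots of 2 modulo `m`: by quadratic reciprocity
for 2, Hensel lifting and the Chinese remainder theorem it is `2 ^ k` or `0`. -/

/-! ### Signs of coset actions -/

/-- The sign of the permutation of `G ⧸ U` induced by an element of `G`. -/
noncomputable def cosetSign {G : Type*} [Group G] [Finite G] (U : Subgroup G) : G →* ℤˣ :=
  let _ := Fintype.ofFinite (G ⧸ U)
  let _ := Classical.decEq (G ⧸ U)
  Equiv.Perm.sign.comp (MulAction.toPermHom G (G ⧸ U))

/-- The involution is a product of `k` disjoint transpositions. -/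
theorem sign_eq_of_involution {α : Type*} [Fintype α] [DecidableEq α] (σ : Equiv.Perm α)
    (h : σ ^ 2 = 1) (c k : ℕ) (hc : Nat.card {x // σ x = x} = c) (hk : Nat.card α = c + 2 * k) :
    Equiv.Perm.sign σ = (-1) ^ k := by
  rw [Equiv.Perm.sign_of_pow_two_eq_one h]
  congr 1
  have h1 : Fintype.card (Function.fixedPoints σ) = c := by
    rw [← Nat.card_eq_fintype_card]; exact hc
  rw [← Nat.card_eq_fintype_card, hk, h1]
  omega

theorem cosetSign_eq_of_fixed {G : Type*} [Group G] [Finite G] (U : Subgroup G) (g : G)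
    (hg : g * g = 1) (c k : ℕ) (hc : Nat.card {x : G ⧸ U // g • x = x} = c)
    (hk : U.index = c + 2 * k) : cosetSign U g = (-1) ^ k := by
  let _ := Fintype.ofFinite (G ⧸ U)
  let _ := Classical.decEq (G ⧸ U)
  refine sign_eq_of_involution (MulAction.toPermHom G (G ⧸ U) g) ?_ c k hc hk
  rw [← map_pow, pow_two, hg, map_one]

/-- The coset `xU` is fixed by `g` exactly when `x⁻¹ * g * x ∈ U`, so `hf` says that there are no
fixed points. An index that is twice an odd number gives sign `-1`. -/
theorem cosetSign_eq_of_free {G : Type*} [Group G] [Finite G] (U : Subgroup G) (g : G)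
    (hg : g * g = 1) (k : ℕ) (hf : ∀ x : G, x⁻¹ * g * x ∉ U)
    (hk : U.index = 2 * k) : cosetSign U g = (-1) ^ k := by
  refine cosetSign_eq_of_fixed U g hg 0 k ?_ (by omega)
  have : IsEmpty {x : G ⧸ U // g • x = x} := by
    refine ⟨fun ⟨x, hx⟩ => ?_⟩
    induction x using QuotientGroup.induction_on with
    | H x =>
      rw [MulAction.Quotient.smul_mk, eq_comm, QuotientGroup.eq] at hx
      exact hf x (by simpa [mul_assoc] using hx)
  exact Nat.card_of_isEmpty

theorem units_int_eq_one_of_pow_odd (u : ℤˣ) (k : ℕ) (hk : Odd k) (h : u ^ k = 1) : u = 1 := by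
  rcases Int.units_eq_one_or u with rfl | rfl
  · rfl
  · rw [hk.neg_one_pow] at h; exact h

theorem hom_eq_one_of_pow_odd {G : Type*} [Group G] (χ : G →* ℤˣ) (g : G) (k : ℕ) (hk : Odd k)
    (h : g ^ k = 1) : χ g = 1 :=
  units_int_eq_one_of_pow_odd _ k hk (by rw [← map_pow, h, map_one])

theorem cosetSign_eq_one_of_smul {G : Type*} [Group G] [Finite G] (U : Subgroup G) (g : G)
    (hg : ∀ x : G, x⁻¹ * g * x ∈ U) : cosetSign U g = 1 := by
  have : MulAction.toPermHom G (G ⧸ U) g = 1 := by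
    ext x
    induction x using QuotientGroup.induction_on with
    | H x =>
      change g • (x : G ⧸ U) = x
      rw [MulAction.Quotient.smul_mk, eq_comm, QuotientGroup.eq]
      simpa [mul_assoc] using hg x
  simp [cosetSign, this]

/-- An automorphism preserving `U` permutes the cosets, and this permutation conjugates the action
of `g` into that of `l g`. -/
theorem cosetSign_map {G : Type*} [Group G] [Finite G] (U : Subgroup G) (l : G ≃* G)
    (hU : ∀ x, l x ∈ U ↔ x ∈ U) (g : G) : cosetSign U (l g) = cosetSign U g := by
  let _ := Fintype.ofFinite (G ⧸ U)
  let _ := Classical.decEq (G ⧸ U)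
  let E : G ⧸ U ≃ G ⧸ U := Quotient.congr l.toEquiv (by
    intro a b
    change QuotientGroup.leftRel U a b ↔ QuotientGroup.leftRel U (l a) (l b)
    rw [QuotientGroup.leftRel_apply, QuotientGroup.leftRel_apply, ← map_inv, ← map_mul, hU])
  symm
  refine Equiv.Perm.sign_eq_sign_of_equiv (MulAction.toPermHom G (G ⧸ U) g)
    (MulAction.toPermHom G (G ⧸ U) (l g)) E ?_
  intro x
  induction x using QuotientGroup.induction_on with
  | H x =>
    change E (g • (x : G ⧸ U)) = l g • E (x : G ⧸ U)
    have hE : ∀ y : G, E (y : G ⧸ U) = ((l y : G) : G ⧸ U) := fun y => rfl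
    rw [MulAction.Quotient.smul_mk, hE, hE, MulAction.Quotient.smul_mk]
    simp

/-! ### Rotary systems -/

/-- The group-theoretic data of a regular map with underlying graph `K_{n,n}`: the group of
colour-preserving automorphisms is an exact product of two dihedral groups of order `2n` sharing
a reflection `t`, with rotations `r`, `s` swapped by an automorphism `l` fixing `t`. -/
structure IsRotarySystem {G : Type*} [Group G] (n : ℕ) (r s t : G) (l : G ≃* G) : Prop where
  r_pow : r ^ n = 1
  s_pow : s ^ n = 1
  t_mul : t * t = 1
  t_r : t * r * t = r⁻¹
  t_s : t * s * t = s⁻¹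
  l_r : l r = s
  l_s : l s = r
  l_t : l t = t
  card_eq : Nat.card G = 2 * n ^ 2
  exists_eq : ∀ g, ∃ j i : ℤ, g = s ^ j * r ^ i ∨ g = s ^ j * r ^ i * t

namespace IsRotarySystem

variable {G : Type*} [Group G] {n : ℕ} {r s t : G} {l : G ≃* G}

theorem t_zpow_of {g : G} (ht : t * t = 1) (h : t * g * t = g⁻¹) (i : ℤ) :
    t * g ^ i * t = g ^ (-i) := by
  have hinv : t⁻¹ = t := inv_eq_of_mul_eq_one_right ht
  have := conj_zpow (a := t) (b := g) (i := i)
  rw [hinv, h] at this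
  rw [← this, zpow_neg, inv_zpow]

theorem t_rz (h : IsRotarySystem n r s t l) (i : ℤ) : t * r ^ i * t = r ^ (-i) :=
  t_zpow_of h.t_mul h.t_r i

theorem t_sz (h : IsRotarySystem n r s t l) (i : ℤ) : t * s ^ i * t = s ^ (-i) :=
  t_zpow_of h.t_mul h.t_s i

theorem t_rz' (h : IsRotarySystem n r s t l) (i : ℤ) : t * r ^ i = r ^ (-i) * t := by
  rw [← h.t_rz, mul_assoc, h.t_mul, mul_one]

theorem t_sz' (h : IsRotarySystem n r s t l) (i : ℤ) : t * s ^ i = s ^ (-i) * t := by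
  rw [← h.t_sz, mul_assoc, h.t_mul, mul_one]

theorem t_inv (h : IsRotarySystem n r s t l) : t⁻¹ = t := inv_eq_of_mul_eq_one_right h.t_mul

theorem l_rz (h : IsRotarySystem n r s t l) (i : ℤ) : l (r ^ i) = s ^ i := by
  rw [map_zpow, h.l_r]

theorem l_sz (h : IsRotarySystem n r s t l) (i : ℤ) : l (s ^ i) = r ^ i := by
  rw [map_zpow, h.l_s]

theorem rz_mod (h : IsRotarySystem n r s t l) {i j : ℤ} (hij : (n : ℤ) ∣ i - j) :
    r ^ i = r ^ j := by
  obtain ⟨c, hc⟩ := hij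
  rw [show i = j + n * c by linarith, zpow_add, zpow_mul, zpow_natCast, h.r_pow]; simp

theorem sz_mod (h : IsRotarySystem n r s t l) {i j : ℤ} (hij : (n : ℤ) ∣ i - j) :
    s ^ i = s ^ j := by
  obtain ⟨c, hc⟩ := hij
  rw [show i = j + n * c by linarith, zpow_add, zpow_mul, zpow_natCast, h.s_pow]; simp

/-- The system with the roles of the two dihedral groups exchanged. -/
theorem swap (h : IsRotarySystem n r s t l) : IsRotarySystem n s r t l where
  r_pow := h.s_pow
  s_pow := h.r_pow
  t_mul := h.t_mul
  t_r := h.t_s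
  t_s := h.t_r
  l_r := h.l_s
  l_s := h.l_r
  l_t := h.l_t
  card_eq := h.card_eq
  exists_eq g := by
    obtain ⟨j, i, hg | hg⟩ := h.exists_eq (l.symm g)
    · refine ⟨j, i, Or.inl ?_⟩
      rw [← l.apply_symm_apply g, hg, map_mul, h.l_sz, h.l_rz]
    · refine ⟨j, i, Or.inr ?_⟩
      rw [← l.apply_symm_apply g, hg, map_mul, map_mul, h.l_sz, h.l_rz, h.l_t]

variable [Finite G]

theorem n_pos (h : IsRotarySystem n r s t l) : 0 < n := by
  have := h.card_eq
  have h2 := Nat.card_pos (α := G)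
  rcases Nat.eq_zero_or_pos n with rfl | hn
  · simp at this; omega
  · exact hn

/-- By `exists_eq` the map is onto, and both sides have `2 * n ^ 2` elements: uniqueness of the
normal form is a count. -/
theorem nf_injective (h : IsRotarySystem n r s t l) : Function.Injective
    (fun x : Fin n × Fin n × Bool => s ^ (x.1 : ℕ) * r ^ (x.2.1 : ℕ) * (if x.2.2 then t else 1)) := by
  have hn := h.n_pos
  let _ := Fintype.ofFinite G
  apply ((Fintype.bijective_iff_surjective_and_card _).mpr ⟨?_, ?_⟩).1
  · have key : ∀ j : ℤ, ((j % n).toNat : ℤ) = j % n := fun j =>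
      Int.toNat_of_nonneg (Int.emod_nonneg _ (by omega))
    have lt : ∀ j : ℤ, (j % n).toNat < n := fun j => by
      have := Int.emod_lt_of_pos j (b := n) (by omega)
      have := key j; omega
    have hs : ∀ j : ℤ, s ^ (j % n).toNat = s ^ j := fun j => by
      rw [← zpow_natCast, key]
      exact h.sz_mod (by simp [Int.dvd_iff_emod_eq_zero])
    have hr : ∀ j : ℤ, r ^ (j % n).toNat = r ^ j := fun j => by
      rw [← zpow_natCast, key]
      exact h.rz_mod (by simp [Int.dvd_iff_emod_eq_zero])
    intro g
    obtain ⟨j, i, rfl | rfl⟩ := h.exists_eq g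
    · exact ⟨(⟨_, lt j⟩, ⟨_, lt i⟩, false), by simp [hs, hr]⟩
    · exact ⟨(⟨_, lt j⟩, ⟨_, lt i⟩, true), by simp [hs, hr]⟩
  · rw [← Nat.card_eq_fintype_card (α := G), h.card_eq]
    simp; ring

theorem nf_one (h : IsRotarySystem n r s t l) {j i : ℤ} (hji : s ^ j * r ^ i = 1) :
    (n : ℤ) ∣ j ∧ (n : ℤ) ∣ i := by
  have hn := h.n_pos
  have key : ∀ j : ℤ, ((j % n).toNat : ℤ) = j % n := fun j =>
    Int.toNat_of_nonneg (Int.emod_nonneg _ (by omega))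
  have lt : ∀ j : ℤ, (j % n).toNat < n := fun j => by
    have := Int.emod_lt_of_pos j (b := n) (by omega)
    have := key j; omega
  have := @nf_injective _ _ _ _ _ _ _ _ h (⟨_, lt j⟩, ⟨_, lt i⟩, false) (⟨0, hn⟩, ⟨0, hn⟩, false) (by
    simp only [Bool.false_eq_true, if_false, mul_one, pow_zero]
    rw [← zpow_natCast, ← zpow_natCast, key, key,
      h.sz_mod (j := j) (by simp [Int.dvd_iff_emod_eq_zero]),
      h.rz_mod (j := i) (by simp [Int.dvd_iff_emod_eq_zero]), hji])
  simp only [Prod.mk.injEq, Fin.mk.injEq, and_true] at this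
  have h1 := key j
  have h2 := key i
  rw [this.1] at h1
  rw [this.2] at h2
  exact ⟨Int.dvd_of_emod_eq_zero h1.symm, Int.dvd_of_emod_eq_zero h2.symm⟩

theorem nf_ne (h : IsRotarySystem n r s t l) (j i : ℤ) : s ^ j * r ^ i ≠ t := by
  intro hji
  have hn := h.n_pos
  have key : ∀ j : ℤ, ((j % n).toNat : ℤ) = j % n := fun j =>
    Int.toNat_of_nonneg (Int.emod_nonneg _ (by omega))
  have lt : ∀ j : ℤ, (j % n).toNat < n := fun j => by
    have := Int.emod_lt_of_pos j (b := n) (by omega)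
    have := key j; omega
  have := @nf_injective _ _ _ _ _ _ _ _ h (⟨_, lt j⟩, ⟨_, lt i⟩, false) (⟨0, hn⟩, ⟨0, hn⟩, true) (by
    simp only [Bool.false_eq_true, if_false, mul_one, pow_zero, if_true, one_mul]
    rw [← zpow_natCast, ← zpow_natCast, key, key,
      h.sz_mod (j := j) (by simp [Int.dvd_iff_emod_eq_zero]),
      h.rz_mod (j := i) (by simp [Int.dvd_iff_emod_eq_zero]), hji])
  simp at this

theorem s_eq_one_iff (h : IsRotarySystem n r s t l) {j : ℤ} : s ^ j = 1 ↔ (n : ℤ) ∣ j :=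
  ⟨fun hj => (h.nf_one (i := 0) (by simpa using hj)).1,
    fun hj => by rw [h.sz_mod (i := j) (j := 0) (by simpa using hj)]; simp⟩

theorem r_eq_one_iff (h : IsRotarySystem n r s t l) {j : ℤ} : r ^ j = 1 ↔ (n : ℤ) ∣ j :=
  ⟨fun hj => (h.nf_one (j := 0) (by simpa using hj)).2,
    fun hj => by rw [h.rz_mod (i := j) (j := 0) (by simpa using hj)]; simp⟩

theorem orderOf_r (h : IsRotarySystem n r s t l) : orderOf r = n := by
  apply Nat.dvd_antisymm (orderOf_dvd_of_pow_eq_one h.r_pow)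
  have := (h.r_eq_one_iff (j := orderOf r)).1 (by rw [zpow_natCast, pow_orderOf_eq_one])
  exact_mod_cast this

theorem orderOf_s (h : IsRotarySystem n r s t l) : orderOf s = n := by
  apply Nat.dvd_antisymm (orderOf_dvd_of_pow_eq_one h.s_pow)
  have := (h.s_eq_one_iff (j := orderOf s)).1 (by rw [zpow_natCast, pow_orderOf_eq_one])
  exact_mod_cast this

theorem t_ne_one (h : IsRotarySystem n r s t l) : t ≠ 1 := fun ht =>
  h.nf_ne 0 0 (by simp [ht])

end IsRotarySystem

/-! ### Vertex stabilizers, signs of the generators, and the centralizer of the reflection -/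

namespace IsRotarySystem

variable {G : Type*} [Group G] {n : ℕ} {r s t : G} {l : G ≃* G}

/-- The dihedral subgroup generated by `x` and a reflection `u` inverting it. -/
def dihedralSubgroup (x u : G) (hu : u * u = 1) (hx : u * x * u = x⁻¹) : Subgroup G where
  carrier := {g | ∃ i : ℤ, g = x ^ i ∨ g = x ^ i * u}
  one_mem' := ⟨0, Or.inl (by simp)⟩
  mul_mem' := by
    have hz : ∀ i : ℤ, u * x ^ i = x ^ (-i) * u := fun i => by
      rw [← t_zpow_of hu hx, mul_assoc, hu, mul_one]
    rintro a b ⟨i, rfl | rfl⟩ ⟨j, rfl | rfl⟩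
    · exact ⟨i + j, Or.inl (zpow_add _ _ _).symm⟩
    · exact ⟨i + j, Or.inr (by rw [zpow_add, mul_assoc])⟩
    · exact ⟨i - j, Or.inr (by rw [mul_assoc, hz, sub_eq_add_neg, zpow_add, mul_assoc])⟩
    · refine ⟨i - j, Or.inl ?_⟩
      rw [mul_assoc, ← mul_assoc u, t_zpow_of hu hx, sub_eq_add_neg, zpow_add]
  inv_mem' := by
    have hz : ∀ i : ℤ, u * x ^ i = x ^ (-i) * u := fun i => by
      rw [← t_zpow_of hu hx, mul_assoc, hu, mul_one]
    rintro a ⟨i, rfl | rfl⟩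
    · exact ⟨-i, Or.inl (by simp)⟩
    · exact ⟨i, Or.inr (by
        rw [mul_inv_rev, inv_eq_of_mul_eq_one_right hu, ← zpow_neg, hz, neg_neg])⟩

theorem card_dihedralSubgroup [Finite G] (x u : G) (hu : u * u = 1) (hx : u * x * u = x⁻¹)
    (hux : u ∉ Subgroup.zpowers x) : Nat.card (dihedralSubgroup x u hu hx) = 2 * orderOf x := by
  rw [← Nat.card_zpowers, ← Nat.card_eq_two_iff.2 ⟨false, true, by decide, by ext b; cases b <;> simp⟩,
    ← Nat.card_prod]
  symm
  refine Nat.card_congr (Equiv.ofBijective (fun p : Bool × Subgroup.zpowers x =>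
    (⟨p.2 * (if p.1 then u else 1), by
      obtain ⟨b, ⟨_, ⟨i, rfl⟩⟩⟩ := p
      cases b
      · exact ⟨i, Or.inl (by simp)⟩
      · exact ⟨i, Or.inr (by simp)⟩⟩ : dihedralSubgroup x u hu hx)) ⟨?_, ?_⟩)
  · have key : ∀ y ∈ Subgroup.zpowers x, ∀ y' ∈ Subgroup.zpowers x, y * u ≠ y' := by
      intro y hy y' hy' e
      exact hux (by rw [show u = y⁻¹ * y' by rw [← e]; group]; exact mul_mem (inv_mem hy) hy')
    rintro ⟨b, ⟨y, hy⟩⟩ ⟨b', ⟨y', hy'⟩⟩ e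
    simp only [Subtype.mk.injEq] at e
    cases b <;> cases b' <;> simp at e
    · simp [e]
    · exact absurd e.symm (key _ hy' _ hy)
    · exact absurd e (key _ hy _ hy')
    · simp [e]
  · rintro ⟨_, ⟨i, rfl | rfl⟩⟩
    · exact ⟨(false, ⟨x ^ i, ⟨i, rfl⟩⟩), by simp⟩
    · exact ⟨(true, ⟨x ^ i, ⟨i, rfl⟩⟩), by simp⟩

/-- The dihedral subgroup `⟨r, t⟩`, the stabilizer of a vertex. -/
def stab (h : IsRotarySystem n r s t l) : Subgroup G := dihedralSubgroup r t h.t_mul h.t_r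

theorem r_mem_stab (h : IsRotarySystem n r s t l) (i : ℤ) : r ^ i ∈ h.stab := ⟨i, Or.inl rfl⟩

theorem t_mem_stab (h : IsRotarySystem n r s t l) : t ∈ h.stab := ⟨0, Or.inr (by simp)⟩

theorem exists_eq_mul (h : IsRotarySystem n r s t l) (g : G) :
    ∃ j : ℤ, ∃ x ∈ h.stab, g = s ^ j * x := by
  obtain ⟨j, i, hg | hg⟩ := h.exists_eq g
  · exact ⟨j, r ^ i, ⟨i, Or.inl rfl⟩, hg⟩
  · exact ⟨j, r ^ i * t, ⟨i, Or.inr rfl⟩, by rw [hg, mul_assoc]⟩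

/-- Conjugation by `s` shifts the exponent of the reflection `s ^ k * t` by an even number, which is
what controls the fixed points of `t` and `s * t` on the cosets of the stabilizer. -/
theorem s_conj_t (h : IsRotarySystem n r s t l) (k j : ℤ) (x : G) :
    (s ^ j * x)⁻¹ * (s ^ k * t) * (s ^ j * x) = x⁻¹ * (s ^ (k - 2 * j) * t) * x := by
  have : s ^ (k - 2 * j) * t = s ^ (-j) * (s ^ k * t) * s ^ j := by
    rw [show k - 2 * j = -j + k + -j by ring, zpow_add, zpow_add]
    simp only [mul_assoc]
    rw [h.t_sz']
  rw [this]
  group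

variable [Finite G]

/-- Exactness of the factorization: `s ^ j ↦ j` identifies the cosets of the stabilizer with `ℤ/n`.
-/
theorem s_mem_stab (h : IsRotarySystem n r s t l) {j : ℤ} : s ^ j ∈ h.stab ↔ (n : ℤ) ∣ j := by
  constructor
  · rintro ⟨i, hi | hi⟩
    · exact (h.nf_one (j := j) (i := -i) (by rw [hi]; group)).1
    · exfalso
      apply h.nf_ne (-j) i
      rw [zpow_neg, hi, mul_inv_rev, h.t_inv]
      group
  · intro hj
    rw [h.s_eq_one_iff.2 hj]
    exact one_mem _

/-- Dedekind's law: `Y` is the exact product of `⟨s⟩ ∩ Y` and the stabilizer. -/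
theorem card_eq_card_inf_mul (h : IsRotarySystem n r s t l) (Y : Subgroup G) (hY : h.stab ≤ Y) :
    Nat.card Y = Nat.card (Subgroup.zpowers s ⊓ Y : Subgroup G) * Nat.card h.stab := by
  rw [← Nat.card_prod]
  symm
  refine Nat.card_congr (Equiv.ofBijective
    (fun x : (Subgroup.zpowers s ⊓ Y : Subgroup G) × h.stab =>
      (⟨x.1 * x.2, mul_mem x.1.2.2 (hY x.2.2)⟩ : Y)) ⟨?_, ?_⟩)
  · rintro ⟨⟨b, ⟨j, rfl⟩, hb⟩, ⟨x, hx⟩⟩ ⟨⟨b', ⟨j', rfl⟩, hb'⟩, ⟨x', hx'⟩⟩ heq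
    simp only [Subtype.mk.injEq] at heq
    have h1 : s ^ (j - j') ∈ h.stab := by
      have : s ^ (j - j') = x' * x⁻¹ := by
        rw [eq_mul_inv_iff_mul_eq, sub_eq_neg_add, zpow_add, mul_assoc, heq]; group
      rw [this]
      exact mul_mem hx' (inv_mem hx)
    have h2 := h.sz_mod (h.s_mem_stab.1 h1)
    simp only [h2, mul_right_inj] at heq
    simp [h2, heq]
  · rintro ⟨y, hy⟩
    obtain ⟨j, x, hx, rfl⟩ := h.exists_eq_mul y
    have : s ^ j ∈ Y := by simpa using mul_mem hy (inv_mem (hY hx))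
    exact ⟨⟨⟨s ^ j, ⟨j, rfl⟩, this⟩, ⟨x, hx⟩⟩, rfl⟩

theorem card_stab (h : IsRotarySystem n r s t l) : Nat.card h.stab = 2 * n := by
  have h1 := h.card_eq_card_inf_mul ⊤ le_top
  rw [Subgroup.card_top, h.card_eq, inf_top_eq, Nat.card_zpowers, h.orderOf_s] at h1
  have := h.n_pos
  apply Nat.eq_of_mul_eq_mul_left this
  rw [← h1]; ring

theorem index_stab (h : IsRotarySystem n r s t l) : h.stab.index = n := by
  have h1 := h.stab.card_mul_index
  rw [h.card_eq, h.card_stab] at h1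
  have := h.n_pos
  apply Nat.eq_of_mul_eq_mul_left (show 0 < 2 * n by omega)
  rw [h1]; ring

/-- Write `x = s ^ j * y` with `y` in the stabilizer. Conjugation by `s ^ j` turns `t` into `s ^
(-2j) * t`, and membership forces `s ^ (-2j) = 1`. Hence the conjugation already takes place inside
the dihedral group, where it changes the exponent by an even number. -/
theorem t_conj_mem_stab (h : IsRotarySystem n r s t l) {x : G} (hx : x⁻¹ * t * x ∈ h.stab) :
    ∃ i : ℤ, x⁻¹ * t * x = r ^ (2 * i) * t := by
  obtain ⟨j, y, hy, rfl⟩ := h.exists_eq_mul x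
  have h1 := h.s_conj_t 0 j y
  simp only [zpow_zero, one_mul] at h1
  rw [h1] at hx ⊢
  have h2 : s ^ (0 - 2 * j) ∈ h.stab := by
    have := mul_mem (mul_mem (mul_mem hy hx) (inv_mem hy)) h.t_mem_stab
    convert this using 1
    have : t * t = 1 := h.t_mul
    simp only [mul_assoc]
    simp [this]
  rw [h.s_eq_one_iff.2 (h.s_mem_stab.1 h2), one_mul]
  obtain ⟨i, rfl | rfl⟩ := hy
  · refine ⟨-i, ?_⟩
    rw [mul_assoc, h.t_rz', ← mul_assoc, ← zpow_neg, ← zpow_add]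
    congr 2; ring
  · refine ⟨i, ?_⟩
    rw [mul_inv_rev, h.t_inv, ← zpow_neg, mul_assoc, mul_assoc, ← mul_assoc t (r ^ i), h.t_rz,
      ← zpow_add, h.t_rz']
    congr 2; ring

/-- On the cosets, viewed as `ℤ/n`, this element acts as `j ↦ 1 - j`, which has no fixed point for
even `n`. -/
theorem sign_st (h : IsRotarySystem n r s t l) {m : ℕ} (hm : n = 2 * m) :
    cosetSign h.stab (s * t) = (-1) ^ m := by
  refine cosetSign_eq_of_free _ _ ?_ m ?_ (by rw [h.index_stab, hm])
  · have := h.t_sz' 1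
    rw [zpow_one] at this
    rw [mul_assoc, ← mul_assoc t, this, mul_assoc, h.t_mul]; group
  · intro x hx
    obtain ⟨j, y, hy, rfl⟩ := h.exists_eq_mul x
    have h1 := h.s_conj_t 1 j y
    rw [zpow_one] at h1
    rw [h1] at hx
    have h2 : s ^ (1 - 2 * j) ∈ h.stab := by
      have := mul_mem (mul_mem (mul_mem hy hx) (inv_mem hy)) h.t_mem_stab
      convert this using 1
      have : t * t = 1 := h.t_mul
      simp only [mul_assoc]
      simp [this]
    have h3 := h.s_mem_stab.1 h2
    rw [hm] at h3
    obtain ⟨c, hc⟩ := h3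
    push_cast at hc
    rw [mul_assoc] at hc
    omega

/-- On the cosets, viewed as `ℤ/n`, the action is `j ↦ -j`; the fixed points are `0` and `m`. -/
theorem sign_t (h : IsRotarySystem n r s t l) {m : ℕ} (hm : n = 2 * m) :
    cosetSign h.stab t = (-1) ^ (m - 1) := by
  have hn := h.n_pos
  refine cosetSign_eq_of_fixed _ _ h.t_mul 2 (m - 1) ?_ (by rw [h.index_stab]; omega)
  have key : {x : G ⧸ h.stab | t • x = x} = {((1 : G) : G ⧸ h.stab), ((s ^ (m : ℤ) : G) : G ⧸ h.stab)} := by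
    ext x
    induction x using QuotientGroup.induction_on with
    | H x =>
      obtain ⟨j, y, hy, rfl⟩ := h.exists_eq_mul x
      have e1 : ((s ^ j * y : G) : G ⧸ h.stab) = ((s ^ j : G) : G ⧸ h.stab) :=
        QuotientGroup.mk_mul_of_mem _ hy
      have e3 : ∀ k : ℤ, ((s ^ j : G) : G ⧸ h.stab) = ((s ^ k : G) : G ⧸ h.stab) ↔ (n : ℤ) ∣ k - j := by
        intro k
        rw [QuotientGroup.eq, ← zpow_neg, ← zpow_add, h.s_mem_stab, neg_add_eq_sub]
      have e2 : t • ((s ^ j : G) : G ⧸ h.stab) = ((s ^ (-j) : G) : G ⧸ h.stab) := by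
        rw [MulAction.Quotient.smul_mk, smul_eq_mul, h.t_sz']
        exact QuotientGroup.mk_mul_of_mem _ h.t_mem_stab
      have e4 := e3 0
      rw [zpow_zero] at e4
      simp only [Set.mem_ofPred_eq, Set.mem_insert_iff, Set.mem_singleton_iff]
      rw [e1, e2, e4, e3 m, eq_comm, e3, hm]
      push_cast
      constructor
      · rintro ⟨c, hc⟩
        rcases Int.even_or_odd c with ⟨d, hd⟩ | ⟨d, hd⟩
        · left; exact ⟨d, by subst hd; linarith⟩
        · right; exact ⟨d + 1, by subst hd; linarith⟩
      · rintro (⟨c, hc⟩ | ⟨c, hc⟩)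
        · exact ⟨2 * c, by linarith⟩
        · exact ⟨2 * c - 1, by linarith⟩
  change Nat.card ({x : G ⧸ h.stab | t • x = x} : Set _) = 2
  rw [key, Nat.card_coe_set_eq, Set.ncard_pair]
  intro e
  rw [QuotientGroup.eq, inv_one, one_mul, h.s_mem_stab, hm] at e
  have := Int.le_of_dvd (by omega) e
  push_cast at this
  omega

/-- The signs of `s * t` and `t` always differ. (The action of `s` is an `n`-cycle of even length.)
-/
theorem sign_s (h : IsRotarySystem n r s t l) {m : ℕ} (hm : n = 2 * m) :
    cosetSign h.stab s = -1 := by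
  have hn := h.n_pos
  have h1 := h.sign_st hm
  rw [map_mul, h.sign_t hm] at h1
  obtain ⟨k, rfl⟩ : ∃ k, m = k + 1 := ⟨m - 1, by omega⟩
  rw [Nat.add_sub_cancel, pow_succ] at h1
  rcases Int.units_eq_one_or ((-1 : ℤˣ) ^ k) with h2 | h2 <;> rw [h2] at h1
  · simpa using h1
  · simpa [neg_eq_iff_eq_neg] using h1

/-- Since `t` inverts both rotations, `s ^ j * r ^ i` commutes with `t` only if `s ^ (2j) * r ^ (2i)
= 1`, so `n` divides `2j` and `2i`. -/
theorem eq_of_commute_t (h : IsRotarySystem n r s t l) {m : ℕ} (hm : n = 2 * m) {g : G}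
    (hg : g * t = t * g) : ∃ j i : ℤ, g = s ^ (m * j : ℤ) * r ^ (m * i : ℤ) ∨
      g = s ^ (m * j : ℤ) * r ^ (m * i : ℤ) * t := by
  have key : ∀ j i : ℤ, s ^ j * r ^ i * t = t * (s ^ j * r ^ i) → (m : ℤ) ∣ j ∧ (m : ℤ) ∣ i := by
    intro j i hji
    have h1 : s ^ j * r ^ i = s ^ (-j) * r ^ (-i) := by
      rw [← mul_left_inj t, hji, ← mul_assoc, h.t_sz', mul_assoc, h.t_rz', mul_assoc]
    have h2 : s ^ (2 * j) * r ^ (2 * i) = 1 := by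
      rw [two_mul, two_mul, zpow_add, zpow_add, mul_assoc, ← mul_assoc (s ^ j) (r ^ i), h1]
      group
    have h3 := h.nf_one h2
    rw [hm] at h3
    push_cast at h3
    exact ⟨Int.dvd_of_mul_dvd_mul_left (by norm_num) h3.1,
      Int.dvd_of_mul_dvd_mul_left (by norm_num) h3.2⟩
  obtain ⟨j, i, rfl | rfl⟩ := h.exists_eq g
  · obtain ⟨⟨j', rfl⟩, ⟨i', rfl⟩⟩ := key j i hg
    exact ⟨j', i', Or.inl rfl⟩
  · obtain ⟨⟨j', rfl⟩, ⟨i', rfl⟩⟩ := key j i (by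
      rw [mul_assoc _ t, h.t_mul, mul_one] at hg
      calc s ^ j * r ^ i * t = t * (s ^ j * r ^ i * t) * t := by rw [← hg]
        _ = t * (s ^ j * r ^ i) := by rw [mul_assoc, mul_assoc _ t t, h.t_mul, mul_one])
    exact ⟨j', i', Or.inr rfl⟩

theorem s_half (h : IsRotarySystem n r s t l) {m : ℕ} (hm : n = 2 * m) (j : ℤ) :
    s ^ (m * j : ℤ) = 1 ∨ s ^ (m * j : ℤ) = s ^ (m : ℤ) := by
  rcases Int.even_or_odd j with ⟨d, hd⟩ | ⟨d, hd⟩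
  · left; rw [h.s_eq_one_iff, hm, hd]; exact ⟨d, by push_cast; ring⟩
  · right; apply h.sz_mod; rw [hm, hd]; exact ⟨d, by push_cast; ring⟩

/-- The elements commuting with `t`, with exponents reduced. -/
theorem cases_of_commute_t (h : IsRotarySystem n r s t l) {m : ℕ} (hm : n = 2 * m) {g : G}
    (hg : g * t = t * g) : ∃ a b c : G, (a = 1 ∨ a = s ^ (m : ℤ)) ∧ (b = 1 ∨ b = r ^ (m : ℤ)) ∧
      (c = 1 ∨ c = t) ∧ g = a * b * c := by
  obtain ⟨j, i, hg | hg⟩ := h.eq_of_commute_t hm hg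
  · exact ⟨_, _, 1, h.s_half hm j, h.swap.s_half hm i, Or.inl rfl, by rw [hg, mul_one]⟩
  · exact ⟨_, _, t, h.s_half hm j, h.swap.s_half hm i, Or.inr rfl, hg⟩

theorem s_half_ne (h : IsRotarySystem n r s t l) {m : ℕ} (hm : n = 2 * m) : s ^ (m : ℤ) ∉ h.stab := by
  rw [h.s_mem_stab, hm]
  have := h.n_pos
  intro hd
  have := Int.le_of_dvd (by omega) hd
  push_cast at this
  omega

theorem s_half_ne_one (h : IsRotarySystem n r s t l) {m : ℕ} (hm : n = 2 * m) : s ^ (m : ℤ) ≠ 1 :=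
  fun e => h.s_half_ne hm (by rw [e]; exact one_mem _)

omit [Finite G] in
theorem t_s_half (h : IsRotarySystem n r s t l) {m : ℕ} (hm : n = 2 * m) :
    t * s ^ (m : ℤ) = s ^ (m : ℤ) * t := by
  rw [h.t_sz', h.sz_mod (i := -m) (j := m)]
  rw [hm]; exact ⟨-1, by push_cast; ring⟩

omit [Finite G] in
theorem s_half_mul (h : IsRotarySystem n r s t l) {m : ℕ} (hm : n = 2 * m) :
    s ^ (m : ℤ) * s ^ (m : ℤ) = 1 := by
  rw [← zpow_add, ← two_mul, show (2 * m : ℤ) = (n : ℕ) by rw [hm]; push_cast; ring, zpow_natCast,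
    h.s_pow]

/-- The product of the half-turns commutes with `t`, so it is one of the eight elements of
`cases_of_commute_t`. All but two of them would put `s ^ m` in the stabilizer, make `r ^ m` trivial,
or make it equal to `t`. -/
theorem half_comm_or (h : IsRotarySystem n r s t l) {m : ℕ} (hm : n = 2 * m) :
    r ^ (m : ℤ) * s ^ (m : ℤ) = s ^ (m : ℤ) * r ^ (m : ℤ) ∨
    r ^ (m : ℤ) * s ^ (m : ℤ) = s ^ (m : ℤ) * r ^ (m : ℤ) * t := by
  have h1 := h.t_s_half hm
  have h2 := h.swap.t_s_half hm
  obtain ⟨a, b, c, ha, hb, hc, hg⟩ := h.cases_of_commute_t hm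
    (g := r ^ (m : ℤ) * s ^ (m : ℤ)) (by rw [mul_assoc, ← h1, ← mul_assoc, ← h2, mul_assoc])
  have hcs : c ∈ h.stab := by
    rcases hc with rfl | rfl
    · exact one_mem _
    · exact h.t_mem_stab
  have hbs : b ∈ h.stab := by
    rcases hb with rfl | rfl
    · exact one_mem _
    · exact h.r_mem_stab m
  rcases ha with rfl | rfl
  · exfalso
    apply h.s_half_ne hm
    have : s ^ (m : ℤ) = (r ^ (m : ℤ))⁻¹ * (1 * b * c) := by rw [← hg]; group
    rw [this]
    exact mul_mem (inv_mem (h.r_mem_stab m)) (mul_mem (mul_mem (one_mem _) hbs) hcs)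
  · rcases hb with rfl | rfl
    · exfalso
      rcases hc with rfl | rfl
      · exact h.swap.s_half_ne_one hm (by simpa using hg)
      · have h3 := h.s_half_mul hm
        apply h.nf_ne 0 m
        rw [zpow_zero, one_mul]
        calc r ^ (m : ℤ) = (r ^ (m : ℤ) * s ^ (m : ℤ)) * s ^ (m : ℤ) := by
              rw [mul_assoc, h3, mul_one]
          _ = c := by rw [hg, mul_one, mul_assoc, h1, ← mul_assoc, h3, one_mul]
    · rcases hc with rfl | rfl
      · left; simpa using hg
      · right; exact hg

/-- In odd degree the reflection is not generated by the rotations. -/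
theorem not_odd (h : IsRotarySystem n r s t l) (ht : t ∈ Subgroup.closure {r, s}) : ¬ Odd n := by
  intro hn
  -- In the regular representation `t` is a product of `n ^ 2` transpositions, whereas `r` and `s`
  -- have odd order and are even.
  have h1 : cosetSign (⊥ : Subgroup G) t = (-1) ^ (n ^ 2) := by
    refine cosetSign_eq_of_free _ _ h.t_mul _ ?_ (by rw [Subgroup.index_bot, h.card_eq])
    intro x hx
    rw [Subgroup.mem_bot] at hx
    apply h.t_ne_one
    have : t = x * (x⁻¹ * t * x) * x⁻¹ := by group
    rw [this, hx]; group
  rw [hn.pow.neg_one_pow] at h1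
  have hr := hom_eq_one_of_pow_odd (cosetSign (⊥ : Subgroup G)) r n hn h.r_pow
  have hs := hom_eq_one_of_pow_odd (cosetSign (⊥ : Subgroup G)) s n hn h.s_pow
  have : Subgroup.closure {r, s} ≤ (cosetSign (⊥ : Subgroup G)).ker := by
    rw [Subgroup.closure_le]
    rintro x (rfl | rfl)
    · exact hr
    · exact hs
  have h2 := this ht
  rw [MonoidHom.mem_ker, h1] at h2
  exact absurd h2 (by decide)

end IsRotarySystem

/-! ### A sign character from an overgroup of the vertex stabilizer -/

namespace IsRotarySystem

variable {G : Type*} [Group G] {n : ℕ} {r s t : G} {l : G ≃* G}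

/-- If an odd power of `s` lies in a proper subgroup `Y` of odd index containing the vertex
stabilizer, then some sign character separates `t` from `s`. -/
theorem exists_sign_of_stab_le [Finite G] (h : IsRotarySystem n r s t l) (Y : Subgroup G)
    (hY : h.stab ≤ Y)
    (hne : Y ≠ ⊤) (hodd : Odd Y.index) (k : ℤ) (hk : Odd k) (hks : s ^ k ∈ Y) :
    ∃ χ : G →* ℤˣ, χ t = -1 ∧ χ s = 1 := by
  have hKY : Y.normalCore ≤ Y := Y.normalCore_le
  have hN : Y.normalCore.Normal := inferInstance
  -- Powers of `s` commute, so by `G = ⟨s⟩ * stab` every conjugate of `s ^ j` is a conjugate by an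
  -- element of the stabilizer, hence of `Y`.
  have hK : ∀ j : ℤ, s ^ j ∈ Y → s ^ j ∈ Y.normalCore := by
    intro j hj b
    obtain ⟨i, x, hx, hb⟩ := h.exists_eq_mul b⁻¹
    have : b * s ^ j * b⁻¹ = x⁻¹ * s ^ j * x := by
      rw [← inv_inv b, hb]; group
    rw [this]
    exact mul_mem (mul_mem (inv_mem (hY hx)) hj) (hY hx)
  -- Exponents can be halved because an odd power of `s` is available: `j = (2c + 1) * j - c *
  -- (2j)`.
  have hK2 : ∀ j : ℤ, s ^ (2 * j) ∈ Y → s ^ j ∈ Y.normalCore := by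
    intro j hj
    obtain ⟨c, rfl⟩ := hk
    have : s ^ j = (s ^ (2 * c + 1)) ^ j * (s ^ (2 * j)) ^ (-c) := by
      rw [← zpow_mul, ← zpow_mul, ← zpow_add]; congr 1; ring
    rw [this]
    exact mul_mem (zpow_mem (hK _ hks) _) (zpow_mem (hK _ hj) _)
  have hst : ∀ j : ℤ, s ^ (-j) * t * s ^ j = s ^ (2 * -j) * t := by
    intro j
    rw [mul_assoc, h.t_sz', ← mul_assoc, ← zpow_add]; congr 2; ring
  -- Otherwise the commutator of `s` and `t`, which is `s ^ 2`, lies in the core; then so does `s`,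
  -- and `Y` is everything.
  have htK : t ∉ Y.normalCore := by
    intro ht
    apply hne
    have h0 : s ^ (1 : ℤ) * t * (s ^ (1 : ℤ))⁻¹ = s ^ (2 * 1 : ℤ) * t := by
      rw [← zpow_neg]; exact hst (-1)
    have h1 := hN.conj_mem t ht (s ^ (1 : ℤ))
    rw [h0] at h1
    have h2 : s ^ (2 * 1 : ℤ) ∈ Y.normalCore := by
      simpa [mul_assoc, h.t_mul] using mul_mem h1 ht
    have h3 := hKY (hK2 _ (hKY h2))
    rw [eq_top_iff]
    intro g _
    obtain ⟨j, x, hx, rfl⟩ := h.exists_eq_mul g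
    rw [zpow_one] at h3
    exact mul_mem (zpow_mem h3 j) (hY hx)
  -- A subgroup of index two in `Y` that avoids `t`: the core joined with `⟨r⟩`, unless that
  -- contains `t`. In the latter case `r` and `t` have the same image of order two modulo the core,
  -- and the core itself serves.
  obtain ⟨U, hKU, hUY, htU, hU⟩ : ∃ U : Subgroup G, Y.normalCore ≤ U ∧ U ≤ Y ∧ t ∉ U ∧
      ∀ y ∈ Y, y ∈ U ∨ y * t ∈ U := by
    by_cases ht : t ∈ Y.normalCore ⊔ Subgroup.zpowers r
    · refine ⟨Y.normalCore, le_rfl, hKY, htK, ?_⟩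
      obtain ⟨κ, hκ, _, ⟨i, rfl⟩, hi⟩ := Subgroup.mem_sup_of_normal_left.1 ht
      let π := QuotientGroup.mk' Y.normalCore
      have hπ : ∀ g, π g = 1 ↔ g ∈ Y.normalCore := fun g => QuotientGroup.eq_one_iff g
      have e1 : π r ^ i = π t := by
        rw [← hi, map_mul, (hπ κ).2 hκ, one_mul, map_zpow]
      have e2 : π r * π r = 1 := by
        have := congrArg π h.t_r
        rw [map_mul, map_mul, map_inv, ← e1, ← zpow_add_one, ← zpow_add] at this
        have e3 : π r ^ i * π r ^ i = 1 := by rw [e1, ← map_mul, h.t_mul, map_one]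
        rw [show i + 1 + i = i + i + 1 by ring, zpow_add_one, zpow_add, e3, one_mul] at this
        nth_rewrite 2 [this]
        group
      have e4 : ∀ j : ℤ, π r ^ j = 1 ∨ π r ^ j = π r := by
        intro j
        rcases Int.even_or_odd j with ⟨d, hd⟩ | ⟨d, hd⟩
        · left; rw [hd, ← two_mul, zpow_mul, zpow_two, e2, one_zpow]
        · right; rw [hd, zpow_add_one, zpow_mul, zpow_two, e2, one_zpow, one_mul]
      have e5 : π r = π t := by
        rcases e4 i with e | e
        · exact absurd ((hπ t).1 (e1.symm.trans e)) htK
        · rw [← e, e1]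
      have e6 : π t * π t = 1 := by rw [← map_mul, h.t_mul, map_one]
      intro y hy
      obtain ⟨j, x, hx, rfl⟩ := h.exists_eq_mul y
      have h7 : s ^ j ∈ Y := by simpa using mul_mem hy (inv_mem (hY hx))
      rw [← hπ, ← hπ, map_mul, map_mul, map_mul, (hπ _).2 (hK _ h7), one_mul]
      obtain ⟨a, rfl | rfl⟩ := hx
      · rw [map_zpow]
        rcases e4 a with e | e <;> rw [e] <;> simp [e5, e6]
      · rw [map_mul, map_zpow]
        rcases e4 a with e | e <;> rw [e] <;> simp [e5, e6]
    · refine ⟨_, le_sup_left, sup_le hKY ?_, ht, ?_⟩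
      · rw [Subgroup.zpowers_le]
        exact hY (by simpa using h.r_mem_stab 1)
      · intro y hy
        obtain ⟨j, x, hx, rfl⟩ := h.exists_eq_mul y
        have h7 : s ^ j ∈ Y := by simpa using mul_mem hy (inv_mem (hY hx))
        have h8 : ∀ a : ℤ, s ^ j * r ^ a ∈ Y.normalCore ⊔ Subgroup.zpowers r := fun a =>
          mul_mem (Subgroup.mem_sup_left (hK _ h7)) (Subgroup.mem_sup_right ⟨a, rfl⟩)
        obtain ⟨a, rfl | rfl⟩ := hx
        · exact Or.inl (h8 a)
        · right
          rw [mul_assoc, mul_assoc, h.t_mul, mul_one]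
          exact h8 a
  have hidx : U.index = 2 * Y.index := by
    rw [← Subgroup.relIndex_mul_index hUY]
    congr 1
    rw [Subgroup.relIndex_eq_two_iff_exists_notMem_and]
    exact ⟨t, hY h.t_mem_stab, htU, fun y hy => (hU y hy).symm⟩
  -- The index of `U` is twice an odd number. If a conjugate of `t` lay in `U`, a conjugate by an
  -- element of `Y` would too, and then `t` itself by normality of `U` in `Y`; so `t` acts freely.
  -- The odd power `s ^ k` lies in the core and acts trivially.
  refine ⟨cosetSign U, ?_, ?_⟩
  · rw [cosetSign_eq_of_free U t h.t_mul _ ?_ hidx, hodd.neg_one_pow]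
    intro x hx
    obtain ⟨j, y, hy, rfl⟩ := h.exists_eq_mul x
    have hyY := hY hy
    have e1 : (s ^ j * y)⁻¹ * t * (s ^ j * y) = y⁻¹ * (s ^ (2 * -j) * t) * y := by
      rw [← hst]; group
    rw [e1] at hx
    have h1 : s ^ (2 * -j) ∈ Y := by
      have := mul_mem (mul_mem (mul_mem hyY (hUY hx)) (inv_mem hyY)) (hY h.t_mem_stab)
      convert this using 1
      simp only [mul_assoc, mul_inv_cancel_left, mul_inv_cancel, mul_one, h.t_mul]
    have h2 : y⁻¹ * s ^ (2 * -j) * y ∈ U := by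
      have := hN.conj_mem _ (hK _ h1) y⁻¹
      rw [inv_inv] at this
      exact hKU this
    have h3 : y⁻¹ * t * y ∈ U := by
      have := mul_mem (inv_mem h2) hx
      convert this using 1
      group
    have h4 : y⁻¹ ∈ U → False := fun h5 => htU (by
      have := mul_mem (mul_mem (inv_mem h5) h3) h5
      convert this using 1
      group)
    rcases hU y⁻¹ (inv_mem hyY) with h5 | h5
    · exact h4 h5
    · apply h4
      have := mul_mem (inv_mem h5) h3
      have h6 := inv_mem this
      convert h6 using 1
      group
  · have h1 : cosetSign U (s ^ k) = 1 := by
      apply cosetSign_eq_one_of_smul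
      intro x
      have := hN.conj_mem _ (hK _ hks) x⁻¹
      rw [inv_inv] at this
      exact hKU this
    rw [map_zpow] at h1
    rcases Int.units_eq_one_or (cosetSign U s) with h2 | h2
    · exact h2
    · rw [h2, hk.neg_one_zpow] at h1
      exact absurd h1 (by decide)

end IsRotarySystem

/-! ### A Sylow 2-subgroup containing the 2-parts of both rotations and the reflection -/

theorem card_mul_card_le_of_disjoint {G : Type*} [Group G] [Finite G] {A B P : Subgroup G}
    (hA : A ≤ P) (hB : B ≤ P) (hd : Disjoint A B) : Nat.card A * Nat.card B ≤ Nat.card P := by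
  rw [← Nat.card_prod]
  refine Nat.card_le_card_of_injective (fun x : A × B => (⟨x.1 * x.2, mul_mem (hA x.1.2) (hB x.2.2)⟩ : P)) ?_
  intro x y hxy
  exact Subgroup.mul_injective_of_disjoint hd (Subtype.ext_iff.1 hxy)

namespace IsRotarySystem

variable {G : Type*} [Group G] {n : ℕ} {r s t : G} {l : G ≃* G}

theorem isPGroup_dihedralSubgroup {x u : G} (hu : u * u = 1) (hx : u * x * u = x⁻¹) {e : ℕ}
    (hxe : x ^ 2 ^ e = 1) : IsPGroup 2 (dihedralSubgroup x u hu hx) := by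
  rintro ⟨_, ⟨i, rfl | rfl⟩⟩
  · refine ⟨e, ?_⟩
    rw [Subtype.ext_iff, SubgroupClass.coe_pow, OneMemClass.coe_one, ← zpow_natCast, zpow_comm]
    rw [zpow_natCast, hxe, one_zpow]
  · refine ⟨1, ?_⟩
    rw [Subtype.ext_iff, SubgroupClass.coe_pow, OneMemClass.coe_one, pow_one, pow_two]
    have := t_zpow_of hu hx i
    rw [mul_assoc, ← mul_assoc u, this]; group

theorem inf_stab_swap [Finite G] (h : IsRotarySystem n r s t l) {x : G} (h1 : x ∈ h.stab)
    (h2 : x ∈ h.swap.stab) : x = 1 ∨ x = t := by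
  obtain ⟨i, rfl | rfl⟩ := h1
  · obtain ⟨j, hj | hj⟩ := h2
    · left
      have := h.s_mem_stab.1 (hj ▸ h.r_mem_stab i)
      rw [hj, h.s_eq_one_iff.2 this]
    · exfalso
      apply h.nf_ne (-j) i
      rw [hj]; group
  · obtain ⟨j, hj | hj⟩ := h2
    · exfalso
      apply h.swap.nf_ne (-i) j
      rw [← hj]; group
    · right
      have : r ^ i = s ^ j := mul_right_cancel hj
      have := h.s_mem_stab.1 (this ▸ h.r_mem_stab i)
      rw [hj, h.s_eq_one_iff.2 this, one_mul]

theorem orderOf_r_pow [Finite G] (h : IsRotarySystem n r s t l) {e q : ℕ} (hq : Odd q)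
    (hn : n = 2 ^ e * q) : orderOf (r ^ (q : ℤ)) = 2 ^ e := by
  rw [zpow_natCast, orderOf_pow' _ hq.pos.ne', h.orderOf_r, hn, Nat.gcd_eq_right (Dvd.intro_left _ rfl),
    Nat.mul_div_cancel _ hq.pos]

/-- A Sylow 2-subgroup compatible with the factorization. -/
theorem exists_sylow [Finite G] (h : IsRotarySystem n r s t l) {e q : ℕ} (hq : Odd q)
    (hn : n = 2 ^ e * q) : ∃ P : Subgroup G, IsPGroup 2 P ∧ Nat.card P = 2 ^ (2 * e + 1) ∧
      r ^ (q : ℤ) ∈ P ∧ s ^ (q : ℤ) ∈ P ∧ t ∈ P := by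
  have : Fact (Nat.Prime 2) := ⟨Nat.prime_two⟩
  have hre := h.orderOf_r_pow hq hn
  have hse := h.swap.orderOf_r_pow hq hn
  have hpr : (r ^ (q : ℤ)) ^ 2 ^ e = 1 := by rw [← hre, pow_orderOf_eq_one]
  have hps : (s ^ (q : ℤ)) ^ 2 ^ e = 1 := by rw [← hse, pow_orderOf_eq_one]
  have hcard : ∀ P : Sylow 2 G, Nat.card P = 2 ^ (2 * e + 1) := by
    intro P
    rw [P.card_eq_multiplicity, h.card_eq, hn]
    congr 1
    rw [show 2 * (2 ^ e * q) ^ 2 = 2 ^ (2 * e + 1) * q ^ 2 by rw [mul_pow]; ring,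
      Nat.factorization_mul (by positivity) (pow_ne_zero _ hq.pos.ne'), Finsupp.add_apply,
      Nat.Prime.factorization_pow Nat.prime_two, Finsupp.single_eq_same,
      Nat.factorization_eq_zero_of_not_dvd (fun hd => ?_), add_zero]
    exact Nat.not_even_iff_odd.2 hq.pow (even_iff_two_dvd.2 hd)
  have htr : t * r ^ (q : ℤ) * t = (r ^ (q : ℤ))⁻¹ := by rw [h.t_rz, zpow_neg]
  have hts : t * s ^ (q : ℤ) * t = (s ^ (q : ℤ))⁻¹ := by rw [h.t_sz, zpow_neg]
  obtain ⟨P, hP⟩ := (isPGroup_dihedralSubgroup h.t_mul htr hpr).exists_le_sylow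
  obtain ⟨Q, hQ⟩ := (isPGroup_dihedralSubgroup h.t_mul hts hps).exists_le_sylow
  obtain ⟨g, hg⟩ := MulAction.exists_smul_eq G P Q
  have mem : ∀ (g x : G) (P : Sylow 2 G), x ∈ g • P ↔ g⁻¹ * x * g ∈ P := by
    intro g x P
    open scoped Pointwise in
    change x ∈ (MulAut.conj g) • (P : Subgroup G) ↔ _
    rw [Subgroup.mem_pointwise_smul_iff_inv_smul_mem, ← map_inv, MulAut.smul_def, MulAut.conj_apply,
      inv_inv]
    rfl
  -- Only the factor `y` is used to conjugate. As `y` normalizes `⟨r ^ q⟩` and `s ^ j` centralizes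
  -- `s ^ q`, the conjugate `y • P` contains `r ^ q` and `s ^ q`, together with some reflection from
  -- each dihedral group.
  obtain ⟨j, y, hy, rfl⟩ := h.exists_eq_mul g
  have hraP : r ^ (q : ℤ) ∈ P := hP ⟨1, Or.inl (zpow_one _).symm⟩
  have htP : t ∈ P := hP ⟨0, Or.inr (by simp)⟩
  have hsQ : s ^ (q : ℤ) ∈ Q := hQ ⟨1, Or.inl (zpow_one _).symm⟩
  have htQ : t ∈ Q := hQ ⟨0, Or.inr (by simp)⟩
  have hr1 : r ^ (q : ℤ) ∈ y • P := by
    rw [mem]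
    obtain ⟨i, rfl | rfl⟩ := hy
    · rw [← zpow_neg, ← zpow_add, ← zpow_add]
      convert hraP using 2; ring
    · rw [mul_inv_rev, h.t_inv, ← zpow_neg,
        show t * r ^ (-i) * r ^ (q : ℤ) * (r ^ i * t) = t * r ^ (q : ℤ) * t by group, h.t_rz, zpow_neg]
      exact inv_mem hraP
  have hs1 : s ^ (q : ℤ) ∈ y • P := by
    rw [mem]
    rw [← hg, mem] at hsQ
    convert hsQ using 1
    group
  have hu0 : ∃ i : ℤ, y⁻¹ * (r ^ i * t) * y = t := by
    obtain ⟨i, rfl | rfl⟩ := hy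
    · refine ⟨2 * i, ?_⟩
      rw [mul_assoc, mul_assoc, h.t_rz', ← zpow_neg, ← mul_assoc, ← mul_assoc, ← zpow_add,
        ← zpow_add, show -i + 2 * i + -i = 0 by ring, zpow_zero, one_mul]
    · refine ⟨2 * i, ?_⟩
      have : r ^ (2 * i) * t = (r ^ i * t) * t * (r ^ i * t)⁻¹ := by
        rw [mul_assoc (r ^ i), h.t_mul, mul_one, mul_inv_rev, h.t_inv, ← zpow_neg, h.t_rz', neg_neg,
          ← mul_assoc, ← zpow_add, two_mul]
      rw [this]; group
  have hu1 : ∃ i : ℤ, r ^ i * t ∈ y • P := by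
    obtain ⟨i, hi⟩ := hu0
    exact ⟨i, by rw [mem, hi]; exact htP⟩
  have hv1 : ∃ i : ℤ, s ^ i * t ∈ y • P := by
    refine ⟨-j - j, ?_⟩
    rw [mem]
    rw [← hg, mem] at htQ
    convert htQ using 1
    rw [mul_inv_rev, ← zpow_neg]
    simp only [mul_assoc]
    rw [← mul_assoc t (s ^ j) y, h.t_sz', sub_eq_add_neg, zpow_add]
    simp only [mul_assoc]
  obtain ⟨i, hu1⟩ := hu1
  obtain ⟨k, hv1⟩ := hv1
  have refl_sq : ∀ {n : ℕ} {r s : G} {l : G ≃* G} (h : IsRotarySystem n r s t l) (i : ℤ),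
      (r ^ i * t) * (r ^ i * t) = 1 := by
    intro n r s l h i
    rw [mul_assoc, ← mul_assoc t, h.t_rz]; group
  have refl_conj : ∀ {n : ℕ} {r s : G} {l : G ≃* G} (h : IsRotarySystem n r s t l) (i q : ℤ),
      (r ^ i * t) * r ^ q * (r ^ i * t) = (r ^ q)⁻¹ := by
    intro n r s l h i q
    rw [mul_assoc (r ^ i), h.t_rz', mul_assoc, mul_assoc (r ^ (-q)), ← mul_assoc t, h.t_rz]; group
  let Du := dihedralSubgroup (r ^ (q : ℤ)) (r ^ i * t) (refl_sq h i) (refl_conj h i q)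
  let Dv := dihedralSubgroup (s ^ (q : ℤ)) (s ^ k * t) (refl_sq h.swap k) (refl_conj h.swap k q)
  have cDu : Nat.card Du = 2 * 2 ^ e := by
    rw [card_dihedralSubgroup, hre]
    rintro ⟨c, hc⟩
    apply h.nf_ne 0 (-i + q * c)
    change (r ^ (q : ℤ)) ^ c = r ^ i * t at hc
    rw [zpow_add, zpow_mul, hc]; group
  have cDv : Nat.card Dv = 2 * 2 ^ e := by
    rw [card_dihedralSubgroup, hse]
    rintro ⟨c, hc⟩
    apply h.nf_ne (-k + q * c) 0
    change (s ^ (q : ℤ)) ^ c = s ^ k * t at hc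
    rw [zpow_add, zpow_mul, hc]; group
  have hDu : Du ≤ ((y • P : Sylow 2 G) : Subgroup G) := by
    rintro _ ⟨c, rfl | rfl⟩
    · exact zpow_mem hr1 c
    · exact mul_mem (zpow_mem hr1 c) hu1
  have hDv : Dv ≤ ((y • P : Sylow 2 G) : Subgroup G) := by
    rintro _ ⟨c, rfl | rfl⟩
    · exact zpow_mem hs1 c
    · exact mul_mem (zpow_mem hs1 c) hv1
  -- Two subgroups of order `2 ^ (e + 1)` cannot meet trivially in a group of order `2 ^ (2e + 1)`.
  -- A nontrivial common element lies in both vertex stabilizers, so it is `t`.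
  have hnd : ¬ Disjoint Du Dv := by
    intro hd
    have h1 := card_mul_card_le_of_disjoint hDu hDv hd
    have h2 : Nat.card ((y • P : Sylow 2 G) : Subgroup G) = _ := hcard (y • P)
    rw [cDu, cDv, h2, pow_succ, mul_comm 2 e, pow_mul] at h1
    have : 0 < 2 ^ e := by positivity
    nlinarith
  rw [Subgroup.disjoint_def] at hnd
  push Not at hnd
  obtain ⟨x, hx1, hx2, hx⟩ := hnd
  have hxt : x = t := by
    refine (h.inf_stab_swap (x := x) ?_ ?_).resolve_left hx
    · obtain ⟨c, rfl | rfl⟩ := hx1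
      · exact ⟨q * c, Or.inl (zpow_mul _ _ _).symm⟩
      · exact ⟨q * c + i, Or.inr (by rw [zpow_add, zpow_mul, mul_assoc])⟩
    · obtain ⟨c, rfl | rfl⟩ := hx2
      · exact ⟨q * c, Or.inl (zpow_mul _ _ _).symm⟩
      · exact ⟨q * c + k, Or.inr (by rw [zpow_add, zpow_mul, mul_assoc])⟩
  refine ⟨(y • P : Sylow 2 G), (y • P : Sylow 2 G).isPGroup', hcard _, hr1, hs1, ?_⟩
  rw [← hxt]
  exact hDu hx1

end IsRotarySystem

/-! ### Commutation of a half-turn with a 2-part -/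

namespace IsRotarySystem

variable {G : Type*} [Group G] {n : ℕ} {r s t : G} {l : G ≃* G}

theorem commute_l (h : IsRotarySystem n r s t l) {i j : ℤ} (hc : s ^ i * r ^ j = r ^ j * s ^ i) :
    r ^ i * s ^ j = s ^ j * r ^ i := by
  have := congrArg l hc
  simpa [map_mul, h.l_rz, h.l_sz] using this

/-- If 4 divides the degree, then the involution of `⟨r⟩` centralizes the 2-part of `⟨s⟩`. -/
theorem half_commute [Finite G] (h : IsRotarySystem n r s t l) {e q : ℕ} (hq : Odd q)
    (he : 2 ≤ e) (hn : n = 2 ^ e * q) {m : ℕ} (hm : n = 2 * m)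
    (hzz : r ^ (m : ℤ) * s ^ (m : ℤ) = s ^ (m : ℤ) * r ^ (m : ℤ)) :
    r ^ (m : ℤ) * s ^ (q : ℤ) = s ^ (q : ℤ) * r ^ (m : ℤ) := by
  obtain ⟨P, hP, hPc, hrP, hsP, htP⟩ := h.exists_sylow hq hn
  have : Fact (Nat.Prime 2) := ⟨Nat.prime_two⟩
  have : Nontrivial P := by
    rw [← Finite.one_lt_card_iff_nontrivial, hPc]
    exact Nat.one_lt_two_pow (by omega)
  have := hP.center_nontrivial
  -- A nontrivial central element of the Sylow subgroup commutes with `t`, so `cases_of_commute_t`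
  -- leaves only a few candidates.
  obtain ⟨⟨⟨c, hcP⟩, hc⟩, hc1⟩ := exists_ne (1 : Subgroup.center P)
  have hc1 : c ≠ 1 := fun e => hc1 (by ext; exact e)
  rw [Subgroup.mem_center_iff] at hc
  have hcr : r ^ (q : ℤ) * c = c * r ^ (q : ℤ) := Subtype.ext_iff.1 (hc ⟨_, hrP⟩)
  have hcs : s ^ (q : ℤ) * c = c * s ^ (q : ℤ) := Subtype.ext_iff.1 (hc ⟨_, hsP⟩)
  have hct : t * c = c * t := Subtype.ext_iff.1 (hc ⟨_, htP⟩)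
  have ht2 := h.t_mul
  -- Here `4 ∣ n` enters: `r ^ q` and `s ^ q` have order at least four, so `t`, which inverts them,
  -- does not commute with them.
  have two_q : ¬ (n : ℤ) ∣ 2 * q := by
    rw [hn]
    intro hd
    have h1 : 2 ^ e * q ∣ 2 * q := by exact_mod_cast hd
    have h2 := Nat.dvd_of_mul_dvd_mul_right hq.pos h1
    have h3 := Nat.le_of_dvd (by norm_num) h2
    have h4 : 2 ^ 2 ≤ 2 ^ e := Nat.pow_le_pow_right (by norm_num) he
    omega
  have key : ∀ {r s : G} {l : G ≃* G} (h : IsRotarySystem n r s t l),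
      r ^ (q : ℤ) * t ≠ t * r ^ (q : ℤ) := by
    intro r s l h e1
    rw [h.t_rz'] at e1
    have e2 := mul_right_cancel e1
    apply two_q
    rw [← h.r_eq_one_iff, two_mul, zpow_add]
    nth_rewrite 1 [e2]
    rw [← zpow_add]; simp
  have hzr : r ^ (q : ℤ) * r ^ (m : ℤ) = r ^ (m : ℤ) * r ^ (q : ℤ) := by
    rw [← zpow_add, ← zpow_add, add_comm]
  have hzs : s ^ (q : ℤ) * s ^ (m : ℤ) = s ^ (m : ℤ) * s ^ (q : ℤ) := by
    rw [← zpow_add, ← zpow_add, add_comm]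
  obtain ⟨a, b, d, ha, hb, hd, rfl⟩ := h.cases_of_commute_t hm hct.symm
  rcases hd with rfl | rfl
  · rcases ha with rfl | rfl
    · rcases hb with rfl | rfl
      · simp at hc1
      · simpa using hcs.symm
    · apply h.commute_l
      rcases hb with rfl | rfl
      · simpa using hcr.symm
      · rw [mul_one, ← mul_assoc, mul_assoc _ (r ^ (m : ℤ)), ← hzr, ← mul_assoc] at hcr
        exact (mul_right_cancel hcr).symm
  · exfalso
    rcases ha with rfl | rfl
    · rcases hb with rfl | rfl
      · exact key h (by simpa using hcr)
      · rw [one_mul, ← mul_assoc, hzr, mul_assoc, mul_assoc] at hcr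
        exact key h (mul_left_cancel hcr)
    · rcases hb with rfl | rfl
      · rw [mul_one, ← mul_assoc, hzs, mul_assoc, mul_assoc] at hcs
        exact key h.swap (mul_left_cancel hcs)
      · -- the case in which `z' z t` is central
        have e1 : r ^ (m : ℤ) * d * s ^ (q : ℤ) = s ^ (q : ℤ) * (r ^ (m : ℤ) * d) := by
          rw [mul_assoc (s ^ (m : ℤ)), ← mul_assoc, hzs, mul_assoc, mul_assoc] at hcs
          exact (mul_left_cancel hcs).symm
        -- As `m` is even, the half-turn has a square root `r ^ (m / 2)`, called `y` below.
        obtain ⟨k, rfl⟩ : ∃ k, m = 2 * k := by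
          obtain ⟨f, rfl⟩ : ∃ f, e = f + 2 := ⟨e - 2, by omega⟩
          refine ⟨2 ^ f * q, ?_⟩
          have : 2 * m = 2 * (2 * (2 ^ f * q)) := by rw [← hm, hn]; ring
          omega
        have hz : r ^ ((2 * k : ℕ) : ℤ) = r ^ (k : ℤ) * r ^ (k : ℤ) := by
          rw [← zpow_add]; congr 1; push_cast; ring
        have hz2 := h.swap.s_half_mul hm
        have e2 : r ^ ((2 * k : ℕ) : ℤ) * s ^ (q : ℤ) * r ^ ((2 * k : ℕ) : ℤ) = s ^ (-(q : ℤ)) := by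
          rw [mul_assoc _ d, h.t_sz', ← mul_assoc, ← mul_assoc] at e1
          have e3 := mul_right_cancel e1
          have e4 : s ^ (q : ℤ) = r ^ ((2 * k : ℕ) : ℤ) * s ^ (-(q : ℤ)) * r ^ ((2 * k : ℕ) : ℤ) := by
            rw [e3, mul_assoc, hz2, mul_one]
          rw [e4]
          simp only [← mul_assoc, hz2, one_mul]
          rw [mul_assoc, hz2, mul_one]
        set y := r ^ (k : ℤ) with hy
        have hyt : d * y = y⁻¹ * d := by rw [hy, h.t_rz', zpow_neg]
        have hyt' : d * y⁻¹ = y * d := by rw [hy, ← zpow_neg, h.t_rz', neg_neg]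
        -- The reflection (now named `d`) inverts `y` and `s ^ q`, and `y ^ 2` also inverts `s ^ q`;
        -- the two effects cancel. The centralizer of the reflection consists of products of
        -- commuting involutions, so `s ^ q` would have order at most two.
        have e5 : (y * s ^ (q : ℤ) * y⁻¹) * d = d * (y * s ^ (q : ℤ) * y⁻¹) := by
          rw [hz] at e2 hz2
          have e6 : s ^ (-(q : ℤ)) * (y * y) = (y * y) * s ^ (q : ℤ) := by
            rw [← e2]; rw [mul_assoc, hz2, mul_one]
          have e7 : d * (y * s ^ (q : ℤ) * y⁻¹) = y⁻¹ * (s ^ (-(q : ℤ)) * (y * y)) * y⁻¹ * d := by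
            rw [← mul_assoc, ← mul_assoc, hyt, mul_assoc y⁻¹ d, h.t_sz', mul_assoc, mul_assoc _ d,
              hyt']
            group
          rw [e7, e6]; group
        obtain ⟨a, b, c, ha, hb, hc, hg⟩ := h.cases_of_commute_t hm e5
        have e8 : (y * s ^ (q : ℤ) * y⁻¹) * (y * s ^ (q : ℤ) * y⁻¹) = 1 := by
          have t1 := h.t_s_half hm
          have t2 := h.swap.t_s_half hm
          have t3 := h.s_half_mul hm
          rw [hg]
          have hac : a * c = c * a := by
            rcases ha with rfl | rfl <;> rcases hc with rfl | rfl <;> simp only [mul_one, one_mul, t1]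
          have hbc : b * c = c * b := by
            rcases hb with rfl | rfl <;> rcases hc with rfl | rfl <;> simp only [mul_one, one_mul, t2]
          have hab : a * b = b * a := by
            rcases ha with rfl | rfl <;> rcases hb with rfl | rfl <;> simp only [mul_one, one_mul, hzz]
          have haa : a * a = 1 := by rcases ha with rfl | rfl <;> simp only [mul_one, t3]
          have hbb : b * b = 1 := by rcases hb with rfl | rfl <;> simp only [mul_one, hz2]
          have hcc : c * c = 1 := by rcases hc with rfl | rfl <;> simp only [mul_one, ht2]
          calc a * b * c * (a * b * c) = a * b * (c * a) * (b * c) := by group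
            _ = a * (b * a) * (c * b) * c := by rw [← hac]; group
            _ = (a * a) * (b * b) * (c * c) := by rw [← hab, ← hbc]; group
            _ = 1 := by rw [haa, hbb, hcc]; simp
        apply two_q
        rw [← h.s_eq_one_iff]
        have : s ^ (2 * q : ℤ) = y⁻¹ * ((y * s ^ (q : ℤ) * y⁻¹) * (y * s ^ (q : ℤ) * y⁻¹)) * y := by
          rw [two_mul, zpow_add]; group
        rw [this, e8]; group

end IsRotarySystem

/-! ### Central half-turns and descent to half the degree -/

namespace IsRotarySystem

variable {G : Type*} [Group G] {n : ℕ} {r s t : G} {l : G ≃* G}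

/-- By `card_eq_card_inf_mul` the index is `n / |⟨s⟩ ∩ Y|`, and `⟨s⟩ ∩ Y` contains the 2-part of
`⟨s⟩`. -/
theorem index_dvd_of_mem [Finite G] (h : IsRotarySystem n r s t l) {e q : ℕ} (hq : Odd q)
    (hn : n = 2 ^ e * q) (Y : Subgroup G) (hY : h.stab ≤ Y) (hs : s ^ (q : ℤ) ∈ Y) :
    Y.index ∣ q := by
  have h1 := h.card_eq_card_inf_mul Y hY
  have h2 := Y.card_mul_index
  have h3 : Nat.card (Subgroup.zpowers s ⊓ Y : Subgroup G) * Y.index = n := by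
    have := h.n_pos
    apply Nat.eq_of_mul_eq_mul_left (show 0 < 2 * n by omega)
    rw [h.card_eq, h1, h.card_stab] at h2
    linarith
  have h4 : 2 ^ e ∣ Nat.card (Subgroup.zpowers s ⊓ Y : Subgroup G) := by
    rw [← h.swap.orderOf_r_pow hq hn, ← Nat.card_zpowers]
    apply Subgroup.card_dvd_of_le
    rw [Subgroup.zpowers_le]
    exact ⟨⟨q, rfl⟩, hs⟩
  obtain ⟨c, hc⟩ := h4
  rw [hc, hn, mul_assoc] at h3
  exact ⟨c, by rw [← Nat.eq_of_mul_eq_mul_left (by positivity) h3, mul_comm]⟩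

/-- If the involution of `⟨r⟩` centralizes the 2-part of `⟨s⟩`, then it is central, unless some
sign character separates `t` from `s`. -/
theorem exists_sign_or_central [Finite G] (h : IsRotarySystem n r s t l) {e q : ℕ} (hq : Odd q)
    (hn : n = 2 ^ e * q) {m : ℕ} (hm : n = 2 * m)
    (hc : r ^ (m : ℤ) * s ^ (q : ℤ) = s ^ (q : ℤ) * r ^ (m : ℤ)) :
    (∃ χ : G →* ℤˣ, χ t = -1 ∧ χ s = 1) ∨ ∀ g, r ^ (m : ℤ) * g = g * r ^ (m : ℤ) := by
  -- The centralizer contains the stabilizer and the odd power `s ^ q`, so its index is odd and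
  -- `exists_sign_of_stab_le` applies unless it is the whole group.
  let Y := Subgroup.centralizer {r ^ (m : ℤ)}
  have hmem : ∀ g, g ∈ Y ↔ g * r ^ (m : ℤ) = r ^ (m : ℤ) * g := fun g =>
    Subgroup.mem_centralizer_singleton_iff
  have hs : s ^ (q : ℤ) ∈ Y := (hmem _).2 hc.symm
  have hr : ∀ i : ℤ, r ^ i ∈ Y := fun i =>
    (hmem _).2 (by rw [← zpow_add, ← zpow_add, add_comm])
  have ht : t ∈ Y := (hmem _).2 (h.swap.t_s_half hm)
  have hY : h.stab ≤ Y := by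
    rintro _ ⟨i, rfl | rfl⟩
    · exact hr i
    · exact mul_mem (hr i) ht
  by_cases hT : Y = ⊤
  · right
    intro g
    exact ((hmem g).1 (by rw [hT]; trivial)).symm
  · left
    exact h.exists_sign_of_stab_le Y hY hT (hq.of_dvd_nat (h.index_dvd_of_mem hq hn Y hY hs)) q
      (by exact_mod_cast hq) hs

theorem orderOf_s_half [Finite G] (h : IsRotarySystem n r s t l) {m : ℕ} (hm : n = 2 * m) :
    orderOf (s ^ (m : ℤ)) = 2 :=
  orderOf_eq_prime (by rw [pow_two, h.s_half_mul hm]) (h.s_half_ne_one hm)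

theorem half_inv (h : IsRotarySystem n r s t l) {m : ℕ} (hm : n = 2 * m)
    (hzz : r ^ (m : ℤ) * s ^ (m : ℤ) = s ^ (m : ℤ) * r ^ (m : ℤ)) :
    r ^ (m : ℤ) * s ^ (m : ℤ) * r ^ (m : ℤ) = (s ^ (m : ℤ))⁻¹ := by
  rw [hzz, mul_assoc, h.swap.s_half_mul hm, mul_one, eq_comm]
  exact inv_eq_of_mul_eq_one_right (h.s_half_mul hm)

/-- The four-group generated by the involutions of `⟨r⟩` and `⟨s⟩`. -/
def halves (h : IsRotarySystem n r s t l) {m : ℕ} (hm : n = 2 * m)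
    (hzz : r ^ (m : ℤ) * s ^ (m : ℤ) = s ^ (m : ℤ) * r ^ (m : ℤ)) : Subgroup G :=
  dihedralSubgroup (s ^ (m : ℤ)) (r ^ (m : ℤ)) (h.swap.s_half_mul hm) (h.half_inv hm hzz)

theorem card_halves [Finite G] (h : IsRotarySystem n r s t l) {m : ℕ} (hm : n = 2 * m)
    (hzz : r ^ (m : ℤ) * s ^ (m : ℤ) = s ^ (m : ℤ) * r ^ (m : ℤ)) :
    Nat.card (h.halves hm hzz) = 4 := by
  rw [halves, card_dihedralSubgroup, h.orderOf_s_half hm]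
  rintro ⟨c, hc⟩
  change (s ^ (m : ℤ)) ^ c = r ^ (m : ℤ) at hc
  rw [← zpow_mul] at hc
  have h2 : s ^ ((m : ℤ) * c) = 1 := by
    rw [h.s_eq_one_iff, ← h.s_mem_stab, hc]; exact h.r_mem_stab _
  exact h.swap.s_half_ne_one hm (by rw [← hc, h2])

theorem mem_halves (h : IsRotarySystem n r s t l) {m : ℕ} (hm : n = 2 * m)
    (hzz : r ^ (m : ℤ) * s ^ (m : ℤ) = s ^ (m : ℤ) * r ^ (m : ℤ)) {g : G} :
    g ∈ h.halves hm hzz ↔ ∃ i j : ℤ, g = s ^ (m * i : ℤ) * r ^ (m * j : ℤ) := by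
  constructor
  · rintro ⟨i, rfl | rfl⟩
    · exact ⟨i, 0, by simp [zpow_mul]⟩
    · exact ⟨i, 1, by simp [zpow_mul]⟩
  · rintro ⟨i, j, rfl⟩
    have h1 : s ^ (m : ℤ) ∈ h.halves hm hzz := ⟨1, Or.inl (zpow_one _).symm⟩
    have h2 : r ^ (m : ℤ) ∈ h.halves hm hzz := ⟨0, Or.inr (by simp)⟩
    rw [zpow_mul, zpow_mul]
    exact mul_mem (zpow_mem h1 i) (zpow_mem h2 j)

theorem map_halves (h : IsRotarySystem n r s t l) {m : ℕ} (hm : n = 2 * m)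
    (hzz : r ^ (m : ℤ) * s ^ (m : ℤ) = s ^ (m : ℤ) * r ^ (m : ℤ)) :
    (h.halves hm hzz).map (l : G →* G) = h.halves hm hzz := by
  have h0 : ∀ i j : ℤ, r ^ (m * i : ℤ) * s ^ (m * j : ℤ) = s ^ (m * j : ℤ) * r ^ (m * i : ℤ) := by
    intro i j
    simp only [zpow_mul]
    exact Commute.zpow_zpow hzz i j
  ext g
  rw [Subgroup.mem_map]
  constructor
  · rintro ⟨x, hx, rfl⟩
    obtain ⟨i, j, rfl⟩ := (h.mem_halves hm hzz).1 hx
    refine (h.mem_halves hm hzz).2 ⟨j, i, ?_⟩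
    rw [← h0]
    simp [h.l_rz, h.l_sz]
  · intro hx
    obtain ⟨i, j, rfl⟩ := (h.mem_halves hm hzz).1 hx
    refine ⟨s ^ (m * j : ℤ) * r ^ (m * i : ℤ), (h.mem_halves hm hzz).2 ⟨_, _, rfl⟩, ?_⟩
    rw [← h0]
    simp [h.l_rz, h.l_sz]

/-- Dividing by the four-group kills one involution in each rotation group, so the degree halves and
the order becomes `2 * n ^ 2 / 4 = 2 * m ^ 2`. -/
theorem quotient [Finite G] (h : IsRotarySystem n r s t l) {m : ℕ} (hm : n = 2 * m)
    (hzz : r ^ (m : ℤ) * s ^ (m : ℤ) = s ^ (m : ℤ) * r ^ (m : ℤ))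
    [hN : (h.halves hm hzz).Normal] :
    IsRotarySystem m (r : G ⧸ h.halves hm hzz) s t
      (QuotientGroup.congr _ _ l (h.map_halves hm hzz)) where
  r_pow := by
    rw [← QuotientGroup.mk_pow, QuotientGroup.eq_one_iff]
    exact (h.mem_halves hm hzz).2 ⟨0, 1, by simp⟩
  s_pow := by
    rw [← QuotientGroup.mk_pow, QuotientGroup.eq_one_iff]
    exact (h.mem_halves hm hzz).2 ⟨1, 0, by simp⟩
  t_mul := by rw [← QuotientGroup.mk_mul, h.t_mul]; rfl
  t_r := by rw [← QuotientGroup.mk_mul, ← QuotientGroup.mk_mul, h.t_r]; rfl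
  t_s := by rw [← QuotientGroup.mk_mul, ← QuotientGroup.mk_mul, h.t_s]; rfl
  l_r := by rw [QuotientGroup.congr_mk, h.l_r]
  l_s := by rw [QuotientGroup.congr_mk, h.l_s]
  l_t := by rw [QuotientGroup.congr_mk, h.l_t]
  card_eq := by
    have := (h.halves hm hzz).card_mul_index
    rw [h.card_halves hm hzz, h.card_eq] at this
    have h2 : 2 * n ^ 2 = 8 * m ^ 2 := by rw [hm]; ring
    change (h.halves hm hzz).index = _
    linarith
  exists_eq := by
    intro g
    induction g using QuotientGroup.induction_on with
    | H g =>
      obtain ⟨j, i, rfl | rfl⟩ := h.exists_eq g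
      · exact ⟨j, i, Or.inl (by simp)⟩
      · exact ⟨j, i, Or.inr (by simp)⟩

theorem halves_normal (h : IsRotarySystem n r s t l) {m : ℕ} (hm : n = 2 * m)
    (hzz : r ^ (m : ℤ) * s ^ (m : ℤ) = s ^ (m : ℤ) * r ^ (m : ℤ))
    (hr : ∀ g, r ^ (m : ℤ) * g = g * r ^ (m : ℤ)) (hs : ∀ g, s ^ (m : ℤ) * g = g * s ^ (m : ℤ)) :
    (h.halves hm hzz).Normal := by
  constructor
  intro x hx g
  obtain ⟨i, j, rfl⟩ := (h.mem_halves hm hzz).1 hx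
  have h1 : Commute (s ^ (m * i : ℤ) * r ^ (m * j : ℤ)) g := by
    rw [zpow_mul, zpow_mul]
    exact (Commute.zpow_left (hs g) i).mul_left (Commute.zpow_left (hr g) j)
  rw [← h1.eq, mul_inv_cancel_right]
  exact hx

theorem central_swap (h : IsRotarySystem n r s t l) {m : ℤ}
    (hr : ∀ g, r ^ m * g = g * r ^ m) (g : G) : s ^ m * g = g * s ^ m := by
  have := congrArg l (hr (l.symm g))
  simpa [h.l_rz] using this

/-- In the other case of `half_comm_or`, every sign character would be trivial at `t`; but for even
`m` the reflection is odd on the cosets of the stabilizer. -/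
theorem half_comm_of_even [Finite G] (h : IsRotarySystem n r s t l) {m : ℕ} (hm : n = 2 * m)
    (hm2 : Even m) : r ^ (m : ℤ) * s ^ (m : ℤ) = s ^ (m : ℤ) * r ^ (m : ℤ) := by
  rcases h.half_comm_or hm with h1 | h1
  · exact h1
  · exfalso
    have h2 := congrArg (cosetSign h.stab) h1
    have hn := h.n_pos
    rw [map_mul, map_mul, map_mul, h.sign_t hm, Odd.neg_one_pow (by grind), mul_comm] at h2
    have := mul_left_cancel ((mul_one _).trans h2)
    exact absurd this (by decide)

end IsRotarySystem

/-- No rotary system of even degree has all its sign characters constant on `{r, s, t}`. -/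
theorem IsRotarySystem.false_of_sign_eq (n : ℕ) : ∀ {G : Type*} [Group G] [Finite G]
    {r s t : G} {l : G ≃* G}, IsRotarySystem n r s t l → Even n →
    (∀ χ : G →* ℤˣ, χ r = χ s ∧ χ s = χ t) → False := by
  induction n using Nat.strong_induction_on with
  | _ n ih =>
  intro G _ _ r s t l h hn hχ
  obtain ⟨m, hm⟩ := hn
  rw [← two_mul] at hm
  have hpos := h.n_pos
  rcases Nat.even_or_odd m with hm2 | hm2
  · have hzz := h.half_comm_of_even hm hm2
    obtain ⟨e, q, hq, hnq⟩ := Nat.exists_eq_two_pow_mul_odd hpos.ne'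
    have he : 2 ≤ e := by
      by_contra! hlt
      obtain ⟨c, rfl⟩ := hm2
      interval_cases e <;> grind
    -- A character separating `t` from `s` contradicts the hypothesis, so both half-turns are
    -- central. The hypothesis passes to the quotient because its characters inflate to `G`.
    rcases h.exists_sign_or_central hq hnq hm (h.half_commute hq he hnq hm hzz) with ⟨χ, h1, h2⟩ | hr
    · have := (hχ χ).2
      rw [h1, h2] at this
      exact absurd this (by decide)
    · have hs := h.central_swap hr
      have := h.halves_normal hm hzz hr hs
      refine ih m (by omega) (h.quotient hm hzz) hm2 (fun χ => ?_)
      exact hχ (χ.comp (QuotientGroup.mk' _))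
  -- The descent ends at odd `m`, where `s` is odd and `t` is even on the cosets of the stabilizer.
  · have h1 := (hχ (cosetSign h.stab)).2
    rw [h.sign_s hm, h.sign_t hm, Even.neg_one_pow (by grind)] at h1
    exact absurd h1 (by decide)

/-! ### Degrees divisible by four -/

namespace IsRotarySystem

variable {G : Type*} [Group G] {n : ℕ} {r s t : G} {l : G ≃* G}

/-- This is how nonorientability enters the sign arguments: the values on `r` and `s` determine the
value at `t`. -/
theorem hom_t_eq (ht : t ∈ Subgroup.closure {r, s}) {χ ψ : G →* ℤˣ} (hr : χ r = ψ r)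
    (hs : χ s = ψ s) : χ t = ψ t := by
  have : Subgroup.closure {r, s} ≤ χ.eqLocus ψ := by
    rw [Subgroup.closure_le]
    rintro x (rfl | rfl)
    · exact hr
    · exact hs
  exact this ht

/-- The sign character on the other colour class. -/
noncomputable def signW [Finite G] (h : IsRotarySystem n r s t l) : G →* ℤˣ :=
  (cosetSign h.stab).comp l.toMonoidHom

theorem signW_apply [Finite G] (h : IsRotarySystem n r s t l) (g : G) :
    h.signW g = cosetSign h.stab (l g) := rfl

/-- If `4 ∣ n` and `r` acts evenly on its own colour class, then no conjugate of `t` is of the form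
`s ^ j * r ^ i`. -/
theorem conj_t_ne [Finite G] (h : IsRotarySystem n r s t l) {m : ℕ} (hm : n = 2 * m)
    (hm2 : Even m) (hr : cosetSign h.stab r = 1) (x : G) (j i : ℤ) :
    x⁻¹ * t * x ≠ s ^ j * r ^ i := by
  intro hw
  have hpos := h.n_pos
  have hVs := h.sign_s hm
  have hVt := h.sign_t hm
  rw [Odd.neg_one_pow (by grind)] at hVt
  have hWr : h.signW r = -1 := by rw [signW_apply, h.l_r, hVs]
  have hWs : h.signW s = 1 := by rw [signW_apply, h.l_s, hr]
  have hWt : h.signW t = -1 := by rw [signW_apply, h.l_t, hVt]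
  set w := s ^ j * r ^ i with hwd
  have hw2 : w⁻¹ = w := by
    rw [← hw, mul_inv_rev, mul_inv_rev, h.t_inv]; group
  -- Both sides equal `r ^ (-i) * t`, as `w` is an involution. Conjugating by `x` moves `s ^ j * t`
  -- into the centralizer of `t`.
  have h1 : (s ^ j * t) * w = w * (s ^ j * t) := by
    have e1 : s ^ j * t * w = r ^ (-i) * t := by
      calc s ^ j * t * w = s ^ j * (t * s ^ j) * r ^ i := by rw [hwd]; group
        _ = t * r ^ i := by rw [h.t_sz']; group
        _ = _ := h.t_rz' i
    have e2 : w⁻¹ * (s ^ j * t) = r ^ (-i) * t := by rw [hwd]; group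
    rw [e1, ← e2, hw2]
  have h2 : (x * (s ^ j * t) * x⁻¹) * t = t * (x * (s ^ j * t) * x⁻¹) := by
    have h3 : x * (s ^ j * t) * x⁻¹ * (x * w * x⁻¹) = x * w * x⁻¹ * (x * (s ^ j * t) * x⁻¹) := by
      calc x * (s ^ j * t) * x⁻¹ * (x * w * x⁻¹) = x * ((s ^ j * t) * w) * x⁻¹ := by group
        _ = x * (w * (s ^ j * t)) * x⁻¹ := by rw [h1]
        _ = _ := by group
    rwa [show x * w * x⁻¹ = t by rw [← hw]; group] at h3
  obtain ⟨a, b, c, ha, hb, hc, hg⟩ := h.cases_of_commute_t hm h2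
  have e1 : ∀ χ : G →* ℤˣ, χ (s ^ j * t) = χ c := by
    intro χ
    have := congrArg χ hg
    have h3 : ∀ u : ℤˣ, u ^ (m : ℤ) = 1 := by
      intro u
      obtain ⟨k, rfl⟩ := hm2
      rw [Nat.cast_add, zpow_add]
      exact Int.units_mul_self _
    have ha1 : χ a = 1 := by
      rcases ha with rfl | rfl
      · simp
      · rw [map_zpow, h3]
    have hb1 : χ b = 1 := by
      rcases hb with rfl | rfl
      · simp
      · rw [map_zpow, h3]
    rw [map_mul χ _ c, map_mul χ a b, ha1, hb1, one_mul, one_mul, map_mul, map_mul, map_inv,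
      mul_right_comm, mul_inv_cancel, one_mul] at this
    exact this
  have e2 : cosetSign h.stab c = h.signW c := by
    rcases hc with rfl | rfl
    · simp
    · rw [hVt, hWt]
  -- The two colour-class characters agree on `c`, hence on `s ^ j * t`. They agree at `t` but not
  -- at `s`, so `j` is even; then `s ^ j * r ^ i` is even on the first class while `t` is odd.
  rw [← e1, ← e1, map_mul, map_mul, map_zpow, map_zpow, hVt, hWs, hWt, hVs] at e2
  have e3 : (-1 : ℤˣ) ^ j = 1 := by simpa using mul_right_cancel e2
  have e4 := congrArg (cosetSign h.stab) hw
  rw [hwd, map_mul, map_mul, map_mul, map_zpow, map_zpow, hr, hVs, e3, hVt, map_inv, one_zpow,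
    mul_right_comm, inv_mul_cancel] at e4
  exact absurd e4 (by decide)

/-- Compare the compatible Sylow subgroup `P` with `S = ⟨r ^ q, s ^ q⟩`. If `S = P`, an index-two
subgroup of `P` must coincide with the kernel of a sign, yet contains `t`. Otherwise `S = ⟨s ^ q⟩ *
⟨r ^ q⟩` contains no conjugate of `t`, and the action on the cosets of `S` gives an impossible
character. -/
theorem not_four_dvd_of_sign_r [Finite G] (h : IsRotarySystem n r s t l)
    (ht : t ∈ Subgroup.closure {r, s}) {m : ℕ} (hm : n = 2 * m) (hm2 : Even m)
    (hVr : cosetSign h.stab r = 1) : False := by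
  have hpos := h.n_pos
  have hVs := h.sign_s hm
  have hVt := h.sign_t hm
  rw [Odd.neg_one_pow (by grind)] at hVt
  obtain ⟨e, q, hq, hnq⟩ := Nat.exists_eq_two_pow_mul_odd hpos.ne'
  have he : 2 ≤ e := by
    by_contra! hlt
    obtain ⟨c, rfl⟩ := hm2
    interval_cases e <;> grind
  have : Fact (Nat.Prime 2) := ⟨Nat.prime_two⟩
  obtain ⟨P, hP, hPc, hrP, hsP, htP⟩ := h.exists_sylow hq hnq
  have hre := h.orderOf_r_pow hq hnq
  have hse := h.swap.orderOf_r_pow hq hnq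
  have hqz : Odd (q : ℤ) := by exact_mod_cast hq
  let S := Subgroup.closure {r ^ (q : ℤ), s ^ (q : ℤ)}
  have hSP : S ≤ P := by
    rw [Subgroup.closure_le]
    rintro x (rfl | rfl)
    · exact hrP
    · exact hsP
  have hrS : r ^ (q : ℤ) ∈ S := Subgroup.subset_closure (by simp)
  have hsS : s ^ (q : ℤ) ∈ S := Subgroup.subset_closure (by simp)
  by_cases hPS : P ≤ S
  · -- the rotations generate the Sylow subgroup
    have htr : t * r ^ (q : ℤ) * t = (r ^ (q : ℤ))⁻¹ := by rw [h.t_rz, zpow_neg]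
    let D := dihedralSubgroup (r ^ (q : ℤ)) t h.t_mul htr
    have hD : D ≤ P := by
      rintro _ ⟨i, rfl | rfl⟩
      · exact zpow_mem hrP i
      · exact mul_mem (zpow_mem hrP i) htP
    have cD : Nat.card (D.subgroupOf P) = 2 ^ (e + 1) := by
      rw [Nat.card_congr (Subgroup.subgroupOfEquivOfLe hD).toEquiv, card_dihedralSubgroup, hre, pow_succ']
      rintro ⟨c, hc⟩
      apply h.nf_ne 0 (q * c)
      rw [zpow_mul]
      simpa using hc
    -- A subgroup of index two in `P` above `⟨r ^ q, t⟩`; it exists since `e + 1 ≤ 2 * e`.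
    obtain ⟨K, hKc, hDK⟩ := Sylow.exists_subgroup_card_pow_prime_le (G := P) 2 (m := 2 * e)
      (by rw [hPc]; exact pow_dvd_pow 2 (by omega)) (D.subgroupOf P) cD (by omega)
    have hK2 : K.index = 2 := by
      have := K.card_mul_index
      rw [hKc, hPc, pow_succ] at this
      exact Nat.eq_of_mul_eq_mul_left (by positivity) this
    have hrK : (⟨r ^ (q : ℤ), hrP⟩ : P) ∈ K := hDK ⟨1, Or.inl (zpow_one _).symm⟩
    have htK : (⟨t, htP⟩ : P) ∈ K := hDK ⟨0, Or.inr (by simp)⟩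
    have hsK : (⟨s ^ (q : ℤ), hsP⟩ : P) ∉ K := by
      intro hsK
      have h1 : P ≤ K.map P.subtype := by
        refine hPS.trans ?_
        rw [Subgroup.closure_le]
        rintro x (rfl | rfl)
        · exact ⟨_, hrK, rfl⟩
        · exact ⟨_, hsK, rfl⟩
      have h2 : K = ⊤ := by
        rw [eq_top_iff]
        rintro ⟨x, hx⟩ -
        obtain ⟨y, hy, hyx⟩ := h1 hx
        rwa [show (⟨x, hx⟩ : P) = y from Subtype.ext hyx.symm]
      rw [h2, Subgroup.index_top] at hK2
      omega
    -- Membership in `K` and the sign both define homomorphisms to a group of order two, and they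
    -- agree on the generators `r ^ q`, `s ^ q`.
    have key : ∀ g (hg : g ∈ S), (⟨g, hSP hg⟩ : P) ∈ K ↔ cosetSign h.stab g = 1 := by
      intro g hg
      induction hg using Subgroup.closure_induction with
      | mem x hx =>
        rcases hx with rfl | rfl
        · exact iff_of_true hrK (by rw [map_zpow, hVr, one_zpow])
        · exact iff_of_false hsK (by rw [map_zpow, hVs, hqz.neg_one_zpow]; decide)
      | one => exact iff_of_true (one_mem K) (map_one _)
      | mul x y hx hy ihx ihy =>
        rw [show (⟨x * y, hSP (mul_mem hx hy)⟩ : P) = ⟨x, hSP hx⟩ * ⟨y, hSP hy⟩ from rfl,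
          Subgroup.mul_mem_iff_of_index_two hK2, ihx, ihy, map_mul]
        rcases Int.units_eq_one_or (cosetSign h.stab x) with h1 | h1 <;>
        rcases Int.units_eq_one_or (cosetSign h.stab y) with h2 | h2 <;> rw [h1, h2] <;> decide
      | inv x hx ihx =>
        rw [show (⟨x⁻¹, hSP (inv_mem hx)⟩ : P) = ⟨x, hSP hx⟩⁻¹ from rfl, inv_mem_iff, ihx, map_inv,
          inv_eq_one]
    have := (key t (hPS htP)).1 htK
    rw [hVt] at this
    exact absurd this (by decide)
  · have hd : Disjoint (Subgroup.zpowers (s ^ (q : ℤ))) (Subgroup.zpowers (r ^ (q : ℤ))) := by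
      rw [Subgroup.disjoint_def]
      rintro x ⟨c, rfl⟩ ⟨d, hd⟩
      change (s ^ (q : ℤ)) ^ c = 1
      change (r ^ (q : ℤ)) ^ d = (s ^ (q : ℤ)) ^ c at hd
      rw [← zpow_mul] at hd ⊢
      rw [← zpow_mul] at hd
      rw [h.s_eq_one_iff, ← h.s_mem_stab, ← hd]
      exact h.r_mem_stab _
    have hZs : Subgroup.zpowers (s ^ (q : ℤ)) ≤ S := by rwa [Subgroup.zpowers_le]
    have hZr : Subgroup.zpowers (r ^ (q : ℤ)) ≤ S := by rwa [Subgroup.zpowers_le]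
    have hle := card_mul_card_le_of_disjoint hZs hZr hd
    rw [Nat.card_zpowers, Nat.card_zpowers, hre, hse] at hle
    -- A proper divisor of `2 ^ (2e + 1)` that is at least `2 ^ (2e)`.
    have hSc : Nat.card S = 2 ^ e * 2 ^ e := by
      obtain ⟨c, hc⟩ := Subgroup.card_dvd_of_le hSP
      have hne : Nat.card S ≠ Nat.card P := by
        intro heq
        exact hPS (le_of_eq (Subgroup.eq_of_le_of_card_ge hSP heq.ge).symm)
      rw [hPc, show 2 ^ (2 * e + 1) = 2 * (2 ^ e * 2 ^ e) by ring] at hc hne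
      have h1 : 0 < 2 ^ e * 2 ^ e := by positivity
      have hc2 : c ≠ 1 := by rintro rfl; exact hne (by rw [hc, mul_one])
      have hc0 : c ≠ 0 := by rintro rfl; omega
      have hc3 : c ≤ 2 := by
        by_contra! hlt
        have := Nat.mul_le_mul hle hlt
        omega
      have : c = 2 := by omega
      subst this
      omega
    have hSmem : ∀ g ∈ S, ∃ j i : ℤ, g = s ^ j * r ^ i := by
      let f : Subgroup.zpowers (s ^ (q : ℤ)) × Subgroup.zpowers (r ^ (q : ℤ)) → S :=
        fun x => ⟨x.1 * x.2, mul_mem (hZs x.1.2) (hZr x.2.2)⟩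
      have hf : Function.Injective f := fun x y hxy =>
        Subgroup.mul_injective_of_disjoint hd (Subtype.ext_iff.1 hxy)
      have hb := (Nat.bijective_iff_injective_and_card f).2 ⟨hf, by
        rw [Nat.card_prod, Nat.card_zpowers, Nat.card_zpowers, hre, hse, hSc]⟩
      intro g hg
      obtain ⟨⟨⟨_, ⟨c, rfl⟩⟩, ⟨_, ⟨d, rfl⟩⟩⟩, hcd⟩ := hb.2 ⟨g, hg⟩
      refine ⟨q * c, q * d, ?_⟩
      rw [zpow_mul, zpow_mul]
      exact (Subtype.ext_iff.1 hcd).symm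
    have hidx : S.index = 2 * q ^ 2 := by
      have h1 := S.card_mul_index
      rw [hSc, h.card_eq, hnq] at h1
      apply Nat.eq_of_mul_eq_mul_left (show 0 < 2 ^ e * 2 ^ e by positivity)
      rw [h1]; ring
    -- By `conj_t_ne` no conjugate of `t` lies in `S`, so `t` acts freely, and the index is twice an
    -- odd number.
    have hχt : cosetSign S t = -1 := by
      rw [cosetSign_eq_of_free S t h.t_mul (q ^ 2) ?_ hidx, hq.pow.neg_one_pow]
      intro x hx
      obtain ⟨j, i, hji⟩ := hSmem _ hx
      exact h.conj_t_ne hm hm2 hVr x j i hji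
    have hlS : ∀ x, x ∈ S → l x ∈ S := by
      intro x hx
      induction hx using Subgroup.closure_induction with
      | mem x hx =>
        rcases hx with rfl | rfl
        · rw [h.l_rz]; exact hsS
        · rw [h.l_sz]; exact hrS
      | one => rw [map_one]; exact one_mem _
      | mul x y _ _ ihx ihy => rw [map_mul]; exact mul_mem ihx ihy
      | inv x _ ihx => rw [map_inv]; exact inv_mem ihx
    have hll : ∀ x, l (l x) = x := by
      intro x
      obtain ⟨j, i, rfl | rfl⟩ := h.exists_eq x <;> simp only [map_mul, h.l_rz, h.l_sz, h.l_t]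
    have hrs : cosetSign S r = cosetSign S s := by
      rw [← h.l_s]
      exact cosetSign_map S l (fun x => ⟨fun hx => by rw [← hll x]; exact hlS _ hx, hlS x⟩) s
    have hWr : h.signW r = -1 := by rw [signW_apply, h.l_r, hVs]
    have hWs : h.signW s = 1 := by rw [signW_apply, h.l_s, hVr]
    have hWt : h.signW t = -1 := by rw [signW_apply, h.l_t, hVt]
    -- As `S` is preserved by `l`, the new character has equal values on `r` and `s`. It is
    -- therefore trivial or the product of the two colour-class characters; both of these are `1` at
    -- `t`.
    rcases Int.units_eq_one_or (cosetSign S s) with h1 | h1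
    · have := hom_t_eq ht (χ := cosetSign S) (ψ := 1) (by rw [hrs, h1]; rfl) (by rw [h1]; rfl)
      rw [hχt, MonoidHom.one_apply] at this
      exact absurd this (by decide)
    · have := hom_t_eq ht (χ := cosetSign S) (ψ := cosetSign h.stab * h.signW)
        (by rw [hrs, h1, MonoidHom.mul_apply, hVr, hWr]; decide)
        (by rw [h1, MonoidHom.mul_apply, hVs, hWs]; decide)
      rw [hχt, MonoidHom.mul_apply, hVt, hWt] at this
      exact absurd this (by decide)

/-- The degree of a nonorientable rotary system is not divisible by 4. -/
theorem not_four_dvd [Finite G] (h : IsRotarySystem n r s t l)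
    (ht : t ∈ Subgroup.closure {r, s}) {m : ℕ} (hm : n = 2 * m) : ¬ Even m := by
  intro hm2
  have hpos := h.n_pos
  have hVs := h.sign_s hm
  have hVt := h.sign_t hm
  rw [Odd.neg_one_pow (by grind)] at hVt
  rcases Int.units_eq_one_or (cosetSign h.stab r) with hVr | hVr
  · exact h.not_four_dvd_of_sign_r ht hm hm2 hVr
  -- Now `cosetSign h.stab` is `-1` on all of `r`, `s`, `t`. A character with equal values on `r`
  -- and `s` is trivial or this one.
  · refine IsRotarySystem.false_of_sign_eq n h ⟨m, by omega⟩ (fun χ => ?_)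
    by_cases hrs : χ r = χ s
    · refine ⟨hrs, ?_⟩
      rcases Int.units_eq_one_or (χ s) with h1 | h1
      · have := hom_t_eq ht (χ := χ) (ψ := 1) (by rw [hrs, h1]; rfl) (by rw [h1]; rfl)
        rw [this, h1]; rfl
      · have := hom_t_eq ht (χ := χ) (ψ := cosetSign h.stab) (by rw [hrs, h1, hVr])
          (by rw [h1, hVs])
        rw [this, h1, hVt]
    · exfalso
      have e1 : χ r * χ s = -1 := by
        rcases Int.units_eq_one_or (χ s) with h1 | h1 <;>
        rcases Int.units_eq_one_or (χ r) with h2 | h2 <;> rw [h1, h2] at hrs ⊢ <;> simp at hrs ⊢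
      -- If `χ` separated `r` from `s`, then `χ * (χ ∘ l)` would be `-1` on both and hence at `t`,
      -- where its value is `χ t ^ 2 = 1`.
      have := hom_t_eq ht (χ := χ * χ.comp l.toMonoidHom) (ψ := cosetSign h.stab)
        (by
          rw [hVr, MonoidHom.mul_apply]
          change χ r * χ (l r) = -1
          rw [h.l_r, e1])
        (by
          rw [hVs, MonoidHom.mul_apply]
          change χ s * χ (l s) = -1
          rw [h.l_s, mul_comm, e1])
      rw [hVt, MonoidHom.mul_apply] at this
      change χ t * χ (l t) = -1 at this
      rw [h.l_t, Int.units_mul_self] at this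
      exact absurd this (by decide)

end IsRotarySystem

/-! ### Twice an odd degree: a separating character and the odd-order normal subgroup -/

namespace IsRotarySystem

variable {G : Type*} [Group G] {n : ℕ} {r s t : G} {l : G ≃* G}

theorem s_half_conj_notMem_stab [Finite G] (h : IsRotarySystem n r s t l) {m : ℕ}
    (hm : n = 2 * m) (x : G) :
    x⁻¹ * s ^ (m : ℤ) * x ∉ h.stab := by
  obtain ⟨j, y, hy, rfl⟩ := h.exists_eq_mul x
  intro hx
  apply h.s_half_ne hm
  have : s ^ (m : ℤ) = y * ((s ^ j * y)⁻¹ * s ^ (m : ℤ) * (s ^ j * y)) * y⁻¹ := by group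
  rw [this]
  exact mul_mem (mul_mem hy hx) (inv_mem hy)

theorem hom_half {m : ℕ} (hmo : Odd m) (χ : G →* ℤˣ) (g : G) : χ (g ^ (m : ℤ)) = χ g := by
  obtain ⟨k, rfl⟩ := hmo
  rw [zpow_natCast, map_pow, pow_succ, pow_mul, sq, Int.units_mul_self, one_pow, one_mul]

/-- The action of `r ^ m` on the cosets of `⟨r ^ m, t⟩` is even when `r ^ m` and `s ^ m` do not
commute, whereas that of `s ^ m` is odd. -/
theorem exists_sign_of_not_commute [Finite G] (h : IsRotarySystem n r s t l) {m : ℕ}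
    (hm : n = 2 * m) (hmo : Odd m)
    (hzz : r ^ (m : ℤ) * s ^ (m : ℤ) = s ^ (m : ℤ) * r ^ (m : ℤ) * t) :
    ∃ χ : G →* ℤˣ, χ r = 1 ∧ χ s = -1 := by
  have hpos := h.n_pos
  have hrr := h.swap.s_half_mul hm
  have hss := h.s_half_mul hm
  have hrt := h.swap.t_s_half hm
  have hst := h.t_s_half hm
  have hr1 := h.swap.s_half_ne_one hm
  have hor : orderOf (r ^ (m : ℤ)) = 2 := h.swap.orderOf_s_half hm
  have htr : t * r ^ (m : ℤ) * t = (r ^ (m : ℤ))⁻¹ := by rw [h.t_rz, zpow_neg]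
  set U := dihedralSubgroup (r ^ (m : ℤ)) t h.t_mul htr with hU
  have hUs : U ≤ h.stab := by
    rintro _ ⟨i, rfl | rfl⟩
    · rw [← zpow_mul]; exact h.r_mem_stab _
    · rw [← zpow_mul]; exact ⟨_, Or.inr rfl⟩
  have hUc : Nat.card U = 4 := by
    rw [card_dihedralSubgroup, hor]
    rintro ⟨c, hc⟩
    apply h.nf_ne 0 (m * c)
    rw [zpow_mul]
    simpa using hc
  have hidx : U.index = 2 * m ^ 2 := by
    have := U.card_mul_index
    rw [hUc, h.card_eq, hm] at this
    linarith
  refine ⟨cosetSign U, ?_, ?_⟩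
  swap
  · rw [← hom_half hmo, cosetSign_eq_of_free U _ hss (m ^ 2) (fun x hx => ?_) hidx,
      hmo.pow.neg_one_pow]
    exact h.s_half_conj_notMem_stab hm x (hUs hx)
  · rw [← hom_half hmo]
    set z := r ^ (m : ℤ) with hz
    set z' := s ^ (m : ℤ) with hz'
    have hzU : ∀ g ∈ U, g = 1 ∨ g = z ∨ g = t ∨ g = z * t := by
      rintro _ ⟨i, hi⟩
      have : z ^ i = 1 ∨ z ^ i = z := by
        rw [hz, ← zpow_mul]; exact h.swap.s_half hm i
      rcases this with h1 | h1 <;> rw [h1] at hi <;> try rw [one_mul] at hi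
      all_goals tauto
    have hzmem : z ∈ U := ⟨1, Or.inl (zpow_one _).symm⟩
    have hztmem : z * t ∈ U := ⟨1, Or.inr (by rw [zpow_one])⟩
    let C := Subgroup.centralizer {z}
    have hC : ∀ g, g ∈ C ↔ z * g = g * z := fun g => Subgroup.mem_centralizer_singleton_iff.trans eq_comm
    have hconj : z'⁻¹ * z * z' = z * t := by
      rw [mul_assoc, hzz, mul_assoc z', inv_mul_cancel_left]
    -- A conjugate of `z` in `U` is `z` or `z * t`, the latter obtained through `z'`; it is not `t`,
    -- since `t_conj_mem_stab` would make `z` a reflection. The conjugating elements thus form two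
    -- cosets of the centralizer.
    have hS : {g : G | g⁻¹ * z * g ∈ U} = (C : Set G) ∪ (fun g => g * z') '' C := by
      ext g
      simp only [Set.mem_ofPred_eq, Set.mem_union, SetLike.mem_coe, Set.mem_image]
      constructor
      · intro hg
        rcases hzU _ hg with h1 | h1 | h1 | h1
        · exfalso
          apply hr1
          have : z = g * (g⁻¹ * z * g) * g⁻¹ := by group
          rw [this, h1]; group
        · left
          rw [hC]
          conv_rhs => rw [← h1]
          group
        · exfalso
          have h2 : (g⁻¹)⁻¹ * t * g⁻¹ = z := by rw [← h1]; group
          obtain ⟨i, hi⟩ := h.t_conj_mem_stab (x := g⁻¹) (by rw [h2]; exact hUs hzmem)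
          rw [h2] at hi
          apply h.nf_ne 0 (-(2 * i) + m)
          rw [zpow_add, ← hz, hi, ← mul_assoc (r ^ _), ← zpow_add]
          simp
        · right
          refine ⟨g * z'⁻¹, ?_, by group⟩
          rw [hC]
          have h2 : z' * (z * t) * z'⁻¹ = z := by rw [← hconj]; group
          calc z * (g * z'⁻¹) = g * (g⁻¹ * z * g) * z'⁻¹ := by group
            _ = g * z'⁻¹ * (z' * (z * t) * z'⁻¹) := by rw [h1]; group
            _ = _ := by rw [h2]
      · rintro (hg | ⟨x, hx, rfl⟩)
        · rw [hC] at hg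
          rwa [mul_assoc, hg, inv_mul_cancel_left]
        · rw [hC] at hx
          have : (x * z')⁻¹ * z * (x * z') = z'⁻¹ * (x⁻¹ * (z * x)) * z' := by group
          rw [this, hx, inv_mul_cancel_left, hconj]
          exact hztmem
    have hz'C : z' ∉ C := by
      rw [hC]
      intro hc
      rw [hc, left_eq_mul] at hzz
      exact h.t_ne_one hzz
    have hdisj : Disjoint (C : Set G) ((fun g => g * z') '' C) := by
      rw [Set.disjoint_left]
      rintro _ hx ⟨y, hy, rfl⟩
      exact hz'C (((Subgroup.mul_mem_cancel_left C hy)).1 hx)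
    have hcardS : Nat.card {g : G | g⁻¹ * z * g ∈ U} = 2 * Nat.card C := by
      rw [hS, Nat.card_coe_set_eq, Set.ncard_union_eq hdisj, Set.ncard_image_of_injective _
        (mul_left_injective z'), two_mul]
      rfl
    let c := Nat.card {x : G ⧸ U // z • x = x}
    have hcS : Nat.card {g : G | g⁻¹ * z * g ∈ U} = 4 * c := by
      have hpre : {g : G | g⁻¹ * z * g ∈ U} =
          (QuotientGroup.mk : G → G ⧸ U) ⁻¹' {x | z • x = x} := by
        ext g
        simp only [Set.mem_ofPred_eq, Set.mem_preimage]
        rw [eq_comm, MulAction.Quotient.smul_mk, QuotientGroup.eq, smul_eq_mul, mul_assoc]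
      rw [hpre, Nat.card_congr (QuotientGroup.preimageMkEquivSubgroupProdSet U _), Nat.card_prod,
        hUc]
      rfl
    have hstC : h.stab ≤ C := by
      rintro _ ⟨i, rfl | rfl⟩ <;> rw [hC, hz]
      · rw [← zpow_add, ← zpow_add, add_comm]
      · rw [mul_assoc, hrt, ← mul_assoc, ← mul_assoc, ← zpow_add, ← zpow_add, add_comm]
    have hcC := h.card_eq_card_inf_mul C hstC
    -- Even order would put the unique involution `z'` of `⟨s⟩` in the centralizer of `z`.
    have hodd : Odd (Nat.card (Subgroup.zpowers s ⊓ C : Subgroup G)) := by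
      rw [← Nat.not_even_iff_odd]
      intro hev
      have : Fact (Nat.Prime 2) := ⟨Nat.prime_two⟩
      obtain ⟨⟨x, hx⟩, hx2⟩ := exists_prime_orderOf_dvd_card' 2 hev.two_dvd
      rw [Subgroup.orderOf_mk] at hx2
      obtain ⟨⟨k, rfl⟩, hxC⟩ := hx
      have hk : s ^ (k * 2) = 1 := by
        rw [zpow_mul]
        exact_mod_cast hx2 ▸ pow_orderOf_eq_one (s ^ k)
      rw [h.s_eq_one_iff, hm] at hk
      obtain ⟨d, hd⟩ := hk
      have hkd : k = m * d := by push_cast at hd; linarith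
      rcases h.s_half hm d with h1 | h1
      · rw [← hkd] at h1
        simp [h1] at hx2
      · rw [← hkd] at h1
        exact hz'C (by rw [hz', ← h1]; exact hxC)
    obtain ⟨o, ho⟩ := hodd
    obtain ⟨b, hb⟩ := hmo
    have hc : c = 2 * m * (2 * o + 1) := by
      rw [ho, h.card_stab, hm] at hcC
      rw [hcS, hcC] at hcardS
      linarith
    have hle : c ≤ U.index := by
      exact Finite.card_subtype_le _
    rw [hidx, hc] at hle
    have hob : o ≤ b := by
      have : m * (2 * (2 * o + 1)) ≤ m * (2 * m) := by linarith
      have := Nat.le_of_mul_le_mul_left this (by omega)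
      omega
    obtain ⟨d, rfl⟩ := Nat.exists_eq_add_of_le hob
    -- Of the `2 * m ^ 2` cosets, `2 * m * (2 * o + 1)` are fixed. With `m = 2 * (o + d) + 1` this
    -- leaves `4 * m * d` moved ones, that is, `2 * m * d` transpositions.
    rw [cosetSign_eq_of_fixed U z hrr c (2 * (m * d)) rfl ?_, pow_mul]
    · simp
    · rw [hidx, hc, hb]; ring

end IsRotarySystem

namespace IsRotarySystem

variable {G : Type*} [Group G] {n : ℕ} {r s t : G} {l : G ≃* G}

/-- When `n ≡ 2 (mod 4)`, some sign character of a nonorientable rotary system separates the two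
rotations. -/
theorem exists_sign_ne [Finite G] (h : IsRotarySystem n r s t l)
    (ht : t ∈ Subgroup.closure {r, s}) {m : ℕ} (hm : n = 2 * m) (hmo : Odd m) :
    ∃ χ : G →* ℤˣ, χ r ≠ χ s := by
  rcases h.half_comm_or hm with hzz | hzz
  swap
  · obtain ⟨χ, h1, h2⟩ := h.exists_sign_of_not_commute hm hmo hzz
    exact ⟨χ, by rw [h1, h2]; decide⟩
  rcases h.exists_sign_or_central (e := 1) hmo (by rw [hm, pow_one]) hm hzz with ⟨χ, h1, h2⟩ | hc
  · refine ⟨χ, fun hrs => ?_⟩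
    have := hom_t_eq ht (χ := χ) (ψ := 1) (by rw [hrs, h2]; rfl) (by rw [h2]; rfl)
    rw [h1, MonoidHom.one_apply] at this
    exact absurd this (by decide)
  · exfalso
    have hcs := h.central_swap hc
    have hidx : (h.halves hm hzz).index = 2 * m ^ 2 := by
      have := (h.halves hm hzz).card_mul_index
      rw [h.card_halves hm hzz, h.card_eq] at this
      have h2 : 2 * n ^ 2 = 8 * m ^ 2 := by rw [hm]; ring
      linarith
    have hN := h.halves_normal hm hzz hc hcs
    -- The four-group of half-turns is normal, does not contain `t` and has index twice an odd
    -- number. Modulo it `r` and `s` have odd order, so they are even, contrary to `t ∈ ⟨r, s⟩`.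
    have h1 : cosetSign (h.halves hm hzz) t = -1 := by
      rw [cosetSign_eq_of_free _ t h.t_mul (m ^ 2) (fun x hx => ?_) hidx, hmo.pow.neg_one_pow]
      have := hN.conj_mem _ hx x
      rw [show x * (x⁻¹ * t * x) * x⁻¹ = t by group, h.mem_halves] at this
      obtain ⟨i, j, hij⟩ := this
      exact h.nf_ne _ _ hij.symm
    have h2 : ∀ g : G, g ^ (m : ℤ) ∈ h.halves hm hzz → cosetSign (h.halves hm hzz) g = 1 := by
      intro g hg
      rw [← hom_half hmo]
      refine cosetSign_eq_one_of_smul _ _ fun x => ?_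
      simpa using hN.conj_mem _ hg x⁻¹
    have := hom_t_eq ht (χ := cosetSign (h.halves hm hzz)) (ψ := 1)
      (h2 r ((h.mem_halves hm hzz).2 ⟨0, 1, by simp⟩))
      (h2 s ((h.mem_halves hm hzz).2 ⟨1, 0, by simp⟩))
    rw [h1, MonoidHom.one_apply] at this
    exact absurd this (by decide)

theorem pow_two_mul_inj [Finite G] (h : IsRotarySystem n r s t l) {m : ℕ} (hm : n = 2 * m) {j i j' i' : ℤ}
    (heq : s ^ (2 * j) * r ^ (2 * i) = s ^ (2 * j') * r ^ (2 * i')) :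
    (m : ℤ) ∣ j - j' ∧ (m : ℤ) ∣ i - i' := by
  have : s ^ (2 * (j - j')) * r ^ (2 * (i - i')) = 1 := by
    have e1 : s ^ (2 * (j - j')) * r ^ (2 * (i - i')) =
      s ^ (-(2 * j')) * (s ^ (2 * j) * r ^ (2 * i)) * r ^ (-(2 * i')) := by group
    rw [e1, heq]; group
  obtain ⟨h1, h2⟩ := h.nf_one this
  rw [hm] at h1 h2
  push_cast at h1 h2
  exact ⟨Int.dvd_of_mul_dvd_mul_left (by norm_num) h1, Int.dvd_of_mul_dvd_mul_left (by norm_num) h2⟩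

/-- The squares of the rotations commute and generate a normal subgroup of odd order. -/
theorem exists_normal_subgroup [Finite G] (h : IsRotarySystem n r s t l) {m : ℕ} (hm : n = 2 * m)
    (hmo : Odd m) {χ : G →* ℤˣ} (hχ : χ r ≠ χ s) :
    ∃ N : Subgroup G, N.Normal ∧ (∀ g, g ∈ N ↔ ∃ j i : ℤ, g = s ^ (2 * j) * r ^ (2 * i)) ∧
      ∀ x ∈ N, ∀ y ∈ N, x * y = y * x := by
  have hpos := h.n_pos
  -- Since `χ` separates `r` from `s`, this map is onto, and its kernel has order `8 * m ^ 2 / 4 = 2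
  -- * m ^ 2`.
  let Φ : G →* ℤˣ × ℤˣ := χ.prod (χ.comp l.toMonoidHom)
  have hΦr : Φ r = (χ r, χ s) := by change (χ r, χ (l r)) = _; rw [h.l_r]
  have hΦs : Φ s = (χ s, χ r) := by change (χ s, χ (l s)) = _; rw [h.l_s]
  have hsurj : Function.Surjective Φ := by
    have key : ∀ a b : ℤˣ, a ≠ b → ∀ c : ℤˣ × ℤˣ, c = 1 ∨ c = (a, b) ∨ c = (b, a) ∨
      c = (a, b) * (b, a) := by decide
    intro c
    rcases key _ _ hχ c with rfl | rfl | rfl | rfl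
    · exact ⟨1, map_one _⟩
    · exact ⟨r, hΦr⟩
    · exact ⟨s, hΦs⟩
    · exact ⟨r * s, by rw [map_mul, hΦr, hΦs]⟩
  let K := Φ.ker
  have hKc : Nat.card K = 2 * m ^ 2 := by
    have h1 : K.index = 4 := by
      rw [Subgroup.index_ker, MonoidHom.range_eq_top.2 hsurj, Subgroup.card_top]
      simp [Nat.card_eq_fintype_card]
    have := K.card_mul_index
    rw [h1, h.card_eq, hm] at this
    linarith
  have hΦ2 : ∀ g, Φ (g * g) = 1 := by
    intro g
    rw [map_mul]
    exact Prod.ext (Int.units_mul_self _) (Int.units_mul_self _)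
  have : Fact (Nat.Prime 2) := ⟨Nat.prime_two⟩
  -- A group of order twice an odd number has a subgroup of index two: an involution is odd in the
  -- regular representation. The kernel of `σ` contains every element of odd order.
  let σ : K →* ℤˣ := cosetSign (⊥ : Subgroup K)
  obtain ⟨u, hu⟩ := exists_prime_orderOf_dvd_card' (G := K) 2 (by rw [hKc]; exact dvd_mul_right _ _)
  have hσu : σ u = -1 := by
    have hu2 : u * u = 1 := by rw [← sq, ← hu, pow_orderOf_eq_one]
    rw [show σ = cosetSign (⊥ : Subgroup K) from rfl, cosetSign_eq_of_free _ u hu2 (m ^ 2) ?_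
      (by rw [Subgroup.index_bot, hKc]), hmo.pow.neg_one_pow]
    intro x hx
    rw [Subgroup.mem_bot] at hx
    have : u = 1 := by
      rw [show u = x * (x⁻¹ * u * x) * x⁻¹ by group, hx]; group
    rw [this, orderOf_one] at hu
    omega
  have hσc : Nat.card σ.ker = m ^ 2 := by
    have h1 : σ.ker.index = 2 := by
      have hs : Function.Surjective σ := by
        intro c
        rcases Int.units_eq_one_or c with rfl | rfl
        · exact ⟨1, map_one _⟩
        · exact ⟨u, hσu⟩
      rw [Subgroup.index_ker, MonoidHom.range_eq_top.2 hs, Subgroup.card_top]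
      simp [Nat.card_eq_fintype_card]
    have := σ.ker.card_mul_index
    rw [h1, hKc] at this
    linarith
  let N := σ.ker.map K.subtype
  have hNc : Nat.card N = m ^ 2 := by
    rw [← hσc]
    exact Nat.card_congr (σ.ker.equivMapOfInjective _ K.subtype_injective).symm.toEquiv
  have hNmem : ∀ g ∈ K, ∀ k, Odd k → g ^ k = 1 → g ∈ N := by
    intro g hg k hk hgk
    exact ⟨⟨g, hg⟩, hom_eq_one_of_pow_odd σ _ k hk (Subtype.ext hgk), rfl⟩
  have hNK : N ≤ K := Subgroup.map_subtype_le _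
  have hNn : N.Normal := by
    refine ⟨fun x hx g => hNmem _ (MonoidHom.normal_ker Φ |>.conj_mem _ (hNK hx) g) (m ^ 2) hmo.pow ?_⟩
    rw [conj_pow]
    have : x ^ m ^ 2 = 1 := by
      have := pow_card_eq_one' (x := (⟨x, hx⟩ : N))
      rw [hNc] at this
      exact Subtype.ext_iff.1 this
    rw [this, mul_one, mul_inv_cancel]
  have hr2 : ∀ i : ℤ, r ^ (2 * i) ∈ N := by
    intro i
    rw [zpow_mul]
    refine zpow_mem (hNmem _ ?_ m hmo ?_) i
    · rw [zpow_two]; exact hΦ2 r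
    · rw [← zpow_natCast, ← zpow_mul, h.r_eq_one_iff, hm]; exact ⟨1, by push_cast; ring⟩
  have hs2 : ∀ i : ℤ, s ^ (2 * i) ∈ N := by
    intro i
    rw [zpow_mul]
    refine zpow_mem (hNmem _ ?_ m hmo ?_) i
    · rw [zpow_two]; exact hΦ2 s
    · rw [← zpow_natCast, ← zpow_mul, h.s_eq_one_iff, hm]; exact ⟨1, by push_cast; ring⟩
  -- These products are `m ^ 2` distinct elements of `N`, so they exhaust it.
  let f : Fin m × Fin m → N := fun x =>
    ⟨s ^ (2 * ((x.1 : ℕ) : ℤ)) * r ^ (2 * ((x.2 : ℕ) : ℤ)), mul_mem (hs2 _) (hr2 _)⟩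
  have hfin : ∀ a b : Fin m, (m : ℤ) ∣ ((a : ℕ) : ℤ) - ((b : ℕ) : ℤ) → a = b := by
    intro a b hab
    have ha := a.2
    have hb := b.2
    have := Int.eq_zero_of_abs_lt_dvd hab (by rw [abs_lt]; omega)
    omega
  have hf : Function.Injective f := by
    intro x y hxy
    obtain ⟨h1, h2⟩ := h.pow_two_mul_inj hm (Subtype.ext_iff.1 hxy)
    exact Prod.ext (hfin _ _ h1) (hfin _ _ h2)
  have hb := (Nat.bijective_iff_injective_and_card f).2 ⟨hf, by
    rw [hNc, Nat.card_prod, Nat.card_fin, sq]⟩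
  have hN : ∀ g, g ∈ N ↔ ∃ j i : ℤ, g = s ^ (2 * j) * r ^ (2 * i) := by
    intro g
    constructor
    · intro hg
      obtain ⟨x, hx⟩ := hb.2 ⟨g, hg⟩
      exact ⟨_, _, (Subtype.ext_iff.1 hx).symm⟩
    · rintro ⟨j, i, rfl⟩
      exact mul_mem (hs2 _) (hr2 _)
  refine ⟨N, hNn, hN, ?_⟩
  -- Conjugation by `t` negates both exponents, so it has no nontrivial fixed point in odd order; a
  -- fixed-point-free involutory automorphism forces commutativity.
  let φ : N →* N := (MulAut.conjNormal t : N ≃* N).toMonoidHom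
  have hφ : ∀ x, ((φ x : N) : G) = t * x * t := fun x => by
    nth_rw 2 [← h.t_inv]
    exact MulAut.conjNormal_apply _ _
  have hinv : Function.Involutive φ := by
    intro x
    apply Subtype.ext
    rw [hφ, hφ, ← mul_assoc, ← mul_assoc, h.t_mul, one_mul, mul_assoc, h.t_mul, mul_one]
  have hfix : MonoidHom.FixedPointFree φ := by
    rintro ⟨x, hx⟩ hfx
    rw [Subtype.ext_iff, hφ] at hfx
    change t * x * t = x at hfx
    obtain ⟨j, i, rfl⟩ := (hN x).1 hx
    have e1 : t * (s ^ (2 * j) * r ^ (2 * i)) * t = s ^ (2 * (-j)) * r ^ (2 * (-i)) := by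
      rw [← mul_assoc, h.t_sz', mul_assoc, mul_assoc, ← mul_assoc t, h.t_rz]
      congr 2 <;> ring
    rw [e1] at hfx
    obtain ⟨h1, h2⟩ := h.pow_two_mul_inj hm hfx
    have hmz : IsCoprime (m : ℤ) 2 := by
      rw [Int.isCoprime_iff_gcd_eq_one]
      exact (Nat.coprime_two_right.2 hmo)
    have h3 : (m : ℤ) ∣ j := hmz.dvd_of_dvd_mul_left (by
      obtain ⟨c, hc⟩ := h1; exact ⟨-c, by linarith⟩)
    have h4 : (m : ℤ) ∣ i := hmz.dvd_of_dvd_mul_left (by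
      obtain ⟨c, hc⟩ := h2; exact ⟨-c, by linarith⟩)
    apply Subtype.ext
    change s ^ (2 * j) * r ^ (2 * i) = 1
    rw [h.s_eq_one_iff.2 (by rw [hm]; push_cast; exact mul_dvd_mul_left _ h3),
      h.r_eq_one_iff.2 (by rw [hm]; push_cast; exact mul_dvd_mul_left _ h4), one_mul]
  intro x hx y hy
  exact Subtype.ext_iff.1 (hfix.commute_all_of_involutive hinv ⟨x, hx⟩ ⟨y, hy⟩)

end IsRotarySystem

/-! ### The relations of a nonorientable rotary system -/

namespace IsRotarySystem

variable {G : Type*} [Group G] {n : ℕ} {r s t : G} {l : G ≃* G}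

/-- If the squares of the rotations generate a normal subgroup of odd order, the half-turns of
the two colours do not commute. -/
theorem half_not_commute [Finite G] (h : IsRotarySystem n r s t l)
    (ht : t ∈ Subgroup.closure {r, s}) {m : ℕ} (hm : n = 2 * m) (hmo : Odd m) {N : Subgroup G}
    (hN : N.Normal) (hmem : ∀ g, g ∈ N ↔ ∃ j i : ℤ, g = s ^ (2 * j) * r ^ (2 * i))
    (hNc : ∀ x ∈ N, ∀ y ∈ N, x * y = y * x) :
    r ^ (m : ℤ) * s ^ (m : ℤ) ≠ s ^ (m : ℤ) * r ^ (m : ℤ) := by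
  intro hzz
  obtain ⟨k, hk⟩ := hmo
  -- Each rotation splits as `g = g ^ (m + 1) * g ^ m`, with `m + 1 = 2 * (k + 1)` even.
  have hle : Subgroup.closure {r, s} ≤ N ⊔ h.halves hm hzz := by
    rw [Subgroup.closure_le]
    have e1 : ∀ g : G, g ^ n = 1 → g ^ (2 * (k + 1) : ℤ) * g ^ (m * 1 : ℤ) = g := by
      intro g hg
      rw [← zpow_add]
      have : (2 * (k + 1) + m * 1 : ℤ) = n + 1 := by rw [hm, hk]; push_cast; ring
      rw [this, zpow_add, zpow_natCast, hg, one_mul, zpow_one]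
    have e2 : ∀ g : G, g ^ n = 1 → g ^ (2 * (k + 1) : ℤ) ∈ N → g ^ (m * 1 : ℤ) ∈ h.halves hm hzz →
        g ∈ N ⊔ h.halves hm hzz := by
      intro g hg h1 h2
      have := mul_mem (Subgroup.mem_sup_left (T := h.halves hm hzz) h1)
        (Subgroup.mem_sup_right (S := N) h2)
      rwa [e1 g hg] at this
    rintro x (hx | hx)
    · rw [hx]
      exact e2 r h.r_pow ((hmem _).2 ⟨0, k + 1, by simp⟩) ((h.mem_halves hm hzz).2 ⟨0, 1, by simp⟩)
    · rw [hx]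
      exact e2 s h.s_pow ((hmem _).2 ⟨k + 1, 0, by simp⟩) ((h.mem_halves hm hzz).2 ⟨1, 0, by simp⟩)
  obtain ⟨x, hx, y, hy, hxy⟩ := Subgroup.mem_sup_of_normal_left.1 (hle ht)
  obtain ⟨a, b, hab⟩ := (h.mem_halves hm hzz).1 hy
  have hy2 : y * y = 1 := by
    rcases h.s_half hm a with h1 | h1 <;> rcases h.swap.s_half hm b with h2 | h2 <;>
      rw [h1, h2] at hab <;> rw [hab]
    · simp
    · simpa using h.swap.s_half_mul hm
    · simpa using h.s_half_mul hm
    · nth_rw 2 [← hzz]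
      rw [mul_assoc, ← mul_assoc (r ^ _), h.swap.s_half_mul hm, one_mul, h.s_half_mul hm]
  have hty : t * y = y * t := by
    rw [hab, ← mul_assoc, h.t_sz', mul_assoc, h.t_rz', ← mul_assoc]
    congr 2
    · exact h.sz_mod ⟨-a, by rw [hm]; push_cast; ring⟩
    · exact h.rz_mod ⟨-b, by rw [hm]; push_cast; ring⟩
  obtain ⟨j, i, hji⟩ := (hmem x).1 hx
  -- Write `t = x * y` with `x ∈ N` and `y` in the four-group. Since `y` is an involution or trivial
  -- and commutes with `t`, also `x * x = 1`; odd order gives `x = 1`, contrary to the normal form.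
  have hx2 : x * x = 1 := by
    have : x = t * y := by rw [← hxy, mul_assoc, hy2, mul_one]
    rw [this, mul_assoc, ← mul_assoc y, ← hty, mul_assoc t y, hy2, mul_one, h.t_mul]
  have hx3 : s ^ (2 * (2 * j)) * r ^ (2 * (2 * i)) = 1 := by
    have hc := hNc (s ^ (2 * j)) ((hmem _).2 ⟨j, 0, by simp⟩) (r ^ (2 * i))
      ((hmem _).2 ⟨0, i, by simp⟩)
    rw [← hx2, hji, two_mul (2 * j), two_mul (2 * i), zpow_add, zpow_add]
    rw [mul_assoc (s ^ (2 * j)), mul_assoc (s ^ (2 * j)), ← mul_assoc (r ^ (2 * i)) (s ^ (2 * j)),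
      ← hc, mul_assoc (s ^ (2 * j)) (r ^ (2 * i))]
  obtain ⟨h1, h2⟩ := h.pow_two_mul_inj hm (j' := 0) (i' := 0) (by rw [hx3]; simp)
  rw [sub_zero] at h1 h2
  have hmz : IsCoprime (m : ℤ) 2 := by
    rw [Int.isCoprime_iff_gcd_eq_one]
    exact (Nat.coprime_two_right.2 ⟨k, hk⟩)
  have hx1 : x = 1 := by
    rw [hji, h.s_eq_one_iff.2, h.r_eq_one_iff.2, one_mul] <;> rw [hm] <;> push_cast
    · exact mul_dvd_mul_left _ (hmz.dvd_of_dvd_mul_left h2)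
    · exact mul_dvd_mul_left _ (hmz.dvd_of_dvd_mul_left h1)
  rw [hx1, one_mul, hab] at hxy
  exact h.nf_ne _ _ hxy

/-- The structure of a nonorientable rotary system: with `e = r ^ (m + 1)`, `e' = s ^ (m + 1)` of odd
order `m` and `z = r ^ m`, `z' = s ^ m` of order two, `⟨e⟩ × ⟨e'⟩` is normalised by `z` and `z'`. -/
theorem exists_relations [Finite G] (h : IsRotarySystem n r s t l)
    (ht : t ∈ Subgroup.closure {r, s}) {m : ℕ} (hm : n = 2 * m) (hmo : Odd m) :
    ∃ x : ℤ, (m : ℤ) ∣ x ^ 2 - 2 ∧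
      r ^ (m + 1 : ℤ) * s ^ (m + 1 : ℤ) = s ^ (m + 1 : ℤ) * r ^ (m + 1 : ℤ) ∧
      r ^ (m : ℤ) * s ^ (m + 1 : ℤ) * r ^ (m : ℤ) =
        (r ^ (m + 1 : ℤ)) ^ x * (s ^ (m + 1 : ℤ))⁻¹ ∧
      r ^ (m : ℤ) * s ^ (m : ℤ) * (r ^ (m : ℤ) * s ^ (m : ℤ)) = t := by
  obtain ⟨χ, hχ⟩ := h.exists_sign_ne ht hm hmo
  obtain ⟨N, hNn, hmem, hNc⟩ := h.exists_normal_subgroup hm hmo hχ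
  have hmz : IsCoprime (m : ℤ) 2 := by
    rw [Int.isCoprime_iff_gcd_eq_one]
    exact (Nat.coprime_two_right.2 hmo)
  have hrr := h.swap.s_half_mul hm
  have hss := h.s_half_mul hm
  have ht4 : r ^ (m : ℤ) * s ^ (m : ℤ) * (r ^ (m : ℤ) * s ^ (m : ℤ)) = t := by
    have := (h.half_comm_or hm).resolve_left (h.half_not_commute ht hm hmo hNn hmem hNc)
    nth_rw 2 [this]
    rw [mul_assoc, mul_assoc, ← mul_assoc (s ^ (m : ℤ)) (s ^ (m : ℤ)), hss, one_mul,
      ← mul_assoc, hrr, one_mul]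
  obtain ⟨k, hk⟩ := hmo
  have he2 : (m + 1 : ℤ) = 2 * (k + 1) := by rw [hk]; push_cast; ring
  have heN : r ^ (m + 1 : ℤ) ∈ N := (hmem _).2 ⟨0, k + 1, by rw [he2]; simp⟩
  have heN' : s ^ (m + 1 : ℤ) ∈ N := (hmem _).2 ⟨k + 1, 0, by rw [he2]; simp⟩
  have hcomm := hNc _ heN _ heN'
  have hzN : r ^ (m : ℤ) * s ^ (m + 1 : ℤ) * r ^ (m : ℤ) ∈ N := by
    have := hNn.conj_mem _ heN' (r ^ (m : ℤ))
    rwa [inv_eq_of_mul_eq_one_right hrr] at this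
  -- By normality of `N` these exponents describe the conjugate of `e'` by `z`, and applying `l`
  -- describes that of `e` by `z'`. Both half-turns then act by matrices over `ℤ/m` in the unknowns
  -- `x`, `y`.
  obtain ⟨j, i, hji⟩ := (hmem _).1 hzN
  set y : ℤ := 2 * j with hy
  set x : ℤ := 2 * i with hx
  have hsy : s ^ y = (s ^ (m + 1 : ℤ)) ^ y := by
    rw [← zpow_mul]
    exact h.sz_mod ⟨-j, by rw [hm, hy]; push_cast; ring⟩
  have hrx : r ^ x = (r ^ (m + 1 : ℤ)) ^ x := by
    rw [← zpow_mul]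
    exact h.rz_mod ⟨-i, by rw [hm, hx]; push_cast; ring⟩
  rw [hsy, hrx] at hji
  have hlji := congrArg l hji
  simp only [map_mul, map_zpow, h.l_r, h.l_s] at hlji
  have hze : r ^ (m : ℤ) * r ^ (m + 1 : ℤ) * r ^ (m : ℤ) = r ^ (m + 1 : ℤ) := by
    rw [← zpow_add, add_comm, zpow_add, mul_assoc, hrr, mul_one]
  have hze' : s ^ (m : ℤ) * s ^ (m + 1 : ℤ) * s ^ (m : ℤ) = s ^ (m + 1 : ℤ) := by
    rw [← zpow_add, add_comm, zpow_add, mul_assoc, hss, mul_one]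
  have hte : t * r ^ (m + 1 : ℤ) * t = (r ^ (m + 1 : ℤ))⁻¹ := by rw [h.t_rz, zpow_neg]
  have hte' : t * s ^ (m + 1 : ℤ) * t = (s ^ (m + 1 : ℤ))⁻¹ := by rw [h.t_sz, zpow_neg]
  have hinj : ∀ a b a' b' : ℤ, (s ^ (m + 1 : ℤ)) ^ a * (r ^ (m + 1 : ℤ)) ^ b =
      (s ^ (m + 1 : ℤ)) ^ a' * (r ^ (m + 1 : ℤ)) ^ b' → (m : ℤ) ∣ a - a' ∧ (m : ℤ) ∣ b - b' := by
    intro a b a' b' hab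
    rw [← zpow_mul, ← zpow_mul, ← zpow_mul, ← zpow_mul, he2, mul_assoc, mul_assoc, mul_assoc,
      mul_assoc] at hab
    obtain ⟨h1, h2⟩ := h.pow_two_mul_inj hm hab
    have hkm : IsCoprime (m : ℤ) (k + 1) := ⟨-1, 2, by rw [hk]; push_cast; ring⟩
    rw [← mul_sub] at h1 h2
    exact ⟨hkm.dvd_of_dvd_mul_left h1, hkm.dvd_of_dvd_mul_left h2⟩
  have hpow : (r ^ (m + 1 : ℤ)) ^ (m : ℤ) = 1 ∧ (s ^ (m + 1 : ℤ)) ^ (m : ℤ) = 1 := by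
    rw [← zpow_mul, ← zpow_mul, h.r_eq_one_iff, h.s_eq_one_iff, hm, he2]
    exact ⟨⟨k + 1, by push_cast; ring⟩, ⟨k + 1, by push_cast; ring⟩⟩
  generalize r ^ (m + 1 : ℤ) = e at *
  generalize s ^ (m + 1 : ℤ) = e' at *
  generalize r ^ (m : ℤ) = z at *
  generalize s ^ (m : ℤ) = z' at *
  have hc : Commute e e' := hcomm
  have conj_zpow' : ∀ u g : G, u * u = 1 → ∀ a : ℤ, u * g ^ a * u = (u * g * u) ^ a := by
    intro u g hu a
    have : u⁻¹ = u := inv_eq_of_mul_eq_one_right hu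
    have h1 := conj_zpow (i := a) (a := u) (b := g)
    rw [this] at h1
    exact h1.symm
  have conj_mul' : ∀ u a b : G, u * u = 1 → u * (a * b) * u = u * a * u * (u * b * u) := by
    intro u a b hu
    have : u * a * u * (u * b * u) = u * a * (u * u) * b * u := by group
    rw [this, hu]; group
  have hmulP : ∀ a b c d : ℤ, e' ^ a * e ^ b * (e' ^ c * e ^ d) = e' ^ (a + c) * e ^ (b + d) := by
    intro a b c d
    have := (hc.zpow_zpow b c).eq
    rw [mul_assoc, ← mul_assoc (e ^ b), this, zpow_add, zpow_add]
    group
  have hz : ∀ a b : ℤ, z * (e' ^ a * e ^ b) * z = e' ^ (y * a) * e ^ (x * a + b) := by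
    intro a b
    rw [conj_mul' z _ _ hrr, conj_zpow' z _ hrr, conj_zpow' z _ hrr, hji, hze,
      (hc.symm.zpow_zpow _ _).mul_zpow, ← zpow_mul, ← zpow_mul, mul_assoc, ← zpow_add]
  have hz' : ∀ a b : ℤ, z' * (e' ^ a * e ^ b) * z' = e' ^ (a + x * b) * e ^ (y * b) := by
    intro a b
    rw [conj_mul' z' _ _ hss, conj_zpow' z' _ hss, conj_zpow' z' _ hss, hlji, hze',
      (hc.zpow_zpow _ _).eq, (hc.symm.zpow_zpow _ _).mul_zpow, ← zpow_mul, ← zpow_mul, ← mul_assoc,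
      ← zpow_add]
  -- From `z ^ 2 = 1`, applied to `e'`.
  have h1 : (m : ℤ) ∣ y * y - 1 ∧ (m : ℤ) ∣ x * y + x - 0 := by
    apply hinj
    have := hz y x
    have h0 := hz 1 0
    rw [mul_one, mul_one, add_zero] at h0
    rw [← this, ← h0]
    calc z * (z * (e' ^ (1 : ℤ) * e ^ (0 : ℤ)) * z) * z
        = (z * z) * (e' ^ (1 : ℤ) * e ^ (0 : ℤ)) * (z * z) := by group
      _ = _ := by rw [hrr]; group
  -- From `(z * z') ^ 2 = t`, which inverts `e'`.
  have h2 : (m : ℤ) ∣ y * (y + x * x) - -1 := by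
    refine (hinj _ (x * (y + x * x) + y * x) _ 0 ?_).1
    rw [← hz, ← hz']
    have h0 := hz 1 0
    have h0' := hz' 1 0
    rw [mul_one, mul_one, add_zero] at h0
    rw [mul_zero, mul_zero, add_zero] at h0'
    rw [← h0, ← h0']
    calc z * (z' * (z * (z' * (e' ^ (1 : ℤ) * e ^ (0 : ℤ)) * z') * z) * z') * z
        = z * z' * (z * z') * e' * (z' * z * (z' * z)) := by group
      _ = t * e' * t⁻¹ := by
        rw [← ht4]
        have : (z * z' * (z * z'))⁻¹ = z' * z * (z' * z) := by
          rw [mul_inv_rev, mul_inv_rev, inv_eq_of_mul_eq_one_right hrr,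
            inv_eq_of_mul_eq_one_right hss]
        rw [this]
      _ = _ := by rw [h.t_inv, hte']; group
  -- The three congruences combine to `2 * (y + 1) ≡ 0`, and `m` is odd. Substituting `y ≡ -1` in
  -- the last one gives `x ^ 2 ≡ 2`.
  have h3 : (m : ℤ) ∣ y + 1 := by
    apply hmz.dvd_of_dvd_mul_left (y := 2)
    obtain ⟨c1, hc1⟩ := h1.1
    obtain ⟨c2, hc2⟩ := h1.2
    obtain ⟨c3, hc3⟩ := h2
    exact ⟨c3 * (y + 1) - c1 * (y + 1) - y * x * c2, by
      linear_combination (y + 1) * hc3 - (y + 1) * hc1 - y * x * hc2⟩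
  refine ⟨x, ?_, hcomm, ?_, ht4⟩
  · obtain ⟨c1, hc1⟩ := h3
    obtain ⟨c3, hc3⟩ := h2
    have hy1 : y = m * c1 - 1 := by linarith
    rw [hy1] at hc3
    refine ⟨m * c1 ^ 2 + c1 * x ^ 2 - 2 * c1 - c3, by linear_combination -hc3⟩
  · rw [hji]
    obtain ⟨c1, hc1⟩ := h3
    have hy1 : y = m * c1 + -1 := by linarith
    rw [hy1, zpow_add, zpow_mul, hpow.2, one_zpow, one_mul, zpow_neg_one]
    exact (hc.zpow_left x).inv_right.symm.eq

end IsRotarySystem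

/-! ### From regular maps to rotary systems -/

namespace CombMap

theorem lam_lam (M : CombMap) (x : M.Flag) : M.lam (M.lam x) = x :=
  congrArg (fun σ : Equiv.Perm M.Flag => σ x) M.lam_mul_self

theorem lam_tau (M : CombMap) (x : M.Flag) : M.lam (M.tau x) = M.tau (M.lam x) :=
  congrArg (fun σ : Equiv.Perm M.Flag => σ x) M.lam_tau_comm

theorem vertexOf_eq_iff (M : CombMap) {x y : M.Flag} :
    M.vertexOf x = M.vertexOf y ↔ ∃ γ ∈ Subgroup.closure {M.rho, M.tau}, γ y = x := by
  refine (Quotient.eq (r := MulAction.orbitRel _ _)).trans ?_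
  rw [MulAction.orbitRel_apply, MulAction.mem_orbit_iff]
  exact ⟨fun ⟨γ, hγ⟩ => ⟨γ, γ.2, hγ⟩, fun ⟨γ, hγ, h⟩ => ⟨⟨γ, hγ⟩, h⟩⟩

theorem vertexOf_rho (M : CombMap) (x : M.Flag) : M.vertexOf (M.rho x) = M.vertexOf x :=
  M.vertexOf_eq_iff.2 ⟨M.rho, Subgroup.subset_closure (by simp), rfl⟩

theorem vertexOf_tau (M : CombMap) (x : M.Flag) : M.vertexOf (M.tau x) = M.vertexOf x :=
  M.vertexOf_eq_iff.2 ⟨M.tau, Subgroup.subset_closure (by simp), rfl⟩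

theorem mem_closure_lam_tau (M : CombMap) {γ : Equiv.Perm M.Flag} :
    γ ∈ Subgroup.closure {M.lam, M.tau} ↔
      γ = 1 ∨ γ = M.lam ∨ γ = M.tau ∨ γ = M.lam * M.tau := by
  have hl : M.lam ∈ Subgroup.closure {M.lam, M.tau} := Subgroup.subset_closure (by simp)
  have ht : M.tau ∈ Subgroup.closure {M.lam, M.tau} := Subgroup.subset_closure (by simp)
  constructor
  · intro h
    have hlt := M.lam_tau_comm
    have hll := M.lam_mul_self
    have htt := M.tau_mul_self
    induction h using Subgroup.closure_induction_left with
    | one => exact Or.inl rfl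
    | mul_left x hx y _ ih =>
      rcases hx with rfl | rfl <;> rcases ih with rfl | rfl | rfl | rfl
      · simp
      · simp [hll]
      · simp
      · simp [← mul_assoc, hll]
      · simp
      · simp [hlt]
      · simp [htt]
      · simp [hlt, ← mul_assoc, htt]
    | inv_mul_cancel x hx y _ ih =>
      have hxi : x⁻¹ = x := by
        rcases hx with rfl | rfl
        · exact inv_eq_of_mul_eq_one_right hll
        · exact inv_eq_of_mul_eq_one_right htt
      rw [hxi]
      rcases hx with rfl | rfl <;> rcases ih with rfl | rfl | rfl | rfl
      · simp
      · simp [hll]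
      · simp
      · simp [← mul_assoc, hll]
      · simp
      · simp [hlt]
      · simp [htt]
      · simp [hlt, ← mul_assoc, htt]
  · rintro (rfl | rfl | rfl | rfl)
    exacts [one_mem _, hl, ht, mul_mem hl ht]

theorem edgeOf_eq_iff (M : CombMap) {x y : M.Flag} :
    M.edgeOf x = M.edgeOf y ↔
      x = y ∨ x = M.lam y ∨ x = M.tau y ∨ x = M.lam (M.tau y) := by
  refine (Quotient.eq (r := MulAction.orbitRel _ _)).trans ?_
  rw [MulAction.orbitRel_apply, MulAction.mem_orbit_iff]
  constructor
  · rintro ⟨⟨γ, hγ⟩, rfl⟩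
    rw [M.mem_closure_lam_tau] at hγ
    rcases hγ with rfl | rfl | rfl | rfl
    exacts [Or.inl rfl, Or.inr (Or.inl rfl), Or.inr (Or.inr (Or.inl rfl)),
      Or.inr (Or.inr (Or.inr rfl))]
  · have hγ : ∀ γ : Equiv.Perm M.Flag, _ → ∃ g : Subgroup.closure {M.lam, M.tau}, g • y = γ y :=
      fun γ h => ⟨⟨γ, M.mem_closure_lam_tau.2 h⟩, rfl⟩
    rintro (rfl | rfl | rfl | rfl)
    exacts [hγ 1 (by simp), hγ M.lam (by simp), hγ M.tau (by simp), hγ (M.lam * M.tau) (by simp)]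

theorem vertexOf_surjective (M : CombMap) : Function.Surjective M.vertexOf := Quotient.mk_surjective

theorem edgeOf_surjective (M : CombMap) : Function.Surjective M.edgeOf := Quotient.mk_surjective

/-- A `2`-colouring of the flags of a bipartite map by the colours of their vertices, in which the
ends of an edge determine it. -/
structure IsColouring (M : CombMap) (c : M.Flag → Bool) : Prop where
  lam : ∀ x, c (M.lam x) = !c x
  rho : ∀ x, c (M.rho x) = c x
  tau : ∀ x, c (M.tau x) = c x
  edgeOf_eq : ∀ x y, M.vertexOf x = M.vertexOf y → M.vertexOf (M.lam x) = M.vertexOf (M.lam y) →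
    M.edgeOf x = M.edgeOf y

/-- The edge of a flag `x` has as ends the vertices of `x` and `λx`. Every edge of the graph joins
the two sides, so `λ` changes the side, and the graph is simple, so the ends determine the edge. -/
theorem IsEmbeddingOf.exists_colouring {M : CombMap} {n : ℕ}
    (h : M.IsEmbeddingOf (completeBipartiteGraph (Fin n) (Fin n))) :
    Nat.card M.Vertex = 2 * n ∧ Nat.card M.Edge = n * n ∧ ∃ c, M.IsColouring c := by
  obtain ⟨f, g, hfg⟩ := h
  refine ⟨by rw [Nat.card_congr f]; simp [two_mul], ?_, fun x => (f (M.vertexOf x)).isLeft, ?_⟩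
  · rw [Nat.card_congr g]
    change (completeBipartiteGraph (Fin n) (Fin n)).edgeSet.ncard = _
    rw [Set.ncard, SimpleGraph.encard_edgeSet_completeBipartiteGraph]
    simp
  · have hinc : ∀ x v, f v ∈ (g (M.edgeOf x) : Sym2 (Fin n ⊕ Fin n)) ↔
        v = M.vertexOf x ∨ v = M.vertexOf (M.lam x) := by
      intro x v
      rw [← hfg]
      constructor
      · rintro ⟨y, rfl, hy⟩
        rcases M.edgeOf_eq_iff.1 hy with rfl | rfl | rfl | rfl
        · exact Or.inl rfl
        · exact Or.inr rfl
        · exact Or.inl (M.vertexOf_tau _)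
        · exact Or.inr (by rw [M.lam_tau, M.vertexOf_tau])
      · rintro (rfl | rfl)
        · exact ⟨x, rfl, rfl⟩
        · exact ⟨M.lam x, rfl, M.edgeOf_eq_iff.2 (by simp)⟩
    have hends : ∀ x, ∃ a b, (g (M.edgeOf x) : Sym2 (Fin n ⊕ Fin n)) = s(Sum.inl a, Sum.inr b) ∧
        ((f (M.vertexOf x) = Sum.inl a ∧ f (M.vertexOf (M.lam x)) = Sum.inr b) ∨
          (f (M.vertexOf x) = Sum.inr b ∧ f (M.vertexOf (M.lam x)) = Sum.inl a)) := by
      intro x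
      have he := (g (M.edgeOf x)).2
      have hx := hinc x
      generalize (g (M.edgeOf x) : Sym2 (Fin n ⊕ Fin n)) = e at he hx ⊢
      have : ∃ a b, e = s(Sum.inl a, Sum.inr b) := by
        induction e using Sym2.ind with
        | _ u v =>
          rw [SimpleGraph.mem_edgeSet] at he
          rcases u with a | a <;> rcases v with b | b <;> simp at he
          · exact ⟨a, b, rfl⟩
          · exact ⟨b, a, Sym2.eq_swap⟩
      obtain ⟨a, b, rfl⟩ := this
      refine ⟨a, b, rfl, ?_⟩
      have ha := (hx (f.symm (Sum.inl a))).1 (by simp)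
      have hb := (hx (f.symm (Sum.inr b))).1 (by simp)
      rw [Equiv.symm_apply_eq, Equiv.symm_apply_eq] at ha hb
      rcases ha with ha | ha <;> rcases hb with hb | hb
      · rw [← hb] at ha; simp at ha
      · exact Or.inl ⟨ha.symm, hb.symm⟩
      · exact Or.inr ⟨hb.symm, ha.symm⟩
      · rw [← hb] at ha; simp at ha
    refine ⟨fun x => ?_, fun x => by rw [M.vertexOf_rho], fun x => by rw [M.vertexOf_tau], ?_⟩
    · obtain ⟨a, b, -, ⟨h1, h2⟩ | ⟨h1, h2⟩⟩ := hends x <;> rw [h1, h2] <;> rfl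
    · intro x y hv hw
      obtain ⟨a, b, h1, h2⟩ := hends x
      obtain ⟨a', b', h1', h2'⟩ := hends y
      apply g.injective
      apply Subtype.ext
      rw [h1, h1']
      rw [hv, hw] at h2
      rcases h2 with ⟨h2, h3⟩ | ⟨h2, h3⟩ <;> rcases h2' with ⟨h2', h3'⟩ | ⟨h2', h3'⟩ <;>
        rw [h2] at h2' <;> rw [h3] at h3' <;> simp_all

/-- The monodromy group. -/
def monodromy (M : CombMap) : Subgroup (Equiv.Perm M.Flag) :=
  Subgroup.closure {M.lam, M.rho, M.tau}

theorem lam_mem (M : CombMap) : M.lam ∈ M.monodromy := Subgroup.subset_closure (by simp)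

theorem rho_mem (M : CombMap) : M.rho ∈ M.monodromy := Subgroup.subset_closure (by simp)

theorem tau_mem (M : CombMap) : M.tau ∈ M.monodromy := Subgroup.subset_closure (by simp)

theorem Iso.comm {M : CombMap} (φ : Iso M M) {γ : Equiv.Perm M.Flag} (hγ : γ ∈ M.monodromy) :
    φ.toEquiv * γ = γ * φ.toEquiv := by
  have : M.monodromy ≤ Subgroup.centralizer {φ.toEquiv} := by
    rw [monodromy, Subgroup.closure_le]
    rintro _ (rfl | rfl | rfl) <;> rw [SetLike.mem_coe, Subgroup.mem_centralizer_singleton_iff] <;>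
      ext x
    exacts [(φ.map_lam x).symm, (φ.map_rho x).symm, (φ.map_tau x).symm]
  exact (Subgroup.mem_centralizer_singleton_iff.1 (this hγ)).symm

/-- Automorphisms commute with monodromies and are transitive on flags, so two monodromies that
agree at one flag agree everywhere. -/
theorem IsRegular.eq_of_apply_eq {M : CombMap} (h : M.IsRegular) {γ δ : Equiv.Perm M.Flag}
    (hγ : γ ∈ M.monodromy) (hδ : δ ∈ M.monodromy) {x : M.Flag} (hx : γ x = δ x) : γ = δ := by
  ext y
  obtain ⟨φ, hφ, -⟩ := h x y
  have h1 := congrArg (fun σ : Equiv.Perm M.Flag => σ x) (φ.comm hγ)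
  have h2 := congrArg (fun σ : Equiv.Perm M.Flag => σ x) (φ.comm hδ)
  simp only [Equiv.Perm.mul_apply, hφ] at h1 h2
  rw [← h1, hx, h2]

theorem exists_mem_monodromy (M : CombMap) (x y : M.Flag) : ∃ γ ∈ M.monodromy, γ x = y := by
  obtain ⟨⟨γ, hγ⟩, h⟩ := M.transitive.exists_smul_eq x y
  exact ⟨γ, hγ, h⟩

/-- A subgroup of the monodromy group of a regular map has regular orbits. -/
theorem IsRegular.card_flag {M : CombMap} (h : M.IsRegular) {K : Subgroup (Equiv.Perm M.Flag)}
    (hK : K ≤ M.monodromy) :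
    Nat.card M.Flag = Nat.card (MulAction.orbitRel.Quotient K M.Flag) * Nat.card K := by
  rw [← Nat.card_prod]
  refine Nat.card_congr (MulAction.selfEquivOrbitsQuotientProd fun x => ?_)
  rw [eq_bot_iff]
  rintro ⟨γ, hγ⟩ hx
  rw [Subgroup.mem_bot]
  exact Subtype.ext (h.eq_of_apply_eq (hK hγ) (one_mem _) (x := x) hx)

end CombMap

theorem mul_inv_mul_of_mul_self {G : Type*} [Group G] {w : G} (hw : w * w = 1) (a : G) :
    w * a⁻¹ * w = (w * a * w)⁻¹ := by
  rw [mul_inv_rev, mul_inv_rev, inv_eq_of_mul_eq_one_right hw, mul_assoc]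

namespace CombMap

open IsRotarySystem (dihedralSubgroup card_dihedralSubgroup)

/-- The monodromies that preserve the colours. -/
def colourSubgroup (M : CombMap) (c : M.Flag → Bool) : Subgroup (Equiv.Perm M.Flag) where
  carrier := {γ | γ ∈ M.monodromy ∧ ∀ x, c (γ x) = c x}
  one_mem' := ⟨one_mem _, fun _ => rfl⟩
  mul_mem' := fun ha hb => ⟨mul_mem ha.1 hb.1, fun x => by rw [Equiv.Perm.mul_apply, ha.2, hb.2]⟩
  inv_mem' := fun {a} ha => ⟨inv_mem ha.1, fun x => by
    rw [← ha.2, ← Equiv.Perm.mul_apply, mul_inv_cancel, Equiv.Perm.one_apply]⟩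

namespace IsColouring

variable {M : CombMap} {c : M.Flag → Bool}

theorem rho_tau_mem (hc : M.IsColouring c) : M.rho * M.tau ∈ M.colourSubgroup c :=
  ⟨mul_mem M.rho_mem M.tau_mem, fun x => by rw [Equiv.Perm.mul_apply, hc.rho, hc.tau]⟩

theorem conj_mem (hc : M.IsColouring c) {γ : Equiv.Perm M.Flag} (hγ : γ ∈ M.colourSubgroup c) :
    M.lam * γ * M.lam ∈ M.colourSubgroup c :=
  ⟨mul_mem (mul_mem M.lam_mem hγ.1) M.lam_mem, fun x => by
    rw [Equiv.Perm.mul_apply, Equiv.Perm.mul_apply, hc.lam, hγ.2, hc.lam, Bool.not_not]⟩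

theorem tau_mem (hc : M.IsColouring c) : M.tau ∈ M.colourSubgroup c := ⟨M.tau_mem, hc.tau⟩

/-- The rotation about a vertex. -/
def r (hc : M.IsColouring c) : M.colourSubgroup c := ⟨M.rho * M.tau, hc.rho_tau_mem⟩

/-- The rotation about the other end of an edge. -/
def s (hc : M.IsColouring c) : M.colourSubgroup c :=
  ⟨M.lam * (M.rho * M.tau) * M.lam, hc.conj_mem hc.rho_tau_mem⟩

/-- The transversal reflection. -/
def t (hc : M.IsColouring c) : M.colourSubgroup c := ⟨M.tau, hc.tau_mem⟩

theorem _root_.CombMap.lam_conj_conj (M : CombMap) (γ : Equiv.Perm M.Flag) :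
    M.lam * (M.lam * γ * M.lam) * M.lam = γ := by
  have h := M.lam_mul_self
  rw [← mul_assoc, ← mul_assoc, h, one_mul, mul_assoc, h, mul_one]

/-- Conjugation by the longitudinal reflection. -/
def l (hc : M.IsColouring c) : M.colourSubgroup c ≃* M.colourSubgroup c where
  toFun γ := ⟨M.lam * γ * M.lam, hc.conj_mem γ.2⟩
  invFun γ := ⟨M.lam * γ * M.lam, hc.conj_mem γ.2⟩
  left_inv γ := Subtype.ext (M.lam_conj_conj γ)
  right_inv γ := Subtype.ext (M.lam_conj_conj γ)
  map_mul' γ δ := by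
    apply Subtype.ext
    change M.lam * (γ * δ : Equiv.Perm M.Flag) * M.lam = (M.lam * γ * M.lam) * (M.lam * δ * M.lam)
    have h : (M.lam * γ * M.lam) * (M.lam * δ * M.lam) =
      M.lam * γ * (M.lam * M.lam) * δ * M.lam := by group
    rw [h, M.lam_mul_self]; group

theorem tau_conj (M : CombMap) : M.tau * (M.rho * M.tau) * M.tau = (M.rho * M.tau)⁻¹ := by
  rw [mul_inv_rev, inv_eq_of_mul_eq_one_right M.tau_mul_self,
    inv_eq_of_mul_eq_one_right M.rho_mul_self, mul_assoc, mul_assoc, M.tau_mul_self, mul_one]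

theorem lam_tau_lam (M : CombMap) : M.lam * M.tau * M.lam = M.tau := by
  rw [M.lam_tau_comm, mul_assoc, M.lam_mul_self, mul_one]

theorem t_mul (hc : M.IsColouring c) : hc.t * hc.t = 1 := Subtype.ext M.tau_mul_self

theorem l_r (hc : M.IsColouring c) : hc.l hc.r = hc.s := rfl

theorem l_s (hc : M.IsColouring c) : hc.l hc.s = hc.r := hc.l.left_inv hc.r

theorem l_t (hc : M.IsColouring c) : hc.l hc.t = hc.t := Subtype.ext (lam_tau_lam M)

theorem t_r (hc : M.IsColouring c) : hc.t * hc.r * hc.t = hc.r⁻¹ := Subtype.ext (tau_conj M)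

theorem t_s (hc : M.IsColouring c) : hc.t * hc.s * hc.t = hc.s⁻¹ := by
  have := congrArg hc.l hc.t_r
  rwa [map_mul, map_mul, map_inv, hc.l_r, hc.l_t] at this

theorem closure_rho_tau (M : CombMap) : Subgroup.closure {M.rho, M.tau} =
    dihedralSubgroup (M.rho * M.tau) M.tau M.tau_mul_self (tau_conj M) := by
  have hr : M.rho ∈ Subgroup.closure {M.rho, M.tau} := Subgroup.subset_closure (by simp)
  have ht : M.tau ∈ Subgroup.closure {M.rho, M.tau} := Subgroup.subset_closure (by simp)
  apply le_antisymm
  · rw [Subgroup.closure_le]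
    rintro _ (rfl | rfl)
    · exact ⟨1, Or.inr (by rw [zpow_one, mul_assoc, M.tau_mul_self, mul_one])⟩
    · exact ⟨0, Or.inr (by simp)⟩
  · rintro _ ⟨i, rfl | rfl⟩
    · exact zpow_mem (mul_mem hr ht) i
    · exact mul_mem (zpow_mem (mul_mem hr ht) i) ht

theorem closure_rho_tau_le (M : CombMap) : Subgroup.closure {M.rho, M.tau} ≤ M.monodromy := by
  rw [Subgroup.closure_le]
  rintro _ (rfl | rfl)
  exacts [M.rho_mem, M.tau_mem]

theorem closure_lam_tau_le (M : CombMap) : Subgroup.closure {M.lam, M.tau} ≤ M.monodromy := by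
  rw [Subgroup.closure_le]
  rintro _ (rfl | rfl)
  exacts [M.lam_mem, M.tau_mem]

theorem card_closure_lam_tau (hc : M.IsColouring c) :
    Nat.card (Subgroup.closure {M.lam, M.tau}) = 4 := by
  obtain ⟨x⟩ := M.nonempty_flag
  have hlt : M.lam ≠ M.tau := fun h => by
    have h1 := hc.lam x
    rw [h, hc.tau] at h1
    simp at h1
  have hl : M.lam ≠ 1 := fun h => M.lam_ne x (by rw [h]; rfl)
  have ht : M.tau ≠ 1 := fun h => M.tau_ne x (by rw [h]; rfl)
  have h : ((Subgroup.closure {M.lam, M.tau} : Subgroup _) : Set (Equiv.Perm M.Flag)) =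
      {1, M.lam, M.tau, M.lam * M.tau} := by
    ext γ
    simp [M.mem_closure_lam_tau]
  have h2 : M.lam * M.tau ≠ 1 := fun h => hlt (by
    rw [← inv_eq_of_mul_eq_one_left h, inv_eq_of_mul_eq_one_right M.tau_mul_self])
  change Nat.card ((Subgroup.closure {M.lam, M.tau} : Subgroup _) : Set (Equiv.Perm M.Flag)) = 4
  rw [h, Nat.card_coe_set_eq, Set.ncard_insert_of_notMem, Set.ncard_insert_of_notMem,
    Set.ncard_pair]
  · simpa using hl
  · simp [hlt, ht]
  · simp [hl.symm, ht.symm, h2.symm]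

theorem card_flag (hc : M.IsColouring c) (hreg : M.IsRegular) {n : ℕ}
    (hE : Nat.card M.Edge = n * n) : Nat.card M.Flag = 4 * n ^ 2 := by
  rw [hreg.card_flag (closure_lam_tau_le M), hc.card_closure_lam_tau]
  change Nat.card M.Edge * 4 = _
  rw [hE]; ring

theorem n_pos (hc : M.IsColouring c) (hreg : M.IsRegular) {n : ℕ}
    (hE : Nat.card M.Edge = n * n) : 0 < n := by
  have := M.finite_flag
  have := M.nonempty_flag
  have h1 := hc.card_flag hreg hE
  have h2 := Nat.card_pos (α := M.Flag)
  rw [h1] at h2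
  by_contra! h
  simp [Nat.le_zero.1 h] at h2

theorem card_closure_rho_tau (hc : M.IsColouring c) (hreg : M.IsRegular) {n : ℕ}
    (hV : Nat.card M.Vertex = 2 * n) (hE : Nat.card M.Edge = n * n) :
    Nat.card (Subgroup.closure {M.rho, M.tau}) = 2 * n := by
  have h1 := hreg.card_flag (closure_rho_tau_le M)
  rw [hc.card_flag hreg hE] at h1
  change _ = Nat.card M.Vertex * _ at h1
  rw [hV] at h1
  have hn := hc.n_pos hreg hE
  apply Nat.eq_of_mul_eq_mul_left (show 0 < 2 * n by omega)
  rw [← h1]; ring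

/-- As a power of `ρτ`, the involution `τ` would commute with `ρτ` as well as invert it. Then `(ρτ)
^ 2 = 1`, so `τ` is `1` or `ρτ`, and `τ` or `ρ` would be trivial. -/
theorem tau_notMem_zpowers (M : CombMap) : M.tau ∉ Subgroup.zpowers (M.rho * M.tau) := by
  obtain ⟨x⟩ := M.nonempty_flag
  rintro ⟨k, hk⟩
  change (M.rho * M.tau) ^ k = M.tau at hk
  have h1 : M.tau * (M.rho * M.tau) = (M.rho * M.tau) * M.tau := by
    have := ((Commute.refl (M.rho * M.tau)).zpow_left k).eq
    rwa [hk] at this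
  have h2 : (M.rho * M.tau) ^ 2 = 1 := by
    have h4 := tau_conj M
    rw [h1, mul_assoc, M.tau_mul_self, mul_one] at h4
    rw [sq]
    nth_rw 2 [h4]
    rw [mul_inv_cancel]
  rcases Int.even_or_odd' k with ⟨d, rfl | rfl⟩
  · rw [zpow_mul, zpow_ofNat, h2, one_zpow] at hk
    exact M.tau_ne x (by rw [← hk]; rfl)
  · rw [zpow_add, zpow_mul, zpow_ofNat, h2, one_zpow, one_mul, zpow_one, mul_eq_right] at hk
    exact M.rho_ne x (by rw [hk]; rfl)

theorem orderOf_rho_tau (hc : M.IsColouring c) (hreg : M.IsRegular) {n : ℕ}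
    (hV : Nat.card M.Vertex = 2 * n) (hE : Nat.card M.Edge = n * n) :
    orderOf (M.rho * M.tau) = n := by
  have := M.finite_flag
  have h1 := hc.card_closure_rho_tau hreg hV hE
  rw [closure_rho_tau, card_dihedralSubgroup _ _ _ _ (tau_notMem_zpowers M)] at h1
  omega

theorem closure_rho_tau_le_colourSubgroup (hc : M.IsColouring c) :
    Subgroup.closure {M.rho, M.tau} ≤ M.colourSubgroup c := by
  rw [Subgroup.closure_le]
  rintro _ (rfl | rfl)
  exacts [⟨M.rho_mem, hc.rho⟩, hc.tau_mem]

/-- Such a `δ` fixes both ends of an edge, hence the edge; of the four monodromies of the edge only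
`1` and `τ` preserve colours. It makes the two dihedral groups meet in `⟨τ⟩`. -/
theorem eq_one_or_eq_tau (hc : M.IsColouring c) (hreg : M.IsRegular) {δ : Equiv.Perm M.Flag}
    (h1 : δ ∈ Subgroup.closure {M.rho, M.tau})
    (h2 : M.lam * δ * M.lam ∈ Subgroup.closure {M.rho, M.tau}) : δ = 1 ∨ δ = M.tau := by
  obtain ⟨x⟩ := M.nonempty_flag
  have hδ := hc.closure_rho_tau_le_colourSubgroup h1
  have he := hc.edgeOf_eq (δ x) x (M.vertexOf_eq_iff.2 ⟨δ, h1, rfl⟩)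
    (M.vertexOf_eq_iff.2 ⟨_, h2, by simp [M.lam_lam]⟩)
  have hcx := hδ.2 x
  rcases M.edgeOf_eq_iff.1 he with h | h | h | h
  · exact Or.inl (hreg.eq_of_apply_eq hδ.1 (one_mem _) h)
  · rw [h, hc.lam] at hcx; simp at hcx
  · exact Or.inr (hreg.eq_of_apply_eq hδ.1 M.tau_mem h)
  · rw [h, hc.lam, hc.tau] at hcx; simp at hcx

theorem l_zpow_r (hc : M.IsColouring c) (i : ℤ) : hc.l (hc.r ^ i) = hc.s ^ i := by
  rw [map_zpow, hc.l_r]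

theorem l_zpow_s (hc : M.IsColouring c) (i : ℤ) : hc.l (hc.s ^ i) = hc.r ^ i := by
  rw [map_zpow, hc.l_s]

theorem orderOf_r (hc : M.IsColouring c) : orderOf hc.r = orderOf (M.rho * M.tau) :=
  (Subgroup.orderOf_coe hc.r).symm

theorem orderOf_s (hc : M.IsColouring c) : orderOf hc.s = orderOf (M.rho * M.tau) := by
  rw [← hc.l_r, MulEquiv.orderOf_eq, hc.orderOf_r]

theorem r_zpow_mem (hc : M.IsColouring c) (i : ℤ) :
    ((hc.r ^ i : M.colourSubgroup c) : Equiv.Perm M.Flag) ∈ Subgroup.closure {M.rho, M.tau} := by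
  rw [closure_rho_tau]
  exact ⟨i, Or.inl rfl⟩

theorem r_zpow_ne_t (hc : M.IsColouring c) (i : ℤ) : hc.r ^ i ≠ hc.t := fun h =>
  tau_notMem_zpowers M ⟨i, congrArg Subtype.val h⟩

theorem s_zpow_ne_t (hc : M.IsColouring c) (i : ℤ) : hc.s ^ i ≠ hc.t := fun h => by
  apply hc.r_zpow_ne_t i
  rw [← hc.l_zpow_s, h, hc.l_t]

/-- Equality of two normal forms puts a power of `s` in the stabilizers of both ends of an edge, so
it is `1` or `τ`, and the latter is not a power of `s`. -/
theorem normalForm_injective (hc : M.IsColouring c) (hreg : M.IsRegular) {n : ℕ}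
    (hr : orderOf (M.rho * M.tau) = n) : Function.Injective
      (fun x : Fin n × Fin n × Bool =>
        hc.s ^ (x.1 : ℕ) * hc.r ^ (x.2.1 : ℕ) * (if x.2.2 then hc.t else 1)) := by
  have ht (b : Bool) : ((if b then hc.t else 1 : M.colourSubgroup c) : Equiv.Perm M.Flag) ∈
      Subgroup.closure {M.rho, M.tau} := by
    split_ifs
    · exact Subgroup.subset_closure (Or.inr rfl)
    · exact one_mem _
  rintro ⟨j, i, b⟩ ⟨j', i', b'⟩ h
  simp only at h
  generalize hu : (if b then hc.t else 1 : M.colourSubgroup c) = u at h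
  generalize hu' : (if b' then hc.t else 1 : M.colourSubgroup c) = u' at h
  have hub := ht b
  have hub' := ht b'
  rw [hu] at hub
  rw [hu'] at hub'
  have h1 : hc.s ^ ((j : ℕ) - (j' : ℕ) : ℤ) = hc.r ^ ((i' : ℕ) : ℤ) * u' * u⁻¹ * hc.r ^ (-((i : ℕ) : ℤ)) := by
    have : hc.s ^ ((j : ℕ) - (j' : ℕ) : ℤ) = hc.s ^ (-((j' : ℕ) : ℤ)) *
      (hc.s ^ (j : ℕ) * hc.r ^ (i : ℕ) * u) * u⁻¹ * hc.r ^ (-((i : ℕ) : ℤ)) := by group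
    rw [this, h]; group
  have h2 : ((hc.s ^ ((j : ℕ) - (j' : ℕ) : ℤ) : M.colourSubgroup c) : Equiv.Perm M.Flag) = 1 ∨
      ((hc.s ^ ((j : ℕ) - (j' : ℕ) : ℤ) : M.colourSubgroup c) : Equiv.Perm M.Flag) = M.tau := by
    apply hc.eq_one_or_eq_tau hreg
    · rw [h1]
      exact mul_mem (mul_mem (mul_mem (hc.r_zpow_mem _) hub') (inv_mem hub)) (hc.r_zpow_mem _)
    · change ((hc.l (hc.s ^ ((j : ℕ) - (j' : ℕ) : ℤ)) : M.colourSubgroup c) : Equiv.Perm M.Flag) ∈ _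
      rw [hc.l_zpow_s]
      exact hc.r_zpow_mem _
  have hj : j = j' := by
    rcases h2 with h2 | h2
    · have h3 : hc.s ^ ((j : ℕ) - (j' : ℕ) : ℤ) = 1 := Subtype.ext h2
      rw [← orderOf_dvd_iff_zpow_eq_one, hc.orderOf_s, hr] at h3
      have := Int.eq_zero_of_abs_lt_dvd h3 (by rw [abs_lt]; omega)
      omega
    · exact absurd (Subtype.ext h2) (hc.s_zpow_ne_t _)
  subst hj
  rw [mul_assoc, mul_assoc, mul_left_cancel_iff] at h
  have h4 : hc.r ^ ((i : ℕ) - (i' : ℕ) : ℤ) = u' * u⁻¹ := by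
    have : hc.r ^ ((i : ℕ) - (i' : ℕ) : ℤ) = hc.r ^ (-((i' : ℕ) : ℤ)) * (hc.r ^ (i : ℕ) * u) * u⁻¹ := by
      group
    rw [this, h]; group
  have hti : hc.t⁻¹ = hc.t := inv_eq_of_mul_eq_one_right hc.t_mul
  have hb : b = b' := by
    by_contra hb
    have : u' * u⁻¹ = hc.t := by
      cases b <;> cases b' <;> simp at hb <;> simp at hu hu' <;> rw [← hu, ← hu']
      · simp
      · simp [hti]
    exact hc.r_zpow_ne_t _ (h4.trans this)
  subst hb
  rw [← hu, ← hu', mul_inv_cancel, ← orderOf_dvd_iff_zpow_eq_one, hc.orderOf_r, hr] at h4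
  have := Int.eq_zero_of_abs_lt_dvd h4 (by rw [abs_lt]; omega)
  have hi : i = i' := by omega
  rw [hi]

/-- The flags `γx` are distinct by regularity, and `λ` carries them to flags of the other colour. -/
theorem card_colourSubgroup_le (hc : M.IsColouring c) (hreg : M.IsRegular) :
    2 * Nat.card (M.colourSubgroup c) ≤ Nat.card M.Flag := by
  have := M.finite_flag
  obtain ⟨x⟩ := M.nonempty_flag
  let f : Bool × M.colourSubgroup c → M.Flag :=
    fun p => if p.1 then M.lam ((p.2 : Equiv.Perm M.Flag) x) else (p.2 : Equiv.Perm M.Flag) x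
  have hf : Function.Injective f := by
    rintro ⟨b, γ⟩ ⟨b', δ⟩ h
    have hcol := congrArg c h
    cases b <;> cases b' <;> simp [f, hc.lam, γ.2.2 x, δ.2.2 x] at h hcol
    · rw [Subtype.ext (hreg.eq_of_apply_eq γ.2.1 δ.2.1 h)]
    · rw [Subtype.ext (hreg.eq_of_apply_eq γ.2.1 δ.2.1 h)]
  have := Nat.card_le_card_of_injective f hf
  rw [Nat.card_prod] at this
  simpa using this

/-- The rotary system of a regular embedding of a complete bipartite graph. -/
theorem isRotarySystem (hc : M.IsColouring c) (hreg : M.IsRegular) {n : ℕ}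
    (hV : Nat.card M.Vertex = 2 * n) (hE : Nat.card M.Edge = n * n) :
    IsRotarySystem n hc.r hc.s hc.t hc.l := by
  have := M.finite_flag
  have hr := hc.orderOf_rho_tau hreg hV hE
  have hle := hc.card_colourSubgroup_le hreg
  rw [hc.card_flag hreg hE] at hle
  have hinj := hc.normalForm_injective hreg hr
  have hge := Nat.card_le_card_of_injective _ hinj
  have hcardF : Nat.card (Fin n × Fin n × Bool) = 2 * n ^ 2 := by
    simp; ring
  rw [hcardF] at hge
  -- The normal forms bound the order from below and the flag count `4 * n ^ 2` from above; hence
  -- every element has a normal form.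
  have hcard : Nat.card (M.colourSubgroup c) = 2 * n ^ 2 := by omega
  have hbij := (Nat.bijective_iff_injective_and_card _).2 ⟨hinj, by rw [hcardF, hcard]⟩
  refine ⟨?_, ?_, hc.t_mul, hc.t_r, hc.t_s, hc.l_r, hc.l_s, hc.l_t, hcard, fun g => ?_⟩
  · rw [← hr, ← hc.orderOf_r, pow_orderOf_eq_one]
  · rw [← hr, ← hc.orderOf_s, pow_orderOf_eq_one]
  · obtain ⟨⟨j, i, b⟩, h⟩ := hbij.2 g
    refine ⟨(j : ℕ), (i : ℕ), ?_⟩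
    rw [← h, zpow_natCast, zpow_natCast]
    cases b <;> simp

/-- In a nonorientable bipartite regular map the transversal reflection is a product of rotations. -/
theorem t_mem_closure (hc : M.IsColouring c) (hreg : M.IsRegular) (hnon : M.IsNonorientable) :
    hc.t ∈ Subgroup.closure {hc.r, hc.s} := by
  obtain ⟨x⟩ := M.nonempty_flag
  let S := (Subgroup.closure {hc.r, hc.s}).map (M.colourSubgroup c).subtype
  have hS : S = Subgroup.closure {M.rho * M.tau, M.lam * (M.rho * M.tau) * M.lam} := by
    refine (MonoidHom.map_closure _ _).trans ?_
    rw [Set.image_pair]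
    rfl
  set w := M.tau * M.lam with hw
  have hww : w * w = 1 := by
    rw [hw]
    nth_rw 1 [← M.lam_tau_comm]
    rw [mul_assoc, ← mul_assoc M.tau, M.tau_mul_self, one_mul, M.lam_mul_self]
  -- The involution `w = τλ` normalizes `S = ⟨r, s⟩`, so the even-word group is covered by `S` and
  -- `wS`.
  have hwS : ∀ γ ∈ S, w * γ * w ∈ S := by
    have hwl (γ) : w * γ * w = M.lam * (M.tau * γ * M.tau) * M.lam := by
      nth_rw 1 [hw]
      rw [← M.lam_tau_comm, hw]
      group
    have hcr := tau_conj M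
    have hcs := congrArg Subtype.val hc.t_s
    change M.tau * (M.lam * (M.rho * M.tau) * M.lam) * M.tau = (M.lam * (M.rho * M.tau) * M.lam)⁻¹ at hcs
    intro γ hγ
    rw [hS] at hγ ⊢
    induction hγ using Subgroup.closure_induction with
    | mem γ h =>
      rw [hwl]
      rcases h with rfl | rfl
      · rw [hcr]
        rw [mul_inv_mul_of_mul_self M.lam_mul_self]
        exact inv_mem (Subgroup.subset_closure (by simp))
      · rw [hcs]
        rw [mul_inv_mul_of_mul_self M.lam_mul_self, M.lam_conj_conj]
        exact inv_mem (Subgroup.subset_closure (by simp))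
    | one => rw [mul_one, hww]; exact one_mem _
    | mul a b _ _ iha ihb =>
      have : w * (a * b) * w = w * a * w * (w * b * w) := by
        have : w * a * w * (w * b * w) = w * a * (w * w) * b * w := by group
        rw [this, hww]; group
      rw [this]
      exact mul_mem iha ihb
    | inv a _ iha =>
      rw [mul_inv_mul_of_mul_self hww]
      exact inv_mem iha
  clear_value w
  have hE : ∀ γ ∈ Subgroup.closure {M.rho * M.tau, M.tau * M.lam}, γ ∈ S ∨ w * γ ∈ S := by
    intro γ hγ
    induction hγ using Subgroup.closure_induction with
    | mem γ h =>
      rcases h with rfl | rfl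
      · exact Or.inl (hS ▸ Subgroup.subset_closure (by simp))
      · exact Or.inr (by rw [← hw, hww]; exact one_mem _)
    | one => exact Or.inl (one_mem _)
    | mul a b _ _ iha ihb =>
      rcases iha with ha | ha <;> rcases ihb with hb | hb
      · exact Or.inl (mul_mem ha hb)
      · right
        have : w * (a * b) = w * a * w * (w * b) := by
          have : w * a * w * (w * b) = w * a * (w * w) * b := by group
          rw [this, hww]; group
        rw [this]
        exact mul_mem (hwS _ ha) hb
      · right
        rw [← mul_assoc]
        exact mul_mem ha hb
      · left
        have : a * b = w * (w * a) * w * (w * b) := by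
          have : w * (w * a) * w * (w * b) = w * w * a * (w * w) * b := by group
          rw [this, hww]; group
        rw [this]
        exact mul_mem (hwS _ ha) hb
    | inv a _ iha =>
      rcases iha with ha | ha
      · exact Or.inl (inv_mem ha)
      · right
        have : w * a⁻¹ = w * (w * a)⁻¹ * w := by
          rw [mul_inv_rev, inv_eq_of_mul_eq_one_right hww, ← mul_assoc, mul_assoc (w * a⁻¹), hww,
            mul_one]
        rw [this]
        exact hwS _ (inv_mem ha)
  obtain ⟨⟨γ, hγ⟩, hγx⟩ := hnon.exists_smul_eq x (M.tau x)
  change γ x = M.tau x at hγx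
  have hSc : ∀ γ ∈ S, γ ∈ M.colourSubgroup c := by
    rintro _ ⟨γ, -, rfl⟩
    exact γ.2
  have hEm : Subgroup.closure {M.rho * M.tau, M.tau * M.lam} ≤ M.monodromy := by
    rw [Subgroup.closure_le]
    rintro _ (rfl | rfl)
    exacts [mul_mem M.rho_mem M.tau_mem, mul_mem M.tau_mem M.lam_mem]
  have hγt := hreg.eq_of_apply_eq (hEm hγ) M.tau_mem hγx
  rw [hγt] at hγ
  rcases hE _ hγ with h | h
  · obtain ⟨γ, h1, h2⟩ := h
    rwa [show γ = hc.t from Subtype.ext h2] at h1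
  -- The element `wτ` is a colour-reversing monodromy, so it is not in `S`.
  · have h1 := (hSc _ h).2 x
    simp [hw, hc.tau, hc.lam] at h1

end IsColouring

end CombMap

/-! ### The model maps -/

/-- The homomorphism from a dihedral group determined by the images of its generators. -/
def DihedralGroup.liftHom {A : Type*} [Monoid A] {n : ℕ} [NeZero n] (a b : A) (ha : a ^ n = 1)
    (hb : b * b = 1) (hab : a * b = b * a ^ (n - 1)) : DihedralGroup n →* A where
  toFun
    | .r i => a ^ i.val
    | .sr i => b * a ^ i.val
  map_one' := by
    change a ^ (0 : ZMod n).val = 1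
    rw [ZMod.val_zero, pow_zero]
  map_mul' := by
    have hval : ∀ k : ℕ, a ^ (k : ZMod n).val = a ^ k := fun k => by
      rw [ZMod.val_natCast, ← pow_eq_pow_mod _ ha]
    have hadd : ∀ i j : ZMod n, a ^ (i + j).val = a ^ i.val * a ^ j.val := by
      intro i j
      rw [ZMod.val_add, ← pow_eq_pow_mod _ ha, pow_add]
    have hneg : ∀ i : ZMod n, a ^ i.val * b = b * a ^ (-i).val := by
      intro i
      have h1 : ∀ k : ℕ, a ^ k * b = b * a ^ ((n - 1) * k) := by
        intro k
        induction k with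
        | zero => simp
        | succ k ih => rw [pow_succ, mul_assoc, hab, ← mul_assoc, ih, mul_assoc, ← pow_add, mul_add,
            mul_one]
      have h2 : -i = ((n - 1) * i.val : ℕ) := by
        rw [Nat.cast_mul, Nat.cast_sub (Nat.one_le_iff_ne_zero.2 (NeZero.ne n))]
        simp
      rw [h2, hval, h1]
    rintro (i | i) (j | j)
    · exact hadd i j
    · change b * a ^ (j - i).val = a ^ i.val * (b * a ^ j.val)
      rw [← mul_assoc, hneg, mul_assoc, ← hadd, neg_add_eq_sub]
    · change b * a ^ (i + j).val = b * a ^ i.val * a ^ j.val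
      rw [hadd, mul_assoc]
    · change a ^ (j - i).val = b * a ^ i.val * (b * a ^ j.val)
      rw [mul_assoc, ← mul_assoc _ b, hneg, mul_assoc, ← mul_assoc b, hb, one_mul, ← hadd,
        neg_add_eq_sub]

namespace Model

open DihedralGroup

variable {m : ℕ} {x : ZMod m}

theorem end_mul_apply {A : Type*} [AddZeroClass A] (f g : AddMonoid.End A) (v : A) :
    (f * g) v = f (g v) := rfl

/-- The image of the generating rotation of the point group. -/
def rotEnd (x : ZMod m) : AddMonoid.End (ZMod m × ZMod m) where
  toFun v := (v.2 + x * v.1, -v.1)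
  map_zero' := by simp
  map_add' u v := by ext <;> simp <;> ring

/-- The exchange of the two coordinates. -/
def swapEnd (m : ℕ) : AddMonoid.End (ZMod m × ZMod m) where
  toFun v := (v.2, v.1)
  map_zero' := by simp
  map_add' u v := by ext <;> simp

theorem rotEnd_apply (v : ZMod m × ZMod m) : rotEnd x v = (v.2 + x * v.1, -v.1) := rfl

theorem swapEnd_apply (v : ZMod m × ZMod m) : swapEnd m v = (v.2, v.1) := rfl

/-- The endomorphism `A` has trace `x` and determinant `1`, so `A ^ 2 = x * A - 1`; with `x * x = 2`
this gives `A ^ 4 = -1`. Thus `x` plays the role of `ζ + ζ⁻¹` for a primitive eighth root of unity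
`ζ`. -/
theorem rotEnd_pow_four (hx : x * x = 2) (v : ZMod m × ZMod m) : (rotEnd x ^ 4) v = -v := by
  simp only [pow_succ, pow_zero, one_mul, end_mul_apply, rotEnd_apply]
  ext <;> simp
  · linear_combination (x * v.2 + (x * x - 1) * v.1) * hx
  · linear_combination -(v.2 + x * v.1) * hx

/-- The action of the point group on the translations. -/
def action (hx : x * x = 2) : DihedralGroup 8 →* AddMonoid.End (ZMod m × ZMod m) :=
  DihedralGroup.liftHom (rotEnd x) (swapEnd m)
    (by
      ext1 v
      rw [show 8 = 4 + 4 from rfl, pow_add, end_mul_apply, rotEnd_pow_four hx,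
        rotEnd_pow_four hx, neg_neg]
      rfl)
    (by ext1 v; rfl)
    (by
      ext1 v
      simp only [Nat.reduceSub]
      rw [show 7 = 4 + 3 from rfl, pow_add, end_mul_apply, end_mul_apply,
        end_mul_apply, rotEnd_pow_four hx]
      simp only [pow_succ, pow_zero, one_mul, end_mul_apply, rotEnd_apply, swapEnd_apply]
      ext <;> simp
      · linear_combination -v.1 * hx
      · linear_combination (v.2 + x * v.1) * hx)

theorem action_r_one (hx : x * x = 2) (v : ZMod m × ZMod m) :
    action hx (r 1) v = (v.2 + x * v.1, -v.1) := by
  change (rotEnd x ^ 1) v = _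
  rw [pow_one, rotEnd_apply]

theorem action_sr_zero (hx : x * x = 2) (v : ZMod m × ZMod m) :
    action hx (sr 0) v = (v.2, v.1) := by
  change (swapEnd m * rotEnd x ^ 0) v = _
  rw [pow_zero, mul_one, swapEnd_apply]

theorem action_r_four (hx : x * x = 2) (v : ZMod m × ZMod m) : action hx (r 4) v = -v :=
  rotEnd_pow_four hx v

theorem action_sr_seven (hx : x * x = 2) (v : ZMod m × ZMod m) :
    action hx (sr 7) v = (v.1 + x * v.2, -v.2) := by
  rw [show (sr 7 : DihedralGroup 8) = r 1 * sr 0 from rfl, map_mul, end_mul_apply,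
    action_sr_zero, action_r_one]

theorem action_sr_three (hx : x * x = 2) (v : ZMod m × ZMod m) :
    action hx (sr 3) v = (-(v.1 + x * v.2), v.2) := by
  rw [show (sr 3 : DihedralGroup 8) = r 4 * sr 7 from rfl, map_mul, end_mul_apply,
    action_sr_seven, action_r_four]
  simp

end Model

open Model DihedralGroup

/-- The semidirect product of `ZMod m × ZMod m` with the dihedral group of order 16. -/
@[ext]
structure ModelGroup {m : ℕ} {x : ZMod m} (hx : x * x = 2) where
  trans : ZMod m × ZMod m
  lin : DihedralGroup 8

namespace ModelGroup

variable {m : ℕ} {x : ZMod m} {hx : x * x = 2}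

instance : Group (ModelGroup hx) where
  mul a b := ⟨a.trans + action hx a.lin b.trans, a.lin * b.lin⟩
  one := ⟨0, 1⟩
  inv a := ⟨-action hx a.lin⁻¹ a.trans, a.lin⁻¹⟩
  mul_assoc a b c := by
    apply ModelGroup.ext
    · change a.trans + action hx a.lin b.trans + action hx (a.lin * b.lin) c.trans =
        a.trans + action hx a.lin (b.trans + action hx b.lin c.trans)
      rw [map_mul, map_add, end_mul_apply, add_assoc]
    · exact mul_assoc _ _ _
  one_mul a := by
    apply ModelGroup.ext
    · change 0 + action hx 1 a.trans = a.trans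
      rw [map_one, zero_add]; rfl
    · exact one_mul _
  mul_one a := by
    apply ModelGroup.ext
    · change a.trans + action hx a.lin 0 = a.trans
      rw [map_zero, add_zero]
    · exact mul_one _
  inv_mul_cancel a := by
    apply ModelGroup.ext
    · exact neg_add_cancel _
    · exact inv_mul_cancel _

theorem mul_def (a b : ModelGroup hx) :
    a * b = ⟨a.trans + action hx a.lin b.trans, a.lin * b.lin⟩ := rfl

theorem one_def : (1 : ModelGroup hx) = ⟨0, 1⟩ := rfl

/-- The product decomposition of the model group. -/
def equivProd (hx : x * x = 2) : ModelGroup hx ≃ (ZMod m × ZMod m) × DihedralGroup 8 where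
  toFun a := (a.trans, a.lin)
  invFun a := ⟨a.1, a.2⟩

instance [NeZero m] : Finite (ModelGroup hx) := Finite.of_equiv _ (equivProd hx).symm

theorem card (hx : x * x = 2) : Nat.card (ModelGroup hx) = 16 * m ^ 2 := by
  rw [Nat.card_congr (equivProd hx), Nat.card_prod, Nat.card_prod, Nat.card_zmod,
    DihedralGroup.nat_card]
  ring

/-- The embedding of the point group. -/
def inr (hx : x * x = 2) : DihedralGroup 8 →* ModelGroup hx where
  toFun d := ⟨0, d⟩
  map_one' := rfl
  map_mul' a b := by rw [mul_def, map_zero, add_zero]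

/-- The longitudinal generator. -/
def L (hx : x * x = 2) : ModelGroup hx := ⟨0, sr 0⟩

/-- The rotary generator. -/
def R (hx : x * x = 2) : ModelGroup hx := ⟨(1, 0), sr 3⟩

/-- The transversal generator. -/
def T (hx : x * x = 2) : ModelGroup hx := ⟨0, r 4⟩

theorem L_mul_self : L hx * L hx = 1 := by
  rw [L, mul_def, map_zero, add_zero]; rfl

theorem T_mul_self : T hx * T hx = 1 := by
  rw [T, mul_def, map_zero, add_zero]; rfl

theorem R_mul_self : R hx * R hx = 1 := by
  rw [R, mul_def, action_sr_three]
  apply ModelGroup.ext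
  · simp [one_def]
  · rfl

theorem L_mul_T : L hx * T hx = T hx * L hx := by
  rw [L, T, mul_def, mul_def, map_zero, map_zero]; rfl

theorem R_mul_T : R hx * T hx = ⟨(1, 0), sr 7⟩ := by
  rw [R, T, mul_def, map_zero, add_zero]; rfl

/-- The linear part `sr 7` fixes `(1, 0)`, so the translations simply add up. -/
theorem R_mul_T_pow_even (k : ℕ) : (R hx * T hx) ^ (2 * k) = ⟨((2 * k : ℕ), 0), 1⟩ := by
  induction k with
  | zero => simp [one_def]; rfl
  | succ k ih =>
    rw [mul_add, mul_one, pow_add, ih, sq, R_mul_T, mul_def, mul_def, action_sr_seven]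
    apply ModelGroup.ext
    · simp only [map_one, AddMonoid.End.coe_one, _root_.id]
      ext <;> simp
      ring
    · rfl

theorem R_mul_T_pow_odd (k : ℕ) : (R hx * T hx) ^ (2 * k + 1) = ⟨((2 * k + 1 : ℕ), 0), sr 7⟩ := by
  rw [pow_succ, R_mul_T_pow_even, R_mul_T, mul_def]
  apply ModelGroup.ext
  · simp only [map_one, AddMonoid.End.coe_one, _root_.id]
    ext <;> simp
  · exact one_mul _

theorem orderOf_R_mul_T (hm : Odd m) : orderOf (R hx * T hx) = 2 * m := by
  apply Nat.dvd_antisymm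
  · apply orderOf_dvd_of_pow_eq_one
    rw [R_mul_T_pow_even]
    simp [one_def]
  · have h := pow_orderOf_eq_one (R hx * T hx)
    rcases Nat.even_or_odd' (orderOf (R hx * T hx)) with ⟨k, hk | hk⟩
    · rw [hk] at h ⊢
      rw [R_mul_T_pow_even] at h
      have h1 := congrArg (fun a => a.trans.1) h
      change ((2 * k : ℕ) : ZMod m) = 0 at h1
      rw [ZMod.natCast_eq_zero_iff] at h1
      exact mul_dvd_mul_left _ ((Nat.coprime_two_right.2 hm).dvd_of_dvd_mul_left h1)
    · rw [hk, R_mul_T_pow_odd] at h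
      exact absurd (congrArg lin h) (by change (sr 7 : DihedralGroup 8) ≠ 1; decide)

theorem translation_pow (k : ℕ) : (⟨(1, 0), 1⟩ : ModelGroup hx) ^ k = ⟨(k, 0), 1⟩ := by
  induction k with
  | zero => simp [one_def]; rfl
  | succ k ih =>
    rw [pow_succ, ih, mul_def]
    simp only [map_one, AddMonoid.End.coe_one, _root_.id]
    ext <;> simp

/-- The even words in the generators exhaust the model group. -/
theorem closure_eq_top [NeZero m] (hm : Odd m) :
    Subgroup.closure {R hx * T hx, T hx * L hx} = ⊤ := by
  set E := Subgroup.closure {R hx * T hx, T hx * L hx}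
  have hr : R hx * T hx ∈ E := Subgroup.subset_closure (by simp)
  have hw : inr hx (sr 4) ∈ E := Subgroup.subset_closure (by
    right
    change _ = T hx * L hx
    rw [T, L, mul_def, map_zero, add_zero]; rfl)
  obtain ⟨k, hk⟩ := hm
  -- The `m`-th power of the rotation: as `m` is odd, the translation vanishes and the reflection
  -- remains.
  have hz : inr hx (sr 7) ∈ E := by
    have := pow_mem hr (2 * k + 1)
    rw [R_mul_T_pow_odd, ← hk] at this
    convert this using 1
    simp [inr]; rfl
  -- Indeed `sr 7 * sr 4 = r 5`, and `5 * 5 ≡ 1` modulo `8`.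
  have h1 : inr hx (r 1) ∈ E := by
    have := pow_mem (mul_mem hz hw) 5
    rw [← map_mul, ← map_pow] at this
    exact this
  have hin : ∀ d, inr hx d ∈ E := by
    have hri : ∀ i : ZMod 8, inr hx (r i) ∈ E := by
      intro i
      have := pow_mem h1 i.val
      rw [← map_pow, r_one_pow, ZMod.natCast_zmod_val] at this
      exact this
    rintro (i | i)
    · exact hri i
    · have := mul_mem hw (hri (i - 4))
      rwa [← map_mul, sr_mul_r, add_sub_cancel] at this
  have he : (⟨(1, 0), 1⟩ : ModelGroup hx) ∈ E := by
    have := mul_mem hr (hin (sr 7))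
    rw [R_mul_T, inr] at this
    convert this using 1
    apply ModelGroup.ext
    · simp [mul_def]
    · rfl
  have htr : ∀ i : ZMod m, (⟨(i, 0), 1⟩ : ModelGroup hx) ∈ E := by
    intro i
    have := pow_mem he i.val
    rwa [translation_pow, ZMod.natCast_zmod_val] at this
  rw [eq_top_iff]
  rintro ⟨⟨i, j⟩, d⟩ -
  have := mul_mem (mul_mem (htr i) (mul_mem (mul_mem (hin (sr 0)) (htr j)) (hin (sr 0)))) (hin d)
  convert this using 1
  apply ModelGroup.ext
  · simp [mul_def, inr, action_sr_zero]
  · change d = 1 * (sr 0 * 1 * sr 0) * d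
    simp

end ModelGroup

/-! ### Recognizing complete bipartite graphs, and the maps of the model groups -/

namespace CombMap

/-- A coloured map in which edges are determined by their ends is an embedding of a complete
bipartite graph as soon as it has the right numbers of vertices and edges. -/
theorem IsColouring.isEmbeddingOf {M : CombMap} {c : M.Flag → Bool} (hc : M.IsColouring c) {n : ℕ}
    (hV : Nat.card M.Vertex = 2 * n) (hE : Nat.card M.Edge = n * n) :
    M.IsEmbeddingOf (completeBipartiteGraph (Fin n) (Fin n)) := by
  have := M.finite_flag
  have : Finite M.Vertex := Finite.of_surjective _ M.vertexOf_surjective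
  have : Finite M.Edge := Finite.of_surjective _ M.edgeOf_surjective
  -- colours of vertices
  have hcv : ∀ x y, M.vertexOf x = M.vertexOf y → c x = c y := by
    intro x y hxy
    obtain ⟨γ, hγ, rfl⟩ := M.vertexOf_eq_iff.1 hxy
    exact (hc.closure_rho_tau_le_colourSubgroup hγ).2 y
  let col : M.Vertex → Bool := fun v => c (M.vertexOf_surjective v).choose
  have hcol : ∀ x, col (M.vertexOf x) = c x := fun x =>
    hcv _ _ (M.vertexOf_surjective (M.vertexOf x)).choose_spec
  -- both colour classes have `n` elements
  have hrep : ∀ e, ∃ x, M.edgeOf x = e ∧ c x = true := by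
    intro e
    obtain ⟨x, rfl⟩ := M.edgeOf_surjective e
    rcases hx : c x
    · exact ⟨M.lam x, M.edgeOf_eq_iff.2 (by simp), by rw [hc.lam, hx]; rfl⟩
    · exact ⟨x, rfl, hx⟩
  choose rep hrep1 hrep2 using hrep
  let F : M.Edge → {v // col v = true} × {v // ¬ col v = true} := fun e =>
    (⟨M.vertexOf (rep e), by rw [hcol, hrep2]⟩,
      ⟨M.vertexOf (M.lam (rep e)), by rw [hcol, hc.lam, hrep2]; decide⟩)
  have hF : Function.Injective F := by
    intro e e' h
    rw [Prod.ext_iff] at h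
    rw [← hrep1 e, ← hrep1 e']
    exact hc.edgeOf_eq _ _ (Subtype.ext_iff.1 h.1) (Subtype.ext_iff.1 h.2)
  have hle := Nat.card_le_card_of_injective F hF
  have hsum := Nat.card_congr (Equiv.sumCompl (fun v => col v = true))
  rw [Nat.card_sum, hV] at hsum
  rw [Nat.card_prod, hE] at hle
  -- Two numbers with sum `2 * n` and product at least `n ^ 2` are both `n`.
  have hA : Nat.card {v // col v = true} = n := by nlinarith
  have hB : Nat.card {v // ¬ col v = true} = n := by omega
  let eA : {v // col v = true} ≃ Fin n := Finite.equivFinOfCardEq hA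
  let eB : {v // ¬ col v = true} ≃ Fin n := Finite.equivFinOfCardEq hB
  let f : M.Vertex ≃ Fin n ⊕ Fin n :=
    (Equiv.sumCompl (fun v => col v = true)).symm.trans (Equiv.sumCongr eA eB)
  have hf : ∀ v, (f v).isLeft = col v := by
    intro v
    rcases hv : col v with _ | _
    · have : f v = Sum.inr (eB ⟨v, by rw [hv]; decide⟩) := by
        simp only [f, Equiv.trans_apply, Equiv.sumCompl_symm_apply_of_neg (p := fun v => col v = true) (a := v) (by rw [hv]; decide)]
        rfl
      rw [this]; rfl
    · have : f v = Sum.inl (eA ⟨v, hv⟩) := by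
        simp only [f, Equiv.trans_apply, Equiv.sumCompl_symm_apply_of_pos (p := fun v => col v = true) (a := v) hv]
        rfl
      rw [this]; rfl
  -- the ends of an edge
  let ends : M.Edge → (completeBipartiteGraph (Fin n) (Fin n)).edgeSet := fun e =>
    ⟨s(f (M.vertexOf (rep e)), f (M.vertexOf (M.lam (rep e)))), by
      have h1 := hf (M.vertexOf (rep e))
      have h2 := hf (M.vertexOf (M.lam (rep e)))
      rw [hcol, hrep2] at h1
      rw [hcol, hc.lam, hrep2] at h2
      rw [SimpleGraph.mem_edgeSet, completeBipartiteGraph_adj]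
      exact Or.inl ⟨h1, by rw [← Sum.not_isLeft, h2]; decide⟩⟩
  have hends : Function.Injective ends := by
    intro e e' h
    have h1 := Subtype.ext_iff.1 h
    change s(_, _) = s(_, _) at h1
    rw [Sym2.eq_iff] at h1
    rcases h1 with ⟨h1, h2⟩ | ⟨h1, h2⟩
    · rw [← hrep1 e, ← hrep1 e']
      exact hc.edgeOf_eq _ _ (f.injective h1) (f.injective h2)
    · have := hcv _ _ (f.injective h1)
      rw [hrep2, hc.lam, hrep2] at this
      exact absurd this (by decide)
  have hcE : Nat.card (completeBipartiteGraph (Fin n) (Fin n)).edgeSet = n * n := by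
    change (completeBipartiteGraph (Fin n) (Fin n)).edgeSet.ncard = _
    rw [Set.ncard, SimpleGraph.encard_edgeSet_completeBipartiteGraph]
    simp
  have hbij := (Nat.bijective_iff_injective_and_card ends).2 ⟨hends, by rw [hcE, hE]⟩
  refine ⟨f, Equiv.ofBijective ends hbij, fun v e => ?_⟩
  change _ ↔ f v ∈ s(_, _)
  rw [Sym2.mem_iff, f.injective.eq_iff, f.injective.eq_iff]
  constructor
  · rintro ⟨y, rfl, hy⟩
    rw [← hrep1 e] at hy
    rcases M.edgeOf_eq_iff.1 hy with rfl | rfl | rfl | rfl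
    · exact Or.inl rfl
    · exact Or.inr rfl
    · exact Or.inl (M.vertexOf_tau _)
    · exact Or.inr (by rw [M.lam_tau, M.vertexOf_tau])
  · rintro (rfl | rfl)
    · exact ⟨rep e, rfl, hrep1 e⟩
    · exact ⟨_, rfl, (M.edgeOf_eq_iff.2 (by simp)).trans (hrep1 e)⟩

/-- Automorphisms commute with the transitive monodromy group, so one flag determines them. -/
theorem Iso.eq_of_apply_eq {M : CombMap} {φ ψ : Iso M M} {x : M.Flag}
    (h : φ.toEquiv x = ψ.toEquiv x) : φ = ψ := by
  have : φ.toEquiv = ψ.toEquiv := by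
    ext y
    obtain ⟨γ, hγ, rfl⟩ := M.exists_mem_monodromy x y
    have h1 := congrArg (fun σ : Equiv.Perm M.Flag => σ x) (φ.comm hγ)
    have h2 := congrArg (fun σ : Equiv.Perm M.Flag => σ x) (ψ.comm hγ)
    simp only [Equiv.Perm.mul_apply] at h1 h2
    rw [h1, h2, h]
  cases φ
  cases ψ
  congr

end CombMap

open ModelGroup in
/-- The map whose flags are the elements of the model group, its three generators acting by left
multiplication. -/
def modelMap {m : ℕ} [NeZero m] {x : ZMod m} (hx : x * x = 2) (hm : Odd m) : CombMap where
  Flag := ModelGroup hx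
  finite_flag := inferInstance
  nonempty_flag := ⟨1⟩
  lam := MulAction.toPermHom _ _ (L hx)
  rho := MulAction.toPermHom _ _ (R hx)
  tau := MulAction.toPermHom _ _ (T hx)
  lam_mul_self := by rw [← map_mul, L_mul_self, map_one]
  rho_mul_self := by rw [← map_mul, R_mul_self, map_one]
  tau_mul_self := by rw [← map_mul, T_mul_self, map_one]
  lam_ne g h := by
    have h1 : L hx = 1 := mul_eq_right.1 h
    exact absurd (congrArg lin h1) (by change (DihedralGroup.sr 0 : DihedralGroup 8) ≠ 1; decide)
  rho_ne g h := by
    have h1 : R hx = 1 := mul_eq_right.1 h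
    exact absurd (congrArg lin h1) (by change (DihedralGroup.sr 3 : DihedralGroup 8) ≠ 1; decide)
  tau_ne g h := by
    have h1 : T hx = 1 := mul_eq_right.1 h
    exact absurd (congrArg lin h1) (by change (DihedralGroup.r 4 : DihedralGroup 8) ≠ 1; decide)
  lam_tau_comm := by rw [← map_mul, L_mul_T, map_mul]
  transitive := by
    refine ⟨fun a b => ?_⟩
    have h : Subgroup.closure {L hx, R hx, T hx} = ⊤ := by
      rw [eq_top_iff, ← closure_eq_top hm, Subgroup.closure_le]
      have hL : L hx ∈ Subgroup.closure {L hx, R hx, T hx} := Subgroup.subset_closure (by simp)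
      have hR : R hx ∈ Subgroup.closure {L hx, R hx, T hx} := Subgroup.subset_closure (by simp)
      have hT : T hx ∈ Subgroup.closure {L hx, R hx, T hx} := Subgroup.subset_closure (by simp)
      rintro _ (rfl | rfl)
      exacts [mul_mem hR hT, mul_mem hT hL]
    have hmem : b * a⁻¹ ∈ Subgroup.closure {L hx, R hx, T hx} := h ▸ Subgroup.mem_top _
    have := Subgroup.mem_map_of_mem (MulAction.toPermHom (ModelGroup hx) (ModelGroup hx)) hmem
    rw [MonoidHom.map_closure, Set.image_insert_eq, Set.image_pair] at this
    exact ⟨⟨_, this⟩, inv_mul_cancel_right b a⟩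

namespace modelMap

open ModelGroup CombMap DihedralGroup

variable {m : ℕ} [NeZero m] {x : ZMod m} (hx : x * x = 2) (hm : Odd m)

theorem isNonorientable : (modelMap hx hm).IsNonorientable := by
  refine ⟨fun (a b : ModelGroup hx) => ?_⟩
  have hmem : b * a⁻¹ ∈ Subgroup.closure {R hx * T hx, T hx * L hx} :=
    closure_eq_top hm ▸ Subgroup.mem_top _
  have := Subgroup.mem_map_of_mem (MulAction.toPermHom (ModelGroup hx) (ModelGroup hx)) hmem
  rw [MonoidHom.map_closure, Set.image_pair, map_mul, map_mul] at this
  exact ⟨⟨_, this⟩, inv_mul_cancel_right (G := ModelGroup hx) b a⟩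

theorem isRegular : (modelMap hx hm).IsRegular := by
  intro (a : ModelGroup hx) (b : ModelGroup hx)
  let e : Equiv.Perm (ModelGroup hx) := Equiv.mulRight (a⁻¹ * b)
  let φ : Iso (modelMap hx hm) (modelMap hx hm) :=
    ⟨e, fun g => mul_assoc (L hx) g _,
      fun g => mul_assoc (R hx) g _, fun g => mul_assoc (T hx) g _⟩
  have hφ : φ.toEquiv a = b := mul_inv_cancel_left (G := ModelGroup hx) a b
  exact ⟨φ, hφ, fun ψ hψ => Iso.eq_of_apply_eq (hψ.trans hφ.symm)⟩

/-- The colour of a flag of the model map. -/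
def colour : DihedralGroup 8 → Bool
  | .r i => i.val % 2 = 1
  | .sr i => i.val % 2 = 0

-- The vertex stabilizer translates only along the first axis, and its linear parts form the
-- four-group generated by `sr 3` and `r 4`.
omit [NeZero m] in
variable {hx} in
theorem _root_.ModelGroup.exists_of_mem_closure {h : ModelGroup hx}
    (hh : h ∈ Subgroup.closure {R hx, T hx}) : ∃ (i : ZMod m) (d : DihedralGroup 8),
      (d = 1 ∨ d = r 4 ∨ d = sr 7 ∨ d = sr 3) ∧ h = ⟨(i, 0), d⟩ := by
  have key : ∀ d : DihedralGroup 8, (d = 1 ∨ d = r 4 ∨ d = sr 7 ∨ d = sr 3) →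
      (sr 3 * d = 1 ∨ sr 3 * d = r 4 ∨ sr 3 * d = sr 7 ∨ sr 3 * d = sr 3) ∧
      (r 4 * d = 1 ∨ r 4 * d = r 4 ∨ r 4 * d = sr 7 ∨ r 4 * d = sr 3) := by decide
  have hstep : ∀ a : ModelGroup hx, (a = R hx ∨ a = T hx) → ∀ h : ModelGroup hx,
      (∃ (i : ZMod m) (d : DihedralGroup 8),
        (d = 1 ∨ d = r 4 ∨ d = sr 7 ∨ d = sr 3) ∧ h = ⟨(i, 0), d⟩) →
      ∃ (i : ZMod m) (d : DihedralGroup 8),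
        (d = 1 ∨ d = r 4 ∨ d = sr 7 ∨ d = sr 3) ∧ a * h = ⟨(i, 0), d⟩ := by
    rintro a (rfl | rfl) h ⟨i, d, hd, rfl⟩
    · refine ⟨1 - i, sr 3 * d, (key d hd).1, ?_⟩
      rw [R, mul_def, Model.action_sr_three]
      apply ModelGroup.ext
      · simp [sub_eq_add_neg]
      · rfl
    · refine ⟨-i, r 4 * d, (key d hd).2, ?_⟩
      rw [T, mul_def, Model.action_r_four]
      apply ModelGroup.ext
      · simp
      · rfl
  induction hh using Subgroup.closure_induction_left with
  | one => exact ⟨0, 1, Or.inl rfl, rfl⟩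
  | mul_left a ha h _ ih => exact hstep a ha h ih
  | inv_mul_cancel a ha h _ ih =>
    have : a⁻¹ = a := by
      rcases ha with rfl | rfl
      · exact inv_eq_of_mul_eq_one_right R_mul_self
      · exact inv_eq_of_mul_eq_one_right T_mul_self
    rw [this]
    exact hstep a ha h ih

theorem exists_mul_eq_of_vertexOf_eq {g h : ModelGroup hx}
    (hgh : (modelMap hx hm).vertexOf g = (modelMap hx hm).vertexOf h) :
    ∃ (i : ZMod m) (d : DihedralGroup 8),
      (d = 1 ∨ d = r 4 ∨ d = sr 7 ∨ d = sr 3) ∧ (⟨(i, 0), d⟩ : ModelGroup hx) * h = g := by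
  obtain ⟨γ, hγ, hγh⟩ := (modelMap hx hm).vertexOf_eq_iff.1 hgh
  have hmap : (Subgroup.closure {R hx, T hx}).map
      (MulAction.toPermHom (ModelGroup hx) (ModelGroup hx)) =
      Subgroup.closure {(modelMap hx hm).rho, (modelMap hx hm).tau} := by
    rw [MonoidHom.map_closure, Set.image_pair]; rfl
  rw [← hmap] at hγ
  obtain ⟨k, hk, rfl⟩ := hγ
  obtain ⟨i, d, hd, rfl⟩ := ModelGroup.exists_of_mem_closure hk
  exact ⟨i, d, hd, hγh⟩

theorem isColouring : (modelMap hx hm).IsColouring fun g : ModelGroup hx => colour g.lin where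
  lam g := (show ∀ d : DihedralGroup 8, colour (sr 0 * d) = !colour d by decide) (lin g)
  rho g := (show ∀ d : DihedralGroup 8, colour (sr 3 * d) = colour d by decide) (lin g)
  tau g := (show ∀ d : DihedralGroup 8, colour (r 4 * d) = colour d by decide) (lin g)
  edgeOf_eq := fun (g h : ModelGroup hx) h1 h2 => by
    obtain ⟨i, d, hd, rfl⟩ := exists_mul_eq_of_vertexOf_eq hx hm h1
    obtain ⟨i', d', hd', hδh⟩ := exists_mul_eq_of_vertexOf_eq hx hm h2
    change _ * (L hx * h) = L hx * (_ * h) at hδh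
    rw [← mul_assoc, ← mul_assoc, mul_left_inj] at hδh
    rw [L, mul_def, mul_def, map_zero, add_zero, zero_add, Model.action_sr_zero] at hδh
    have e1 := congrArg (fun a => a.trans.2) hδh
    have e2 := congrArg lin hδh
    change 0 = i at e1
    change d' * sr 0 = sr 0 * d at e2
    subst e1
    -- Exchanging the coordinates kills the translation and leaves only the linear parts common to
    -- the stabilizers of both ends of an edge.
    have key : ∀ d d' : DihedralGroup 8, (d = 1 ∨ d = r 4 ∨ d = sr 7 ∨ d = sr 3) →
      (d' = 1 ∨ d' = r 4 ∨ d' = sr 7 ∨ d' = sr 3) → d' * sr 0 = sr 0 * d → d = 1 ∨ d = r 4 := by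
      decide
    refine (modelMap hx hm).edgeOf_eq_iff.2 ?_
    rcases key d d' hd hd' e2 with rfl | rfl
    · exact Or.inl (one_mul h)
    · exact Or.inr (Or.inr (Or.inl rfl))

theorem isEmbeddingOf :
    (modelMap hx hm).IsEmbeddingOf (completeBipartiteGraph (Fin (2 * m)) (Fin (2 * m))) := by
  have hc := isColouring hx hm
  have hreg := isRegular hx hm
  have hcard : Nat.card (modelMap hx hm).Flag = 16 * m ^ 2 := ModelGroup.card hx
  have hm0 : 0 < m := Nat.pos_of_ne_zero (NeZero.ne m)
  have := (modelMap hx hm).finite_flag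
  apply hc.isEmbeddingOf
  · have h1 := hreg.card_flag (IsColouring.closure_rho_tau_le _)
    have h2 : orderOf ((modelMap hx hm).rho * (modelMap hx hm).tau) = 2 * m := by
      rw [← orderOf_R_mul_T (hx := hx) hm]
      have := orderOf_injective (MulAction.toPermHom (ModelGroup hx) (ModelGroup hx))
        MulAction.toPerm_injective (R hx * T hx)
      rw [map_mul] at this
      exact this
    rw [IsColouring.closure_rho_tau, IsRotarySystem.card_dihedralSubgroup _ _ _ _
      (IsColouring.tau_notMem_zpowers _), h2, hcard, ← IsColouring.closure_rho_tau] at h1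
    change _ = Nat.card (modelMap hx hm).Vertex * _ at h1
    -- There are `16 * m ^ 2` flags, with `4 * m` at each vertex.
    apply Nat.eq_of_mul_eq_mul_right (show 0 < 4 * m by omega)
    linarith
  · have h1 := hreg.card_flag (IsColouring.closure_lam_tau_le _)
    rw [hc.card_closure_lam_tau, hcard] at h1
    change _ = Nat.card (modelMap hx hm).Edge * _ at h1
    linarith

theorem isNonorientableRegularEmbedding : (modelMap hx hm).IsNonorientableRegularEmbedding
    (completeBipartiteGraph (Fin (2 * m)) (Fin (2 * m))) :=
  ⟨isEmbeddingOf hx hm, isRegular hx hm, isNonorientable hx hm⟩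

end modelMap

open DihedralGroup ModelGroup Model in
/-- Elements satisfying the relations of the model group define a map intertwining left
multiplication by the generators. -/
theorem ModelGroup.exists_intertwining {m : ℕ} [NeZero m] {x : ZMod m} (hx : x * x = 2)
    {H : Type*} [Group H] {a u e f z : H} {k : ℤ} (hk : (k : ZMod m) = x) (ha : a * a = 1)
    (hu : u * u = 1) (hz : z * z = 1) (he : e ^ m = 1) (hf : f ^ m = 1) (hef : Commute e f)
    (hae : a * e * a = f) (hue : u * e * u = e⁻¹) (huf : u * f * u = f⁻¹) (hze : z * e * z = e)
    (hzf : z * f * z = e ^ k * f⁻¹)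
    (hzu : z * (a * z * a) * (z * (a * z * a)) = u) :
    ∃ F : ModelGroup hx → H, ∀ g, F (L hx * g) = a * F g ∧ F (T hx * g) = u * F g ∧
      F (R hx * g) = e * z * u * F g := by
  have haf : a * f * a = e := by
    rw [← hae, ← mul_assoc, ← mul_assoc, ha, one_mul, mul_assoc, ha, mul_one]
  have hza4 : (z * a) ^ 4 = u := by
    rw [← hzu]
    simp only [pow_succ, pow_zero, one_mul, mul_assoc]
  have hzai : (z * a)⁻¹ = a * z := by
    rw [mul_inv_rev, inv_eq_of_mul_eq_one_right ha, inv_eq_of_mul_eq_one_right hz]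
  have hza8 : (z * a) ^ 8 = 1 := by
    rw [show 8 = 4 + 4 from rfl, pow_add, hza4, hu]
  have hza7 : a * (z * a) ^ 7 = z := by
    rw [eq_inv_of_mul_eq_one_left (show (z * a) ^ 7 * (z * a) = 1 by rw [← pow_succ, hza8]), hzai,
      ← mul_assoc, ha, one_mul]
  -- Since `sr 7 * sr 0 = r 1`, the generator `r 1` must go to `z * a`; the hypothesis on `u` says
  -- `(z * a) ^ 4 = u`, hence `(z * a) ^ 8 = 1`.
  let δ : DihedralGroup 8 →* H := DihedralGroup.liftHom (z * a) a hza8 ha (by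
    rw [hza7, mul_assoc, ha, mul_one])
  have hδL : δ (sr 0) = a := by
    change a * (z * a) ^ 0 = a
    rw [pow_zero, mul_one]
  have hδT : δ (r 4) = u := hza4
  have hδR : δ (sr 3) = z * u := by
    rw [show (sr 3 : DihedralGroup 8) = sr 7 * r 4 from rfl, map_mul, hδT]
    change a * (z * a) ^ 7 * u = _
    rw [hza7]
  have hpow : ∀ {g : H}, g ^ m = 1 → ∀ {i j : ℤ}, (i : ZMod m) = j → g ^ i = g ^ j := by
    intro g hg i j hij
    rw [eq_comm, ZMod.intCast_eq_intCast_iff_dvd_sub] at hij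
    obtain ⟨d, hd⟩ := hij
    rw [← sub_add_cancel i j, hd, zpow_add, zpow_mul, zpow_natCast, hg, one_zpow, one_mul]
  let c : ZMod m → ℤ := fun i => (i.val : ℤ)
  have hc : ∀ i, ((c i : ℤ) : ZMod m) = i := fun i => by simp [c]
  let π : ZMod m × ZMod m → H := fun v => e ^ c v.1 * f ^ c v.2
  have hπ : ∀ (v : ZMod m × ZMod m) (i j : ℤ), (i : ZMod m) = v.1 → (j : ZMod m) = v.2 →
      e ^ i * f ^ j = π v := by
    intro v i j hi hj
    rw [hpow he (hi.trans (hc v.1).symm), hpow hf (hj.trans (hc v.2).symm)]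
  have conj : ∀ {w g h : H}, w * w = 1 → ∀ (i j : ℤ),
      w * (g ^ i * h ^ j) = (w * g * w) ^ i * (w * h * w) ^ j * w := by
    intro w g h hw i j
    have hwi : w⁻¹ = w := inv_eq_of_mul_eq_one_right hw
    have h1 := conj_zpow (i := i) (a := w) (b := g)
    have h2 := conj_zpow (i := j) (a := w) (b := h)
    rw [hwi] at h1 h2
    rw [h1, h2]
    have : w * g ^ i * w * (w * h ^ j * w) * w = w * g ^ i * (w * w) * h ^ j * (w * w) := by group
    rw [this, hw]; group
  have hL : ∀ v, a * π v = π (action hx (sr 0) v) * a := by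
    intro v
    rw [conj ha, hae, haf, (hef.symm.zpow_zpow _ _).eq, action_sr_zero]
  have hT : ∀ v, u * π v = π (action hx (r 4) v) * u := by
    intro v
    rw [conj hu, hue, huf, action_r_four, inv_zpow', inv_zpow', hπ (-v)] <;> simp [hc]
  have hZ : ∀ v, z * π v = π (action hx (sr 7) v) * z := by
    intro v
    rw [conj hz, hze, hzf, ((hef.zpow_left k).inv_right).mul_zpow, ← mul_assoc, ← zpow_mul,
      ← zpow_add, inv_zpow', action_sr_seven, hπ] <;> simp [hc, hk]
  have hR : ∀ v, z * u * π v = π (action hx (sr 3) v) * (z * u) := by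
    intro v
    rw [mul_assoc, hT, ← mul_assoc, hZ, mul_assoc, show (sr 3 : DihedralGroup 8) = sr 7 * r 4 from rfl,
      map_mul, end_mul_apply]
  have hE : ∀ v, e * π v = π ((1, 0) + v) := by
    intro v
    rw [← mul_assoc, ← zpow_one_add, hπ] <;> simp [hc]
  -- It suffices to push each generator past a translation `π v`; multiplicativity of the whole map
  -- is never needed.
  refine ⟨fun g => π g.trans * δ g.lin, fun g => ⟨?_, ?_, ?_⟩⟩
  · change π (0 + action hx (sr 0) g.trans) * δ (sr 0 * g.lin) = a * (π g.trans * δ g.lin)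
    rw [zero_add, map_mul, hδL, ← mul_assoc, ← mul_assoc, hL]
  · change π (0 + action hx (r 4) g.trans) * δ (r 4 * g.lin) = u * (π g.trans * δ g.lin)
    rw [zero_add, map_mul, hδT, ← mul_assoc, ← mul_assoc, hT]
  · change π ((1, 0) + action hx (sr 3) g.trans) * δ (sr 3 * g.lin) =
      e * z * u * (π g.trans * δ g.lin)
    rw [map_mul, hδR, ← hE, mul_assoc e z u, mul_assoc e, ← mul_assoc _ (z * u), ← hR]
    simp only [mul_assoc]

/-! ### Every embedding comes from a model map -/

namespace CombMap

/-- A nonempty set of flags that is closed under the three involutions contains all flags. -/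
theorem forall_of_closed (M : CombMap) {p : M.Flag → Prop} {x : M.Flag} (hx : p x)
    (hl : ∀ y, p y → p (M.lam y)) (hr : ∀ y, p y → p (M.rho y)) (ht : ∀ y, p y → p (M.tau y))
    (y : M.Flag) : p y := by
  obtain ⟨γ, hγ, rfl⟩ := M.exists_mem_monodromy x y
  have hi : ∀ δ ∈ ({M.lam, M.rho, M.tau} : Set (Equiv.Perm M.Flag)), δ⁻¹ = δ := by
    rintro δ (rfl | rfl | rfl)
    exacts [inv_eq_of_mul_eq_one_right M.lam_mul_self, inv_eq_of_mul_eq_one_right M.rho_mul_self,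
      inv_eq_of_mul_eq_one_right M.tau_mul_self]
  have hs : ∀ δ ∈ ({M.lam, M.rho, M.tau} : Set (Equiv.Perm M.Flag)), ∀ y, p y → p (δ y) := by
    rintro δ (rfl | rfl | rfl)
    exacts [hl, hr, ht]
  induction hγ using Subgroup.closure_induction_left with
  | one => exact hx
  | mul_left δ hδ γ _ ih => exact hs δ hδ _ ih
  | inv_mul_cancel δ hδ γ _ ih => rw [hi δ hδ]; exact hs δ hδ _ ih

/-- Every nonorientable regular embedding of `K_{n,n}` is isomorphic to a model map. -/
theorem IsNonorientableRegularEmbedding.exists_iso {M : CombMap} {n : ℕ}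
    (h : M.IsNonorientableRegularEmbedding (completeBipartiteGraph (Fin n) (Fin n))) :
    ∃ (m : ℕ) (_ : NeZero m) (hm : Odd m) (x : ZMod m) (hx : x * x = 2), n = 2 * m ∧
      Nonempty (Iso (modelMap hx hm) M) := by
  obtain ⟨hemb, hreg, hnon⟩ := h
  obtain ⟨hV, hE, c, hc⟩ := hemb.exists_colouring
  have := M.finite_flag
  have hrot := hc.isRotarySystem hreg hV hE
  have ht := hc.t_mem_closure hreg hnon
  have hn := hrot.n_pos
  obtain ⟨m, hnm⟩ := Nat.not_odd_iff_even.1 (hrot.not_odd ht)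
  replace hnm : n = 2 * m := by omega
  have hm : Odd m := Nat.not_even_iff_odd.1 (hrot.not_four_dvd ht hnm)
  have hm0 : NeZero m := ⟨by omega⟩
  obtain ⟨k, hk, hef, hzf, hzz⟩ := hrot.exists_relations ht hnm hm
  have hx : (k : ZMod m) * k = 2 := by
    rw [← ZMod.intCast_zmod_eq_zero_iff_dvd] at hk
    push_cast at hk
    linear_combination hk
  refine ⟨m, hm0, hm, k, hx, hnm, ?_⟩
  obtain ⟨x⟩ := M.nonempty_flag
  have key : ∃ F : ModelGroup hx → Equiv.Perm M.Flag, ∀ g, F (ModelGroup.L hx * g) = M.lam * F g ∧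
      F (ModelGroup.T hx * g) = M.tau * F g ∧ F (ModelGroup.R hx * g) = M.rho * F g := by
    have hcoe : ∀ i : ℤ, ((hc.s ^ i : M.colourSubgroup c) : Equiv.Perm M.Flag) =
        M.lam * (hc.r ^ i : M.colourSubgroup c) * M.lam := fun i => by
      rw [← hc.l_zpow_r]; rfl
    have hrr : (hc.r ^ (m + 1 : ℤ)) * hc.r ^ (m : ℤ) * hc.t = ⟨M.rho, M.rho_mem, hc.rho⟩ := by
      rw [← zpow_add, hrot.rz_mod (j := 1) ⟨1, by rw [hnm]; push_cast; ring⟩, zpow_one]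
      apply Subtype.ext
      change M.rho * M.tau * M.tau = M.rho
      rw [mul_assoc, M.tau_mul_self, mul_one]
    have hdvd : (n : ℤ) ∣ (m + 1) * m := by
      obtain ⟨d, hd⟩ := hm
      exact ⟨d + 1, by rw [hnm, hd]; push_cast; ring⟩
    -- The translations go to `r ^ (m + 1)` and `s ^ (m + 1)`, of order `m`, and `z` is the
    -- half-turn `r ^ m`. Then `e * z * u = r ^ (2m + 1) * t = ρ`.
    obtain ⟨F, hF⟩ := ModelGroup.exists_intertwining hx (H := Equiv.Perm M.Flag) (a := M.lam)
      (u := M.tau) (e := ((hc.r ^ (m + 1 : ℤ) : M.colourSubgroup c) : Equiv.Perm M.Flag))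
      (f := ((hc.s ^ (m + 1 : ℤ) : M.colourSubgroup c) : Equiv.Perm M.Flag))
      (z := ((hc.r ^ (m : ℤ) : M.colourSubgroup c) : Equiv.Perm M.Flag)) (k := k) rfl
      M.lam_mul_self M.tau_mul_self (congrArg Subtype.val (hrot.swap.s_half_mul hnm))
      (congrArg Subtype.val (show (hc.r ^ (m + 1 : ℤ)) ^ m = 1 by
        rw [← zpow_natCast, ← zpow_mul, hrot.r_eq_one_iff.2 hdvd]))
      (congrArg Subtype.val (show (hc.s ^ (m + 1 : ℤ)) ^ m = 1 by
        rw [← zpow_natCast, ← zpow_mul, hrot.s_eq_one_iff.2 hdvd]))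
      (congrArg Subtype.val hef) (hcoe _).symm
      (congrArg Subtype.val ((hrot.t_rz _).trans (zpow_neg _ _)))
      (congrArg Subtype.val ((hrot.t_sz _).trans (zpow_neg _ _)))
      (congrArg Subtype.val (show hc.r ^ (m : ℤ) * hc.r ^ (m + 1 : ℤ) * hc.r ^ (m : ℤ) = hc.r ^ (m + 1 : ℤ) by
        rw [← zpow_add, ← zpow_add]
        exact hrot.rz_mod ⟨1, by rw [hnm]; push_cast; ring⟩))
      (congrArg Subtype.val hzf) (by
        rw [← hcoe]
        exact congrArg Subtype.val hzz)
    refine ⟨F, fun g => ⟨(hF g).1, (hF g).2.1, ?_⟩⟩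
    rw [(hF g).2.2]
    congr 1
    exact congrArg Subtype.val hrr
  obtain ⟨F, hF⟩ := key
  let Φ : (modelMap hx hm).Flag → M.Flag := fun g => F g x
  have hl : ∀ g, Φ ((modelMap hx hm).lam g) = M.lam (Φ g) := fun g =>
    congrArg (fun σ : Equiv.Perm M.Flag => σ x) (hF g).1
  have hτ : ∀ g, Φ ((modelMap hx hm).tau g) = M.tau (Φ g) := fun g =>
    congrArg (fun σ : Equiv.Perm M.Flag => σ x) (hF g).2.1
  have hρ : ∀ g, Φ ((modelMap hx hm).rho g) = M.rho (Φ g) := fun g =>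
    congrArg (fun σ : Equiv.Perm M.Flag => σ x) (hF g).2.2
  -- The image is closed under the three involutions, so it is everything; both maps have `16 * m ^
  -- 2` flags, hence `Φ` is bijective.
  have hsurj : Function.Surjective Φ := by
    apply M.forall_of_closed (p := fun y => ∃ g, Φ g = y) (x := Φ (1 : ModelGroup hx)) ⟨_, rfl⟩
    · rintro _ ⟨g, rfl⟩
      exact ⟨_, hl g⟩
    · rintro _ ⟨g, rfl⟩
      exact ⟨_, hρ g⟩
    · rintro _ ⟨g, rfl⟩
      exact ⟨_, hτ g⟩
  have hfin := (modelMap hx hm).finite_flag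
  have hbij := (Nat.bijective_iff_surjective_and_card Φ).2 ⟨hsurj, by
    rw [hc.card_flag hreg hE, hnm]
    refine (ModelGroup.card hx).trans ?_
    ring⟩
  exact ⟨⟨Equiv.ofBijective Φ hbij, hl, hρ, hτ⟩⟩

end CombMap

/-! ### The parameter is an isomorphism invariant -/

namespace ModelGroup

open DihedralGroup

variable {m : ℕ} {x : ZMod m} {hx : x * x = 2}

/-- The relation from which the parameter of a model map can be read off. -/
theorem relation (k : ℕ) (hk : (k : ZMod m) = x) :
    L hx * (R hx * T hx) ^ 2 * L hx * (R hx * T hx) * (L hx * (R hx * T hx) ^ 2 * L hx) =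
      (R hx * T hx) ^ (2 * k + 1) := by
  have h1 : L hx * (R hx * T hx) ^ 2 * L hx = ⟨(0, 2), 1⟩ := by
    have h2 : (R hx * T hx) ^ 2 = ⟨(2, 0), 1⟩ := by
      have := R_mul_T_pow_even (hx := hx) 1
      simpa using this
    rw [h2, L, mul_def, mul_def, Model.action_sr_zero]
    apply ModelGroup.ext
    · simp
    · rfl
  rw [h1, R_mul_T_pow_odd, R_mul_T, mul_def, mul_def]
  apply ModelGroup.ext
  · simp [Model.action_sr_seven, ← hk]
    ring
  · rfl

theorem eq_of_R_mul_T_pow_eq (hm : Odd m) {i j : ℕ}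
    (h : (R hx * T hx) ^ (2 * i + 1) = (R hx * T hx) ^ (2 * j + 1)) : (i : ZMod m) = j := by
  rw [R_mul_T_pow_odd, R_mul_T_pow_odd] at h
  have h1 := congrArg (fun a => a.trans.1) h
  change ((2 * i + 1 : ℕ) : ZMod m) = ((2 * j + 1 : ℕ) : ZMod m) at h1
  push_cast at h1
  have h2 : IsUnit (2 : ZMod m) := by
    have := (ZMod.isUnit_iff_coprime 2 m).2 (Nat.coprime_two_left.2 hm)
    exact_mod_cast this
  exact h2.mul_left_cancel (add_right_cancel h1)

end ModelGroup

open ModelGroup in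
/-- Isomorphic model maps have the same parameter. -/
theorem modelMap.eq_of_iso {m : ℕ} [NeZero m] (hm : Odd m) {x y : ZMod m} {hx : x * x = 2}
    {hy : y * y = 2} (φ : CombMap.Iso (modelMap hx hm) (modelMap hy hm)) : x = y := by
  let f : ModelGroup hx → ModelGroup hy := φ.toEquiv
  have hL : ∀ g, f (L hx * g) = L hy * f g := φ.map_lam
  have hR : ∀ g, f (R hx * g) = R hy * f g := φ.map_rho
  have hT : ∀ g, f (T hx * g) = T hy * f g := φ.map_tau
  have hrot : ∀ (k : ℕ) g, f ((R hx * T hx) ^ k * g) = (R hy * T hy) ^ k * f g := by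
    intro k g
    induction k with
    | zero => simp
    | succ k ih => rw [pow_succ', mul_assoc, mul_assoc, hR, hT, ih, pow_succ']; simp only [mul_assoc]
  have hrot1 : ∀ g, f (R hx * T hx * g) = R hy * T hy * f g := by simpa using hrot 1
  have hs : ∀ g, f (L hx * (R hx * T hx) ^ 2 * L hx * g) =
      L hy * (R hy * T hy) ^ 2 * L hy * f g := by
    intro g
    rw [mul_assoc, mul_assoc, hL, hrot, hL]
    simp only [mul_assoc]
  -- The relation determining `x` is carried along `f` and compared with the one determining `y`;
  -- cancelling `f 1` equates two odd powers of the same rotation.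
  have h1 := congrArg (fun g => f (g * 1)) (relation (hx := hx) x.val (ZMod.natCast_zmod_val x))
  rw [hrot, mul_assoc, mul_assoc, hs, hrot1, hs, ← mul_assoc, ← mul_assoc,
    relation y.val (ZMod.natCast_zmod_val y), mul_left_inj] at h1
  have := eq_of_R_mul_T_pow_eq hm h1
  rwa [ZMod.natCast_zmod_val, ZMod.natCast_zmod_val, eq_comm] at this

/-! ### Square roots of two modulo `m` -/

/-- Hensel lifting: the derivative `2 * x` is invertible modulo `p`. -/
theorem exists_int_sq_sub_two {p : ℕ} [Fact p.Prime] (hp : p ≠ 2) (h : IsSquare (2 : ZMod p))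
    (a : ℕ) : ∃ x : ℤ, ((p ^ (a + 1) : ℕ) : ℤ) ∣ x * x - 2 := by
  induction a with
  | zero =>
    obtain ⟨y, hy⟩ := h
    obtain ⟨x, rfl⟩ := ZMod.intCast_surjective y
    refine ⟨x, ?_⟩
    rw [zero_add, pow_one, ← ZMod.intCast_zmod_eq_zero_iff_dvd]
    push_cast
    rw [← hy, sub_self]
  | succ a ih =>
    obtain ⟨x, d, hd⟩ := ih
    have hpz : Prime (p : ℤ) := Nat.prime_iff_prime_int.1 Fact.out
    have hp2 : ¬ (p : ℤ) ∣ 2 := fun h2 =>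
      hp ((Nat.prime_dvd_prime_iff_eq Fact.out Nat.prime_two).1 (by exact_mod_cast h2))
    have hx : ¬ (p : ℤ) ∣ 2 * x := by
      intro hx
      rcases hpz.dvd_or_dvd hx with h2 | ⟨e, he⟩
      · exact hp2 h2
      · apply hp2
        refine ⟨x * e - p ^ a * d, ?_⟩
        push_cast at hd
        rw [pow_succ] at hd
        linear_combination -hd + x * he
    obtain ⟨u, v, huv⟩ := (hpz.coprime_iff_not_dvd).2 hx
    -- A Newton step, with `v` the inverse of `2 * x` modulo `p` supplied by the Bézout identity;
    -- the second entry is the exact quotient by `p ^ (a + 2)`.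
    refine ⟨x - p ^ (a + 1) * (v * d), u * d + p ^ a * (v * d) ^ 2, ?_⟩
    push_cast at hd ⊢
    linear_combination hd - (p : ℤ) ^ (a + 1) * d * huv

/-- If `x` and `y` are roots, then `p ^ a` divides `(y - x) * (y + x)`. The prime cannot divide both
factors, as it does not divide `2 * x`, so `y = x` or `y = -x`. -/
theorem card_sq_eq_two_prime_pow {p : ℕ} [Fact p.Prime] (hp : p ≠ 2) (h : IsSquare (2 : ZMod p))
    {a : ℕ} (ha : 1 ≤ a) : Nat.card {x : ZMod (p ^ a) // x * x = 2} = 2 := by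
  obtain ⟨a, rfl⟩ := Nat.exists_eq_add_of_le' ha
  obtain ⟨x, hx⟩ := exists_int_sq_sub_two hp h a
  have hpp : p.Prime := Fact.out
  have hpz : Prime (p : ℤ) := Nat.prime_iff_prime_int.1 Fact.out
  have hp2 : ¬ (p : ℤ) ∣ 2 := fun h2 =>
    hp ((Nat.prime_dvd_prime_iff_eq hpp Nat.prime_two).1 (by exact_mod_cast h2))
  have hpow : ((p ^ (a + 1) : ℕ) : ℤ) = (p : ℤ) ^ (a + 1) := by push_cast; rfl
  have hxp : ¬ (p : ℤ) ∣ x := by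
    intro hd
    apply hp2
    have h1 : (p : ℤ) ∣ x * x - 2 := (dvd_pow_self _ (Nat.succ_ne_zero a)).trans (hpow ▸ hx)
    have h2 := dvd_sub (hd.mul_right x) h1
    simpa using h2
  have hx2 : ((x : ZMod (p ^ (a + 1))) * x) = 2 := by
    rw [← ZMod.intCast_zmod_eq_zero_iff_dvd] at hx
    push_cast at hx
    linear_combination hx
  rw [Nat.card_eq_two_iff]
  refine ⟨⟨x, hx2⟩, ⟨-x, by rw [neg_mul_neg, hx2]⟩, ?_, ?_⟩
  · intro hne
    have h1 : (x : ZMod (p ^ (a + 1))) = -x := Subtype.ext_iff.1 hne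
    have h2 : ((2 * x : ℤ) : ZMod (p ^ (a + 1))) = 0 := by
      push_cast
      linear_combination h1
    rw [ZMod.intCast_zmod_eq_zero_iff_dvd, hpow] at h2
    rcases hpz.dvd_or_dvd ((dvd_pow_self _ (Nat.succ_ne_zero a)).trans h2) with h3 | h3
    · exact hp2 h3
    · exact hxp h3
  · rw [Set.eq_univ_iff_forall]
    rintro ⟨y, hy⟩
    obtain ⟨y, rfl⟩ := ZMod.intCast_surjective y
    have hd : (p : ℤ) ^ (a + 1) ∣ (y - x) * (y + x) := by
      rw [← hpow, ← ZMod.intCast_zmod_eq_zero_iff_dvd]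
      push_cast
      linear_combination hy - hx2
    have key : (p : ℤ) ^ (a + 1) ∣ y - x ∨ (p : ℤ) ^ (a + 1) ∣ y + x := by
      by_cases h1 : (p : ℤ) ∣ y + x
      · right
        have h2 : ¬ (p : ℤ) ∣ y - x := fun h2 => by
          have h3 := dvd_sub h1 h2
          rw [show y + x - (y - x) = 2 * x by ring] at h3
          exact (hpz.dvd_or_dvd h3).elim hp2 hxp
        exact ((hpz.coprime_iff_not_dvd.2 h2).pow_left).dvd_of_dvd_mul_left hd
      · left
        exact ((hpz.coprime_iff_not_dvd.2 h1).pow_left).dvd_of_dvd_mul_right hd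
    rcases key with h1 | h1 <;> rw [← hpow, ← ZMod.intCast_zmod_eq_zero_iff_dvd] at h1 <;>
      push_cast at h1
    · left
      exact Subtype.ext (sub_eq_zero.1 h1)
    · right
      exact Subtype.ext (eq_neg_of_add_eq_zero_left h1)

/-- Chinese remainder theorem, with two roots for each prime power; the congruence modulo `8` makes
2 a square modulo `p i` and excludes `p i = 2`. -/
theorem card_sq_eq_two {k : ℕ} {p a : Fin k → ℕ} (hp : ∀ i, (p i).Prime)
    (hinj : Function.Injective p) (ha : ∀ i, 1 ≤ a i)
    (h8 : ∀ i, (p i : ℤ) ≡ 1 [ZMOD 8] ∨ (p i : ℤ) ≡ -1 [ZMOD 8]) :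
    Nat.card {x : ZMod (∏ i, p i ^ a i) // x * x = 2} = 2 ^ k := by
  have hco : Pairwise (Function.onFun Nat.Coprime fun i => p i ^ a i) := fun i j hij =>
    Nat.Coprime.pow _ _ ((Nat.coprime_primes (hp i) (hp j)).2 (hinj.ne hij))
  let e := ZMod.prodEquivPi (fun i => p i ^ a i) hco
  let E : {x : ZMod (∏ i, p i ^ a i) // x * x = 2} ≃ ∀ i, {x : ZMod (p i ^ a i) // x * x = 2} :=
    (e.toEquiv.subtypeEquiv (q := fun y => ∀ i, y i * y i = 2) (fun x => by
      rw [← e.injective.eq_iff, map_mul, map_ofNat, funext_iff]; rfl)).trans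
      (Equiv.subtypePiEquivPi (p := fun i (b : ZMod (p i ^ a i)) => b * b = 2))
  rw [Nat.card_congr E, Nat.card_pi]
  have : ∀ i, Nat.card {x : ZMod (p i ^ a i) // x * x = 2} = 2 := by
    intro i
    have : Fact (p i).Prime := ⟨hp i⟩
    have hp2 : p i ≠ 2 := by
      intro h2
      have := h8 i
      rw [h2] at this
      revert this
      decide
    refine card_sq_eq_two_prime_pow hp2 ?_ (ha i)
    rw [ZMod.exists_sq_eq_two_iff hp2]
    have := h8 i
    simp only [Int.ModEq] at this
    omega
  simp [this]

/-! ### The classification theorem -/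

open CombMap

theorem theorem1p1 :
    (∀ n : ℕ, (n ≡ 0 [MOD 4] ∨ n ≡ 1 [MOD 4] ∨ n ≡ 3 [MOD 4]) →
      ¬ ∃ M : CombMap,
        M.IsNonorientableRegularEmbedding (completeBipartiteGraph (Fin n) (Fin n))) ∧
    (∀ (n k : ℕ) (p a : Fin k → ℕ),
      (∀ i, (p i).Prime) → Function.Injective p → (∀ i, 1 ≤ a i) →
      n = 2 * ∏ i, p i ^ a i →
      ((∀ i, (p i : ℤ) ≡ 1 [ZMOD 8] ∨ (p i : ℤ) ≡ -1 [ZMOD 8]) →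
        numNonorientableRegularEmbeddings (completeBipartiteGraph (Fin n) (Fin n)) = 2 ^ k) ∧
      ((¬ ∀ i, (p i : ℤ) ≡ 1 [ZMOD 8] ∨ (p i : ℤ) ≡ -1 [ZMOD 8]) →
        numNonorientableRegularEmbeddings (completeBipartiteGraph (Fin n) (Fin n)) = 0)) := by
  refine ⟨?_, ?_⟩
  · rintro n hn ⟨M, hM⟩
    obtain ⟨m, -, ⟨d, hd⟩, -, -, hnm, -⟩ := hM.exists_iso
    simp only [Nat.ModEq] at hn
    omega
  intro n k p a hp hinj ha hn
  set m := ∏ i, p i ^ a i with hm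
  have hm0 : NeZero m := ⟨Finset.prod_ne_zero_iff.2 fun i _ => pow_ne_zero _ (hp i).ne_zero⟩
  refine ⟨fun h8 => ?_, fun h8 => ?_⟩
  · have hodd : Odd m := by
      refine Finset.prod_induction _ Odd (fun _ _ => Odd.mul) odd_one fun i _ => Odd.pow ?_
      refine (hp i).odd_of_ne_two fun h2 => ?_
      have := h8 i
      rw [h2] at this
      revert this
      decide
    let f : {x : ZMod m // x * x = 2} → Quotient isoSetoid := fun x =>
      Quotient.mk isoSetoid (modelMap x.2 hodd)
    have hf : Function.Injective f := by
      intro x y hxy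
      obtain ⟨φ⟩ := Quotient.exact hxy
      exact Subtype.ext (modelMap.eq_of_iso hodd φ)
    have hrange : (fun M : CombMap => Quotient.mk isoSetoid M) ''
        {M | M.IsNonorientableRegularEmbedding (completeBipartiteGraph (Fin n) (Fin n))} =
        Set.range f := by
      apply Set.Subset.antisymm
      · rintro _ ⟨M, hM, rfl⟩
        obtain ⟨m', _, hm', x, hx, hnm, φ⟩ := hM.exists_iso
        obtain rfl : m = m' := by omega
        exact ⟨⟨x, hx⟩, Quotient.sound φ⟩
      · rintro _ ⟨x, rfl⟩
        refine ⟨_, ?_, rfl⟩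
        rw [hn]
        exact modelMap.isNonorientableRegularEmbedding x.2 hodd
    rw [numNonorientableRegularEmbeddings, hrange, ← Set.image_univ, hf.encard_image,
      Set.encard_univ, ENat.card_eq_coe_natCard, card_sq_eq_two hp hinj ha h8]
    simp
  · rw [numNonorientableRegularEmbeddings, Set.encard_eq_zero, Set.image_eq_empty,
      Set.eq_empty_iff_forall_notMem]
    intro M hM
    obtain ⟨m', _, hodd, x, hx, hnm, -⟩ := IsNonorientableRegularEmbedding.exists_iso hM
    obtain rfl : m = m' := by omega
    apply h8
    intro i
    have : Fact (p i).Prime := ⟨hp i⟩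
    have hdvd : p i ∣ m :=
      (dvd_pow_self _ (by have := ha i; omega)).trans (Finset.dvd_prod_of_mem _ (Finset.mem_univ i))
    have hp2 : p i ≠ 2 := by
      intro h2
      rw [h2] at hdvd
      exact (Nat.not_even_iff_odd.2 hodd) (even_iff_two_dvd.2 hdvd)
    have hsq : IsSquare (2 : ZMod (p i)) := by
      refine ⟨ZMod.castHom hdvd (ZMod (p i)) x, ?_⟩
      rw [← map_mul, hx, map_ofNat]
    rw [ZMod.exists_sq_eq_two_iff hp2] at hsq
    simp only [Int.ModEq]
    omega
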